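/- Let $k,l\ge 0$ be integers, let $Z$ be a smooth $(4k+2)$-dimensional spin$^c$ manifold, and let $\xi$ be the complex line bundle associated with the spin$^c$ structure, with underlying real plane bundle $\xi_{\mathbf R}$, $\xi_{\mathbf C}=\xi_{\mathbf R}\otimes\mathbf C$ and $c=c_1(\xi)$. Let $V$ be a real spin vector bundle on $Z$ of rank $16l$, with complexification $V_{\mathbf C}$ and (full) complex spinor bundle $\triangle(V)$, of rank $2^{8l}$. Write $T_{\mathbf C}Z=TZ\otimes\mathbf C$, and for a complex bundle $E$ write $\widetilde E=E-\operatorname{rk}E$, $\wedge_t(E)=\sum_{p\ge0}t^p\wedge^pE$ and $S_t(E)=\sum_{p\ge0}t^pS^pE=\wedge_{-t}(E)^{-1}$, extended to virtual bundles by $\wedge_t(E-F)=\wedge_t(E)/\wedge_t(F)$ and $S_t(E-F)=S_t(E)/S_t(F)$. For $\tau$ in the upper half plane $\mathbf H$ put $q^{s}=e^{2\pi\sqrt{-1}\,\tau s}$ and $$ \begin{aligned} Q_1(Z,\xi,V,\tau)=\Big\{&\widehat A(TZ)\,e^{c/2}\,\mathrm{ch}\Big[\bigotimes_{n=1}^{\infty}S_{q^n}(\widetilde{T_{\mathbf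 C}Z})\otimes\bigotimes_{m=1}^{\infty}\wedge_{-q^m}(\widetilde{\xi_{\mathbf C}})\Big]\Big(\prod_{n=1}^{\infty}(1-q^n)\Big)^{8l}\\ &\cdot\Big[q^l\,\mathrm{ch}\Big(\triangle(V)\otimes\bigotimes_{m=1}^{\infty}\wedge_{q^m}(V_{\mathbf C})\Big)+\mathrm{ch}\Big(\bigotimes_{r=1}^{\infty}\wedge_{-q^{r-1/2}}(V_{\mathbf C})\Big)+\mathrm{ch}\Big(\bigotimes_{s=1}^{\infty}\wedge_{q^{s-1/2}}(V_{\mathbf C})\Big)\Big]\Big\}^{(4k+2)}, \end{aligned} $$ where $\{\cdot\}^{(4k+2)}$ denotes the component of degree $4k+2$. Here the characteristic classes are taken in de Rham cohomology and represented by the Chern–Weil forms of any metric connection on $TZ$ (for any Riemannian metric on $Z$), any metric connection on $V$ and any unitary connection on $\xi$. If $-p_1(Z)+p_1(\xi_{\mathbf R})+p_1(V)=0$ in $H^4(Z;\mathbf R)$, where $p_1$ denotes the first Pontryagin class, then $\tau\mapsto Q_1(Z,\xi,V,\tau)\in H^{4k+2}(Z;\mathbf C)$ is a modular form over $SL_2(\mathbf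 Z)$ of weight $4l+2k$. That is, there are finitely many modular forms $f_1,\dots,f_N$ of weight $4l+2k$ over $SL_2(\mathbf Z)$ (holomorphic on $\mathbf H$, with trivial character, bounded at the cusp) and classes $a_1,\dots,a_N\in H^{4k+2}(Z;\mathbf C)$ with $Q_1(Z,\xi,V,\tau)=\sum_j f_j(\tau)\,a_j$ for all $\tau\in\mathbf H$. -/

import Mathlib

open scoped Manifold ContDiff MatrixGroups UpperHalfPlane

noncomputable section

namespace SpincModular

/-! ### Complex differential forms in coordinates

A complex differential form on an open subset of `ℝⁿ` is a function with values in the exterior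
algebra on the symbols `dx₁, …, dxₙ`; the wedge product is the product of this algebra. -/

/-- The model space `ℝⁿ`. -/
abbrev Coord (n : ℕ) := EuclideanSpace ℝ (Fin n)

/-- The values of complex differential forms of mixed degree: `Λ(dx₁, …, dxₙ) ⊗ ℂ`. -/
abbrev Forms (n : ℕ) := ExteriorAlgebra ℂ (Fin n → ℂ)

/-- The coordinate covector `dxₐ`. -/
def dx {n : ℕ} (a : Fin n) : Forms n := ExteriorAlgebra.ι ℂ (Pi.single a 1)

/-- The basis `dx_S = dx_{s₁} ∧ ⋯ ∧ dx_{sₚ}`, `S = {s₁ < ⋯ < sₚ}`. -/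
def dxBasis (n : ℕ) : Module.Basis (Finset (Fin n)) ℂ (Forms n) :=
  (Pi.basisFun ℂ (Fin n)).ExteriorAlgebra

/-- The space of values of forms of degree `p`. -/
abbrev degreeForms (n p : ℕ) : Submodule ℂ (Forms n) := ⋀[ℂ]^p (Fin n → ℂ)

/-- The component of degree `p` of a form of mixed degree. -/
def component {n : ℕ} (p : ℕ) (w : Forms n) : Forms n :=
  GradedRing.proj (fun i : ℕ => ⋀[ℂ]^i (Fin n → ℂ)) p w

/-- The subalgebra of forms of even degree; it is commutative. -/
def evenForms (n : ℕ) : Subalgebra ℂ (Forms n) :=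
  Algebra.adjoin ℂ {w | ∃ u v : Fin n → ℂ, w = ExteriorAlgebra.ι ℂ u * ExteriorAlgebra.ι ℂ v}

/-- Forms of even degree. -/
abbrev EvenForms (n : ℕ) := ↥(evenForms n)

theorem ι_anticomm {n : ℕ} (u v : Fin n → ℂ) :
    ExteriorAlgebra.ι ℂ u * ExteriorAlgebra.ι ℂ v =
      -(ExteriorAlgebra.ι ℂ v * ExteriorAlgebra.ι ℂ u) := by
  have h := ExteriorAlgebra.ι_sq_zero (R := ℂ) (u + v)
  rw [map_add, mul_add, add_mul, add_mul, ExteriorAlgebra.ι_sq_zero,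
    ExteriorAlgebra.ι_sq_zero, zero_add, add_zero] at h
  exact eq_neg_of_add_eq_zero_right h

theorem evenForms_mul_comm {n : ℕ} (x y : EvenForms n) : x * y = y * x := by
  have h : IsMulCommutative (evenForms n) := Algebra.isMulCommutative_adjoin ℂ (by
    rintro _ ⟨u, v, rfl⟩ _ ⟨u', v', rfl⟩
    have h1 := ι_anticomm v u'
    have h2 := ι_anticomm v v'
    have h3 := ι_anticomm u u'
    have h4 := ι_anticomm u v'
    set a := ExteriorAlgebra.ι ℂ u
    set b := ExteriorAlgebra.ι ℂ v
    set c := ExteriorAlgebra.ι ℂ u'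
    set d := ExteriorAlgebra.ι ℂ v'
    calc a * b * (c * d) = a * (b * c) * d := by noncomm_ring
      _ = -((a * c) * (b * d)) := by rw [h1]; noncomm_ring
      _ = -(c * (a * d) * b) := by rw [h2, h3]; noncomm_ring
      _ = c * d * (a * b) := by rw [h4]; noncomm_ring)
  exact h.is_comm.comm x y

instance evenFormsCommRing (n : ℕ) : CommRing (EvenForms n) :=
  { Subalgebra.toRing (evenForms n) with mul_comm := evenForms_mul_comm }

/-- The even forms at a point are a finite dimensional complex vector space and carry its usual
topology. -/
instance evenFormsTopology (n : ℕ) : TopologicalSpace (EvenForms n) :=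
  moduleTopology ℂ (EvenForms n)

/-- `dx_μ ∧ dx_ν` as an even form. -/
def dxdx {n : ℕ} (μ ν : Fin n) : EvenForms n :=
  ⟨dx μ * dx ν, Algebra.subset_adjoin ⟨_, _, rfl⟩⟩

/-- The partial derivative `∂f/∂x_μ` of a function on (an open subset of) `ℝⁿ`. -/
def pderiv {n : ℕ} {F : Type*} [NormedAddCommGroup F] [NormedSpace ℝ F] (μ : Fin n)
    (f : Coord n → F) (x : Coord n) : F :=
  fderiv ℝ f x (EuclideanSpace.single μ 1)

/-- The exterior derivative `d(∑_S f_S dx_S) = ∑_S ∑_μ ∂f_S/∂x_μ dx_μ ∧ dx_S`. -/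
def extD {n : ℕ} (α : Coord n → Forms n) (x : Coord n) : Forms n :=
  ∑ S : Finset (Fin n), ∑ μ : Fin n,
    pderiv μ (fun y => (dxBasis n).repr (α y) S) x • (dx μ * dxBasis n S)

/-- The Jacobian matrix `(∂φ_a/∂x_b)`. -/
def jac {n : ℕ} (φ : Coord n → Coord n) (x : Coord n) : Matrix (Fin n) (Fin n) ℝ :=
  Matrix.of fun a b => pderiv b φ x a

/-- Pullback of the value of a form along a map with Jacobian matrix `J`:
the algebra homomorphism with `dy_a ↦ ∑_b J_{ab} dx_b`. -/
def pullback {n : ℕ} (J : Matrix (Fin n) (Fin n) ℝ) : Forms n →ₐ[ℂ] Forms n :=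
  ExteriorAlgebra.map (Matrix.toLin' (J.transpose.map (fun t : ℝ => (t : ℂ))))

/-! ### Manifolds, differential forms and bundles with connection -/

/-- A cover of the manifold `Z` by domains of smooth charts. -/
structure ChartCover (n : ℕ) (Z : Type*) [TopologicalSpace Z] [ChartedSpace (Coord n) Z]
    (ι : Type*) where
  /-- the charts -/
  chart : ι → OpenPartialHomeomorph Z (Coord n)
  chart_mem : ∀ i, chart i ∈ IsManifold.maximalAtlas (𝓡 n) ∞ Z
  cover : ∀ z, ∃ i, z ∈ (chart i).source

variable {n : ℕ} {Z : Type*} [TopologicalSpace Z] [ChartedSpace (Coord n) Z] {ι : Type*}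

namespace ChartCover

/-- The image of chart `i`. -/
def dom (C : ChartCover n Z ι) (i : ι) : Set (Coord n) := (C.chart i).target

/-- The point of `Z` with coordinates `x` in chart `i`. -/
def pt (C : ChartCover n Z ι) (i : ι) (x : Coord n) : Z := (C.chart i).symm x

/-- The overlap `U_i ∩ U_j` in the coordinates of chart `i`. -/
def overlap (C : ChartCover n Z ι) (i j : ι) : Set (Coord n) :=
  {x | x ∈ C.dom i ∧ C.pt i x ∈ (C.chart j).source}

/-- The change of coordinates from chart `i` to chart `j`. -/
def trans (C : ChartCover n Z ι) (i j : ι) (x : Coord n) : Coord n := C.chart j (C.pt i x)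

end ChartCover

/-- `α = (α_i)` is a smooth complex differential form of degree `p` on `Z`, given by its expressions
in the charts of the cover. -/
def IsForm (C : ChartCover n Z ι) (p : ℕ) (α : ι → Coord n → Forms n) : Prop :=
  (∀ i, ∀ x ∈ C.dom i, α i x ∈ degreeForms n p) ∧
  (∀ i S, ContDiffOn ℝ ∞ (fun x => (dxBasis n).repr (α i x) S) (C.dom i)) ∧
  (∀ i j, ∀ x ∈ C.overlap i j, α i x = pullback (jac (C.trans i j) x) (α j (C.trans i j x)))

/-- `α = dη` for a smooth complex differential form `η` of degree `p` on `Z`, i.e. `α` is a form of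
degree `p + 1` whose class in the de Rham cohomology `H^{p+1}(Z; ℂ)` is zero. -/
def IsExact (C : ChartCover n Z ι) (p : ℕ) (α : ι → Coord n → Forms n) : Prop :=
  ∃ η : ι → Coord n → Forms n, IsForm C p η ∧ ∀ i, ∀ x ∈ C.dom i, α i x = extD (η i) x

/-- A real vector bundle of rank `r` with a Euclidean metric and a metric connection, given in
orthonormal frames over the sets of the cover: transition functions `g i j` in `O(r)`
(components in the frames `i` and `j` are related by `s_i = g_{ij} s_j`) and connection forms
`∑_μ A i x μ dx_μ` with values in skew matrices (`∇ s = d s_i + A_i s_i` in the frame `i`). -/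
structure EuclideanBundle (C : ChartCover n Z ι) (r : ℕ) where
  /-- transition functions -/
  g : ι → ι → Z → Matrix (Fin r) (Fin r) ℝ
  g_mem : ∀ i j, ∀ z ∈ (C.chart i).source ∩ (C.chart j).source,
    g i j z ∈ Matrix.orthogonalGroup (Fin r) ℝ
  g_smooth : ∀ i j a b, ContDiffOn ℝ ∞ (fun x => g i j (C.pt i x) a b) (C.overlap i j)
  g_cocycle : ∀ i j k, ∀ z ∈ (C.chart i).source ∩ (C.chart j).source ∩ (C.chart k).source,
    g i j z * g j k z = g i k z
  /-- connection forms -/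
  A : ι → Coord n → Fin n → Matrix (Fin r) (Fin r) ℝ
  A_skew : ∀ i μ, ∀ x ∈ C.dom i, (A i x μ).transpose = -A i x μ
  A_smooth : ∀ i μ a b, ContDiffOn ℝ ∞ (fun x => A i x μ a b) (C.dom i)
  A_gauge : ∀ i j μ, ∀ x ∈ C.overlap i j,
    ∑ ν, jac (C.trans i j) x ν μ • A j (C.trans i j x) ν =
      (g i j (C.pt i x)).transpose * A i x μ * g i j (C.pt i x) +
      (g i j (C.pt i x)).transpose *
        Matrix.of fun a b => pderiv μ (fun y => g i j (C.pt i y) a b) x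

/-- The curvature `R = dA + A ∧ A` in the frame `i`, a matrix of `2`-forms. -/
def EuclideanBundle.curvature {C : ChartCover n Z ι} {r : ℕ} (V : EuclideanBundle C r) (i : ι)
    (x : Coord n) : Matrix (Fin r) (Fin r) (EvenForms n) :=
  Matrix.of fun a b => ∑ μ, ∑ ν,
    ((pderiv μ (fun y => V.A i y ν a b) x + (V.A i x μ * V.A i x ν) a b : ℝ) : ℂ) • dxdx μ ν

/-- A Riemannian metric on `Z` with a metric connection on `TZ`. The column `a` of
`frame i x` holds the coordinates, in chart `i`, of the `a`-th vector of the `i`-th orthonormal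
frame of `TZ`. -/
structure TangentConnection (C : ChartCover n Z ι) extends EuclideanBundle C n where
  /-- orthonormal frames of `TZ` -/
  frame : ι → Coord n → Matrix (Fin n) (Fin n) ℝ
  frame_isUnit : ∀ i, ∀ x ∈ C.dom i, IsUnit (frame i x)
  frame_smooth : ∀ i a b, ContDiffOn ℝ ∞ (fun x => frame i x a b) (C.dom i)
  frame_compat : ∀ i j, ∀ x ∈ C.overlap i j,
    jac (C.trans i j) x * frame i x * g i j (C.pt i x) = frame j (C.trans i j x)

/-- A complex line bundle with a Hermitian metric and a unitary connection: transition functions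
`h i j` in `U(1)` (`s_i = h_{ij} s_j`) and connection forms `√-1 ∑_μ a i x μ dx_μ`. -/
structure HermitianLineBundle (C : ChartCover n Z ι) where
  /-- transition functions -/
  h : ι → ι → Z → ℂ
  h_norm : ∀ i j, ∀ z ∈ (C.chart i).source ∩ (C.chart j).source, ‖h i j z‖ = 1
  h_smooth : ∀ i j, ContDiffOn ℝ ∞ (fun x => h i j (C.pt i x)) (C.overlap i j)
  h_cocycle : ∀ i j k, ∀ z ∈ (C.chart i).source ∩ (C.chart j).source ∩ (C.chart k).source,
    h i j z * h j k z = h i k z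
  /-- connection forms, divided by `√-1` -/
  a : ι → Coord n → Fin n → ℝ
  a_smooth : ∀ i μ, ContDiffOn ℝ ∞ (fun x => a i x μ) (C.dom i)
  a_gauge : ∀ i j μ, ∀ x ∈ C.overlap i j,
    Complex.I * ((∑ ν, jac (C.trans i j) x ν μ * a j (C.trans i j x) ν : ℝ) : ℂ) =
      Complex.I * (a i x μ : ℂ) +
      (h i j (C.pt i x))⁻¹ * pderiv μ (fun y => h i j (C.pt i y)) x

/-- The real `2`-form `F` such that `√-1 F` is the curvature of the connection. -/
def HermitianLineBundle.realCurvature {C : ChartCover n Z ι} (ξ : HermitianLineBundle C) (i : ι)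
    (x : Coord n) : EvenForms n :=
  ∑ μ, ∑ ν, ((pderiv μ (fun y => ξ.a i y ν) x : ℝ) : ℂ) • dxdx μ ν

/-- The first Chern form `c₁(ξ) = (√-1/2π) · (√-1 F)`. -/
def HermitianLineBundle.c₁ {C : ChartCover n Z ι} (ξ : HermitianLineBundle C) (i : ι)
    (x : Coord n) : EvenForms n :=
  (Complex.I / (2 * Real.pi)) • (Complex.I • ξ.realCurvature i x)

/-- The curvature of the underlying real plane bundle `ξ_ℝ` in the real frame `(s, √-1 s)`:
`√-1` acts as the rotation `(0, -1; 1, 0)`. -/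
def HermitianLineBundle.curvatureReal {C : ChartCover n Z ι} (ξ : HermitianLineBundle C) (i : ι)
    (x : Coord n) : Matrix (Fin 2) (Fin 2) (EvenForms n) :=
  !![0, -ξ.realCurvature i x; ξ.realCurvature i x, 0]

/-! ### Spin and spin^c structures -/

/-- The standard quadratic form `∑ v_a²` on `ℝʳ`. -/
abbrev stdForm (r : ℕ) : QuadraticForm ℝ (Fin r → ℝ) :=
  QuadraticMap.weightedSumSquares ℝ (fun _ : Fin r => (1 : ℝ))

/-- A spin structure on a Euclidean bundle: a lift of the transition functions to a continuous
cocycle with values in `Spin(r)`. -/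
structure SpinStructure {C : ChartCover n Z ι} {r : ℕ} (V : EuclideanBundle C r) where
  /-- the lifted transition functions -/
  lift : ι → ι → Z → CliffordAlgebra (stdForm r)
  lift_mem : ∀ i j, ∀ z ∈ (C.chart i).source ∩ (C.chart j).source,
    lift i j z ∈ spinGroup (stdForm r)
  lift_covers : ∀ i j, ∀ z ∈ (C.chart i).source ∩ (C.chart j).source, ∀ v : Fin r → ℝ,
    lift i j z * CliffordAlgebra.ι (stdForm r) v =
      CliffordAlgebra.ι (stdForm r) ((V.g i j z).mulVec v) * lift i j z
  lift_cocycle : ∀ i j k, ∀ z ∈ (C.chart i).source ∩ (C.chart j).source ∩ (C.chart k).source,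
    lift i j z * lift j k z = lift i k z
  lift_continuous : ∀ i j (f : CliffordAlgebra (stdForm r) →ₗ[ℝ] ℝ),
    ContinuousOn (fun z => f (lift i j z)) ((C.chart i).source ∩ (C.chart j).source)

/-- A spin^c structure on a Euclidean bundle `T` with associated complex line bundle `ξ`:
a lift of the transition functions of `T` to a continuous cocycle of elements
`[lift, phase]` of `Spin^c(r) = (Spin(r) × U(1))/{±1}`, such that `ξ` has the transition functions
`phase²`. -/
structure SpincStructure {C : ChartCover n Z ι} {r : ℕ} (T : EuclideanBundle C r)
    (ξ : HermitianLineBundle C) where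
  /-- the `Spin`-component, defined up to a common sign with `phase` -/
  lift : ι → ι → Z → CliffordAlgebra (stdForm r)
  /-- the `U(1)`-component -/
  phase : ι → ι → Z → ℂ
  lift_mem : ∀ i j, ∀ z ∈ (C.chart i).source ∩ (C.chart j).source,
    lift i j z ∈ spinGroup (stdForm r)
  phase_norm : ∀ i j, ∀ z ∈ (C.chart i).source ∩ (C.chart j).source, ‖phase i j z‖ = 1
  lift_covers : ∀ i j, ∀ z ∈ (C.chart i).source ∩ (C.chart j).source, ∀ v : Fin r → ℝ,
    lift i j z * CliffordAlgebra.ι (stdForm r) v =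
      CliffordAlgebra.ι (stdForm r) ((T.g i j z).mulVec v) * lift i j z
  phase_sq : ∀ i j, ∀ z ∈ (C.chart i).source ∩ (C.chart j).source,
    phase i j z ^ 2 = ξ.h i j z
  cocycle : ∀ i j k, ∀ z ∈ (C.chart i).source ∩ (C.chart j).source ∩ (C.chart k).source,
    (lift i j z * lift j k z = lift i k z ∧ phase i j z * phase j k z = phase i k z) ∨
    (lift i j z * lift j k z = -lift i k z ∧ phase i j z * phase j k z = -phase i k z)
  continuous : ∀ i j (f : CliffordAlgebra (stdForm r) →ₗ[ℝ] ℝ),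
    ContinuousOn (fun z => f (lift i j z) • phase i j z)
      ((C.chart i).source ∩ (C.chart j).source)

/-- The `i`-th tensor factor of the `a`-th gamma matrix. -/
def gammaFactor (a i : ℕ) : Matrix (Fin 2) (Fin 2) ℂ :=
  if i < a / 2 then !![1, 0; 0, -1]
  else if i = a / 2 then (if a % 2 = 0 then !![0, 1; 1, 0] else !![0, -Complex.I; Complex.I, 0])
  else 1

/-- The gamma matrices `γ₀, …, γ_{2m-1}` (tensor products of Pauli matrices) on the space
`(ℂ²)^{⊗m}` of complex spinors of dimension `2m`; they satisfy `γ_a γ_b + γ_b γ_a = 2 δ_{ab}`. -/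
def gamma (m a : ℕ) : Matrix (Fin m → Fin 2) (Fin m → Fin 2) ℂ :=
  Matrix.of fun s t => ∏ i : Fin m, gammaFactor a i (s i) (t i)

/-- The curvature of the connection on the spinor bundle `△(V)` induced by a metric connection
on `V`, the image `¼ ∑_{a,b} R_{ab} γ_a γ_b` of the curvature `R` of `V` under the spin
representation of the Lie algebra `so(2m)`. Here `V` has rank `r = 2m`. -/
def spinorCurvature (m : ℕ) {r : ℕ} (R : Matrix (Fin r) (Fin r) (EvenForms n)) :
    Matrix (Fin m → Fin 2) (Fin m → Fin 2) (EvenForms n) :=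
  Matrix.of fun s t => ∑ a : Fin r, ∑ b : Fin r,
    ((1 / 4 : ℂ) * (gamma m a * gamma m b) s t) • R a b

/-! ### Characteristic forms

The input `R` is the curvature matrix of a bundle. Its entries have degree `2`, so products of more
than `n / 2` entries vanish and the sums over `j ≤ n` below are the full power series. -/

/-- The exponential `∑_j Xʲ/j!` (of a form of positive degree, or of a matrix of such forms). -/
def expForm (n : ℕ) {B : Type*} [Ring B] [Algebra ℂ B] (X : B) : B :=
  ∑ j ∈ Finset.range (n + 1), ((j.factorial : ℂ)⁻¹) • X ^ j

/-- `exp(√-1 R / 2π)`. -/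
def expCurvature {s : Type*} [Fintype s] [DecidableEq s] (R : Matrix s s (EvenForms n)) :
    Matrix s s (EvenForms n) :=
  expForm n ((Complex.I / (2 * Real.pi)) • R)

/-- The first Pontryagin form `p₁ = -tr(R²)/8π²`. -/
def p₁ {r : ℕ} (R : Matrix (Fin r) (Fin r) (EvenForms n)) : EvenForms n :=
  (-1 / (8 * (Real.pi : ℂ) ^ 2)) • (R * R).trace

/-- `(1 + y)^{-1/2}` for nilpotent `y`, by the binomial series. -/
def rsqrtOneAdd (y : EvenForms n) : EvenForms n :=
  ∑ j ∈ Finset.range (n + 1), ((-1 / 4 : ℂ) ^ j * (Nat.centralBinom j : ℂ)) • y ^ j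

/-- `sinh(X)/X` for a matrix of forms of positive degree. -/
def sinhDiv {r : ℕ} (X : Matrix (Fin r) (Fin r) (EvenForms n)) :
    Matrix (Fin r) (Fin r) (EvenForms n) :=
  ∑ j ∈ Finset.range (n + 1), (((2 * j + 1).factorial : ℂ)⁻¹) • X ^ (2 * j)

/-- The `Â`-form `det^{1/2}(X / sinh X)` with `X = √-1 R / 4π`. -/
def AHat {r : ℕ} (R : Matrix (Fin r) (Fin r) (EvenForms n)) : EvenForms n :=
  rsqrtOneAdd ((sinhDiv ((Complex.I / (4 * Real.pi)) • R)).det - 1)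

/-- The Chern character form `tr exp(√-1 R / 2π)`. -/
def ch {s : Type*} [Fintype s] [DecidableEq s] (R : Matrix s s (EvenForms n)) : EvenForms n :=
  (expCurvature R).trace

/-- The Chern character form `ch(∧ᵖ E)` of the exterior power of a bundle `E` with curvature `R`:
the trace of the endomorphism of `∧ᵖ` induced by `exp(√-1 R / 2π)`. -/
def chExteriorPower {r : ℕ} (p : ℕ) (R : Matrix (Fin r) (Fin r) (EvenForms n)) : EvenForms n :=
  LinearMap.trace (EvenForms n) (⋀[EvenForms n]^p (Fin r → EvenForms n))
    (exteriorPower.map p (Matrix.toLin' (expCurvature R)))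

/-- `ch(∧_t(E))`, `∧_t(E) = ∑_p tᵖ ∧ᵖE`. -/
def chLambda {r : ℕ} (t : ℂ) (R : Matrix (Fin r) (Fin r) (EvenForms n)) : EvenForms n :=
  ∑ p ∈ Finset.range (r + 1), t ^ p • chExteriorPower p R

/-- `ch(∧_t(Ẽ))` for the virtual bundle `Ẽ = E - rk E`; `∧_t(E - F) = ∧_t(E) / ∧_t(F)`. -/
def chLambdaTilde {r : ℕ} (t : ℂ) (R : Matrix (Fin r) (Fin r) (EvenForms n)) : EvenForms n :=
  (((1 + t) ^ r)⁻¹ : ℂ) • chLambda t R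

/-- `ch(S_t(Ẽ))` for the virtual bundle `Ẽ = E - rk E`, where `S_t = ∑_p tᵖ Sᵖ` is the total
symmetric power, `S_t = 1 / ∧_{-t}`. -/
def chSymTilde {r : ℕ} (t : ℂ) (R : Matrix (Fin r) (Fin r) (EvenForms n)) : EvenForms n :=
  Ring.inverse (chLambdaTilde (-t) R)

/-- `q^s = e^{2π√-1 τ s}`. -/
def qpow (τ : ℍ) (s : ℝ) : ℂ := Complex.exp (2 * Real.pi * Complex.I * (τ : ℂ) * s)

/-- The form of mixed degree in the definition of `Q₁(Z, ξ, V, τ)`, where `RT`, `RV`, `Rξ` are the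
curvatures of `TZ`, `V`, `ξ_ℝ`, where `c = c₁(ξ)`, and `V` has rank `16 l`. -/
def Q₁Integrand (l : ℕ) (RT : Matrix (Fin n) (Fin n) (EvenForms n)) (c : EvenForms n)
    (Rξ : Matrix (Fin 2) (Fin 2) (EvenForms n))
    (RV : Matrix (Fin (16 * l)) (Fin (16 * l)) (EvenForms n)) (τ : ℍ) : EvenForms n :=
  AHat RT * expForm n ((1 / 2 : ℂ) • c) *
    ((∏' j : ℕ, chSymTilde (qpow τ (j + 1)) RT) *
      (∏' j : ℕ, chLambdaTilde (-qpow τ (j + 1)) Rξ)) *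
    algebraMap ℂ (EvenForms n) ((∏' j : ℕ, (1 - qpow τ (j + 1))) ^ (8 * l)) *
    (qpow τ l • (ch (spinorCurvature (8 * l) RV) * ∏' j : ℕ, chLambda (qpow τ (j + 1)) RV) +
      (∏' j : ℕ, chLambda (-qpow τ (j + 1 / 2)) RV) +
      (∏' j : ℕ, chLambda (qpow τ (j + 1 / 2)) RV))

/-- The characteristic form `Q₁(Z, ξ, V, τ)`: the component of top degree `n = dim Z`. -/
def Q₁ {C : ChartCover n Z ι} (T : TangentConnection C) (ξ : HermitianLineBundle C) {l : ℕ}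
    (V : EuclideanBundle C (16 * l)) (τ : ℍ) (i : ι) (x : Coord n) : Forms n :=
  component n (Q₁Integrand l (T.curvature i x) (ξ.c₁ i x) (ξ.curvatureReal i x)
    (V.curvature i x) τ : Forms n)

/-- The form `-p₁(Z) + p₁(ξ_ℝ) + p₁(V)`. -/
def pontryaginSum {C : ChartCover n Z ι} (T : TangentConnection C) (ξ : HermitianLineBundle C)
    {r : ℕ} (V : EuclideanBundle C r) (i : ι) (x : Coord n) : Forms n :=
  ((-p₁ (T.curvature i x) + p₁ (ξ.curvatureReal i x) + p₁ (V.curvature i x) : EvenForms n) :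
    Forms n)

/-- A function `τ ↦ Q τ` with values in the forms of top degree `p + 1 = dim Z` (all of which are
closed) induces a modular form of weight `w` over `SL₂(ℤ)` with values in the de Rham cohomology
`H^{p+1}(Z; ℂ)`: there are modular forms `f_j` of weight `w` over `SL₂(ℤ)` and forms `α_j` with
`[Q τ] = ∑_j f_j(τ) [α_j]` for all `τ`. -/
def IsModularInCohomology (C : ChartCover n Z ι) (p : ℕ) (w : ℤ)
    (Q : ℍ → ι → Coord n → Forms n) : Prop :=
  ∃ (N : ℕ) (f : Fin N → ModularForm 𝒮ℒ w) (α : Fin N → ι → Coord n → Forms n),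
    (∀ j, IsForm C (p + 1) (α j)) ∧
    ∀ τ : ℍ, IsExact C p (fun i x => Q τ i x - ∑ j, f j τ • α j i x)

end SpincModular

end

/-!
The three brackets in the definition of `Q₁` correspond to the three even theta functions, which the
modular group permutes. The proof therefore works with triples of functions on the upper half plane
that are permuted in this way (`IsModularTriple`); the sum over the three indices of such a triple is
a modular form. Triples of this kind are the eighth powers of the theta constants, written as eta
quotients (`isModularTriple_theta`), and the Eisenstein series at `2τ`, `τ/2` and `(τ+1)/2`
(`isModularTriple_eisTriple`). In weight two the Eisenstein series is only quasimodular, but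
`isModularTriple_eisTriple_two` shows that the defect is the same for the three indices.

All characteristic forms in `Q₁` are exponentials of linear combinations of the power traces
`tr (√-1 R/2π)ᵏ` of the curvatures, with even `k`: a power series with logarithm `ℓ` has, at a
nilpotent matrix `X`, the determinant `exp (tr ℓ(X))` (`det_nilEval`). The logarithms of `sinh x / x`
and of `1 + t eˣ` give Bernoulli numbers and power sums, which add up to Eisenstein series over the
infinite products. The Chern character of the spinor bundle is treated in the same way, by
`trace_expForm_spinRep`: the two-point function `tr (γ_a γ_b exp S)` of the Clifford generators
determines the logarithmic derivative of `tr (exp S)`. The line bundle `ξ` enters through `e^{c/2}`;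
in degree `4k + 2` only its odd part `sinh (c/2)` contributes (`component_expForm_mul`), and this
supplies the Bernoulli numbers for the Eisenstein series of `ξ_ℝ`, with opposite sign.

As a result (`Q₁_eq`), `Q₁` is the top degree component of `½ c ∑ₛ θₛˡ exp (Eₛ)`, where the
coefficients of `tr (√-1 R/2π)ᵏ` in `Eₛ` are modular triples of weight `k`, except for a multiple
`-eis 2 · P` of the form `P = -p₁(Z) + p₁(ξ_ℝ) + p₁(V)` (`exponent_eq`). Without this multiple, the
forms of degree `2p` in `exp (Eₛ)` have coefficients of weight `p`, so that the component of degree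
`4k + 2` has weight `4l + 2k` (`topComponent_of_mem`). The factor `exp (-eis 2 · P)` differs from one
by a closed multiple of `P`. Since `P` is exact and the power traces are closed, by the Bianchi
identity and the behaviour of the curvature under changes of frames and coordinates
(`IsConnection.trace_pow_mem`), this difference does not affect the cohomology class.
-/

noncomputable section
namespace SpincModular

open UpperHalfPlane ModularForm EisensteinSeries Filter Topology

/-! ### Triples of modular functions permuted by the modular group -/

/-- The point `a τ + b` of the upper half plane, `a > 0`. -/
def affinePoint (a : ℝ) (ha : 0 < a) (b : ℝ) (τ : ℍ) : ℍ :=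
  ⟨a * τ + b, by simpa using mul_pos ha τ.im_pos⟩

theorem mdiff_affinePoint {f : ℍ → ℂ} (hf : MDiff f) (a : ℝ) (ha : 0 < a) (b : ℝ) :
    MDiff (fun τ => f (affinePoint a ha b τ)) := by
  rw [mdifferentiable_iff] at hf ⊢
  have h1 : DifferentiableOn ℂ (fun z : ℂ => (a : ℂ) * z + b) {z | 0 < z.im} := by fun_prop
  have h2 : Set.MapsTo (fun z : ℂ => (a : ℂ) * z + b) {z | 0 < z.im} {z | 0 < z.im} := by
    intro z hz
    simpa using mul_pos ha hz
  refine (hf.comp h1 h2).congr fun z hz => ?_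
  have hz' : 0 < ((a : ℂ) * z + b).im := h2 hz
  simp only [Function.comp_apply, ofComplex_apply_of_im_pos hz, ofComplex_apply_of_im_pos hz']
  rfl

theorem bdd_affinePoint {f : ℍ → ℂ} (hf : IsBoundedAtImInfty f) (a : ℝ) (ha : 0 < a) (b : ℝ) :
    IsBoundedAtImInfty (fun τ => f (affinePoint a ha b τ)) := by
  rw [isBoundedAtImInfty_iff] at hf ⊢
  obtain ⟨M, A, h⟩ := hf
  refine ⟨M, A / a, fun z hz => h _ ?_⟩
  have : (affinePoint a ha b z).im = a * z.im := by
    rw [← coe_im]; simp [affinePoint]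
  rw [this]
  rw [div_le_iff₀ ha] at hz
  linarith

/-- The points `2τ`, `τ/2` and `(τ+1)/2`, which represent the three subgroups of index two of the
lattice `ℤ + ℤτ`. -/
def halfPoint (s : Fin 3) : ℍ → ℍ :=
  ![affinePoint 2 two_pos 0, affinePoint (1 / 2) one_half_pos 0,
    affinePoint (1 / 2) one_half_pos (1 / 2)] s

/-- The permutation of the three indices by `τ ↦ τ + 1`. -/
def permT : Equiv.Perm (Fin 3) := Equiv.swap 1 2

/-- The permutation of the three indices by `τ ↦ -1/τ`. -/
def permS : Equiv.Perm (Fin 3) := Equiv.swap 0 1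

theorem slash_T_apply (f : ℍ → ℂ) (w : ℤ) (τ : ℍ) :
    (f ∣[w] ModularGroup.T) τ = f (ModularGroup.T • τ) := by
  have h : denom (ModularGroup.T : GL (Fin 2) ℝ) τ = 1 := by
    rw [ModularGroup.denom_apply]; simp [ModularGroup.T]
  rw [SL_slash_apply, h]
  simp

/-- A vector valued modular form of weight `w`, holomorphic and bounded at the cusp, whose three
components are permuted by the generators of the modular group in the same way as the three even
theta functions are. -/
structure IsModularTriple (w : ℤ) (f : Fin 3 → ℍ → ℂ) : Prop where
  holo : ∀ s, MDiff (f s)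
  bdd : ∀ s, IsBoundedAtImInfty (f s)
  map_T : ∀ s τ, f s (ModularGroup.T • τ) = f (permT s) τ
  map_S : ∀ s τ, f s (ModularGroup.S • τ) = (τ : ℂ) ^ w * f (permS s) τ

namespace IsModularTriple

variable {w w' : ℤ} {f g : Fin 3 → ℍ → ℂ}

theorem mul (hf : IsModularTriple w f) (hg : IsModularTriple w' g) :
    IsModularTriple (w + w') (f * g) where
  holo s := (hf.holo s).mul (hg.holo s)
  bdd s := (hf.bdd s).mul (hg.bdd s)
  map_T s τ := by simp only [Pi.mul_apply, hf.map_T, hg.map_T]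
  map_S s τ := by
    simp only [Pi.mul_apply, hf.map_S, hg.map_S, zpow_add₀ τ.ne_zero]
    ring

theorem add (hf : IsModularTriple w f) (hg : IsModularTriple w g) : IsModularTriple w (f + g) where
  holo s := (hf.holo s).add (hg.holo s)
  bdd s := (hf.bdd s).add (hg.bdd s)
  map_T s τ := by simp only [Pi.add_apply, hf.map_T, hg.map_T]
  map_S s τ := by
    simp only [Pi.add_apply, hf.map_S, hg.map_S]
    ring

theorem const_smul (hf : IsModularTriple w f) (a : ℂ) : IsModularTriple w (a • f) where
  holo s := (hf.holo s).const_smul a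
  bdd s := by
    have := (hf.bdd s).const_mul_left a
    exact this
  map_T s τ := by simp only [Pi.smul_apply, hf.map_T]
  map_S s τ := by
    simp only [Pi.smul_apply, hf.map_S, smul_eq_mul]
    ring

theorem one : IsModularTriple 0 1 where
  holo s := mdifferentiable_const
  bdd s := Filter.const_boundedAtFilter _ _
  map_T s τ := by simp
  map_S s τ := by simp

theorem pow (hf : IsModularTriple w f) (j : ℕ) : IsModularTriple (j * w) (f ^ j) := by
  induction j with
  | zero => simpa using one
  | succ j ih =>
    rw [pow_succ]
    convert ih.mul hf using 1
    push_cast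
    ring

/-- The sum of the three components is invariant under the full modular group. -/
theorem exists_modularForm (hf : IsModularTriple w f) :
    ∃ F : ModularForm 𝒮ℒ w, ∀ τ, F τ = ∑ s, f s τ := by
  have hS : (fun τ => ∑ s, f s τ) ∣[w] ModularGroup.S = fun τ => ∑ s, f s τ := by
    ext τ
    rw [SlashInvariantForm.slash_S_apply, ← modular_S_smul]
    simp only [hf.map_S, ← Finset.mul_sum]
    rw [Equiv.sum_comp permS (fun s => f s τ), mul_comm, ← mul_assoc, ← zpow_add₀ τ.ne_zero]
    simp
  have hT : (fun τ => ∑ s, f s τ) ∣[w] ModularGroup.T = fun τ => ∑ s, f s τ := by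
    ext τ
    rw [slash_T_apply]
    simp only [hf.map_T]
    rw [Equiv.sum_comp permT (fun s => f s τ)]
  refine ⟨{ toFun := fun τ => ∑ s, f s τ
            slash_action_eq' := ?_
            holo' := ?_
            bdd_at_cusps' := ?_ }, fun τ => rfl⟩
  · rintro A ⟨A, rfl⟩
    exact SlashInvariantForm.slash_action_generators_SL2Z hS hT A
  · change MDiff (fun τ => ∑ s, f s τ)
    simp only [Fin.sum_univ_three]
    exact ((hf.holo 0).add (hf.holo 1)).add (hf.holo 2)
  -- All cusps are translates of `∞`, and the sum is invariant under the translations.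
  · intro c hc
    rw [Subgroup.IsArithmetic.isCusp_iff_isCusp_SL2Z] at hc
    rw [OnePoint.isBoundedAt_iff_forall_SL2Z hc]
    intro γ _
    rw [SlashInvariantForm.slash_action_generators_SL2Z hS hT]
    simp only [Fin.sum_univ_three]
    exact ((hf.bdd 0).add (hf.bdd 1)).add (hf.bdd 2)

end IsModularTriple

theorem coe_T_smul (τ : ℍ) : ((ModularGroup.T • τ : ℍ) : ℂ) = τ + 1 := by
  rw [modular_T_smul]
  simp [add_comm]

theorem coe_S_smul (τ : ℍ) : ((ModularGroup.S • τ : ℍ) : ℂ) = -(τ : ℂ)⁻¹ := by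
  rw [modular_S_smul]
  simp [inv_neg]

/-- A modular form for the full modular group, repeated three times. -/
theorem isModularTriple_const {w : ℤ} (F : ModularForm 𝒮ℒ w) :
    IsModularTriple w (fun _ => F) where
  holo _ := F.holo'
  bdd _ := by
    have h := F.bdd_at_cusps' (c := OnePoint.infty) (by
      rw [Subgroup.IsArithmetic.isCusp_iff_isCusp_SL2Z]
      exact isCusp_SL2Z_iff'.mpr ⟨1, by simp⟩)
    rwa [OnePoint.isBoundedAt_infty_iff] at h
  map_T _ τ := by
    have h := congrFun (F.slash_action_eq' _ ⟨ModularGroup.T, rfl⟩) τ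
    have h2 : ((F : ℍ → ℂ) ∣[w] ModularGroup.T) τ = F τ := h
    rwa [slash_T_apply] at h2
  map_S _ τ := by
    have h := congrFun (F.slash_action_eq' _ ⟨ModularGroup.S, rfl⟩) τ
    have h2 : ((F : ℍ → ℂ) ∣[w] ModularGroup.S) τ = F τ := h
    rw [SlashInvariantForm.slash_S_apply, ← modular_S_smul] at h2
    rw [← h2, mul_comm, mul_assoc, ← zpow_add₀ τ.ne_zero]
    simp

/-! ### Values at the half points -/

theorem halfPoint_zero_coe (τ : ℍ) : (halfPoint 0 τ : ℂ) = 2 * τ := by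
  simp [halfPoint, affinePoint]

theorem halfPoint_one_coe (τ : ℍ) : (halfPoint 1 τ : ℂ) = τ / 2 := by
  simp [halfPoint, affinePoint]; ring

theorem halfPoint_two_coe (τ : ℍ) : (halfPoint 2 τ : ℂ) = (τ + 1) / 2 := by
  simp [halfPoint, affinePoint]; ring

section HalfPoint

variable {g : ℍ → ℂ} {u : ℂ}

theorem halfPoint_zero_T (hT : ∀ τ, g (ModularGroup.T • τ) = u * g τ) (τ : ℍ) :
    g (halfPoint 0 (ModularGroup.T • τ)) = u ^ 2 * g (halfPoint 0 τ) := by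
  have h : halfPoint 0 (ModularGroup.T • τ) =
      ModularGroup.T • ModularGroup.T • halfPoint 0 τ := by
    apply UpperHalfPlane.ext
    simp only [halfPoint_zero_coe, coe_T_smul]
    ring
  rw [h, hT, hT]
  ring

theorem halfPoint_one_T (τ : ℍ) : halfPoint 1 (ModularGroup.T • τ) = halfPoint 2 τ := by
  apply UpperHalfPlane.ext
  simp only [halfPoint_one_coe, halfPoint_two_coe, coe_T_smul]

theorem halfPoint_two_T (τ : ℍ) :
    halfPoint 2 (ModularGroup.T • τ) = ModularGroup.T • halfPoint 1 τ := by
  apply UpperHalfPlane.ext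
  simp only [halfPoint_one_coe, halfPoint_two_coe, coe_T_smul]
  ring

theorem halfPoint_zero_S (τ : ℍ) :
    halfPoint 0 (ModularGroup.S • τ) = ModularGroup.S • halfPoint 1 τ := by
  apply UpperHalfPlane.ext
  simp only [halfPoint_one_coe, halfPoint_zero_coe, coe_S_smul]
  have := τ.ne_zero
  field_simp

theorem halfPoint_one_S (τ : ℍ) :
    halfPoint 1 (ModularGroup.S • τ) = ModularGroup.S • halfPoint 0 τ := by
  apply UpperHalfPlane.ext
  simp only [halfPoint_one_coe, halfPoint_zero_coe, coe_S_smul]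
  have := τ.ne_zero
  field_simp

/-- If `T` multiplies `g` by a cube root of unity and `S` acts on `g` with weight `k` and defect
`e`, then the values of `g` at `(τ + 1)/2` and at its image `(-1/τ + 1)/2` are related through
the intermediate point `(τ - 1)/2`, since the former two are `T • p` and `S T⁻² S • p`. -/
theorem halfPoint_two_S {k : ℤ} {e : ℂ → ℂ} (hT : ∀ τ, g (ModularGroup.T • τ) = u * g τ)
    (hu : u ^ 3 = 1) (hS : ∀ τ : ℍ, g (ModularGroup.S • τ) = (τ : ℂ) ^ k * g τ + e τ) (τ : ℍ) :
    g (halfPoint 2 (ModularGroup.S • τ)) = (τ : ℂ) ^ k * g (halfPoint 2 τ) +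
      ((τ - 1) / (2 * τ) : ℂ) ^ (-k) * (u * e ((τ - 1) / 2) - e ((τ - 1) / (2 * τ))) := by
  set p : ℍ := affinePoint (1 / 2) one_half_pos (-1 / 2) τ with hp
  have hpc : (p : ℂ) = (τ - 1) / 2 := by rw [hp]; simp [affinePoint]; ring
  have hτ := τ.ne_zero
  have hp0 : (τ : ℂ) - 1 ≠ 0 := by
    have := p.ne_zero
    rw [hpc] at this
    intro h
    simp [h] at this
  set x : ℍ := halfPoint 2 (ModularGroup.S • τ) with hx
  have hxc : (x : ℂ) = (τ - 1) / (2 * τ) := by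
    rw [hx, halfPoint_two_coe, coe_S_smul]
    field_simp
    ring
  have h1 : ModularGroup.T • p = halfPoint 2 τ := by
    apply UpperHalfPlane.ext
    rw [coe_T_smul, halfPoint_two_coe, hpc]
    ring
  have h2 : ModularGroup.T • ModularGroup.T • ModularGroup.S • x = ModularGroup.S • p := by
    apply UpperHalfPlane.ext
    simp only [coe_T_smul, coe_S_smul, hpc, hxc]
    field_simp
    ring
  have e1 := hS p
  rw [← h2, hT, hT, hS x, hxc, hpc] at e1
  have e2 := hT p
  rw [h1] at e2
  have hx0 : ((τ - 1) / (2 * τ) : ℂ) ≠ 0 := by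
    apply div_ne_zero hp0
    simpa using hτ
  have e3 : ((τ - 1) / (2 * τ) : ℂ) ^ k * g x = ((τ - 1) / 2 : ℂ) ^ k * g (halfPoint 2 τ) +
      (u * e ((τ - 1) / 2) - e ((τ - 1) / (2 * τ))) := by
    rw [e2]
    linear_combination u * e1 - (((τ - 1) / (2 * τ) : ℂ) ^ k * g x + e ((τ - 1) / (2 * τ))) * hu
  have e4 : ((τ - 1) / 2 : ℂ) = τ * ((τ - 1) / (2 * τ)) := by field_simp
  have e5 : ((τ - 1) / (2 * τ) : ℂ) ^ (-k) * ((τ - 1) / (2 * τ) : ℂ) ^ k = 1 := by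
    rw [← zpow_add₀ hx0]; simp
  nth_rw 1 [e4] at e3
  rw [mul_zpow] at e3
  linear_combination ((τ - 1) / (2 * τ) : ℂ) ^ (-k) * e3 +
    ((τ : ℂ) ^ k * g (halfPoint 2 τ) - g x) * e5

end HalfPoint

/-- The values of `g` at the three half points; the normalization makes them a modular triple of
weight `k` if `g` is a modular form of weight `k`. -/
def halfTriple (k : ℕ) (g : ℍ → ℂ) (s : Fin 3) (τ : ℍ) : ℂ :=
  ![2 ^ k, 1, 1] s * g (halfPoint s τ)

theorem mdiff_halfPoint {f : ℍ → ℂ} (hf : MDiff f) (s : Fin 3) :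
    MDiff (fun τ => f (halfPoint s τ)) := by
  fin_cases s
  · exact mdiff_affinePoint hf 2 two_pos 0
  · exact mdiff_affinePoint hf _ one_half_pos _
  · exact mdiff_affinePoint hf _ one_half_pos _

theorem bdd_halfPoint {f : ℍ → ℂ} (hf : IsBoundedAtImInfty f) (s : Fin 3) :
    IsBoundedAtImInfty (fun τ => f (halfPoint s τ)) := by
  fin_cases s
  · exact bdd_affinePoint hf 2 two_pos 0
  · exact bdd_affinePoint hf _ one_half_pos _
  · exact bdd_affinePoint hf _ one_half_pos _

theorem mdiff_halfTriple {f : ℍ → ℂ} (hf : MDiff f) (k : ℕ) (s : Fin 3) :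
    MDiff (halfTriple k f s) :=
  (mdiff_halfPoint hf s).const_smul (![2 ^ k, 1, 1] s : ℂ)

theorem bdd_halfTriple {f : ℍ → ℂ} (hf : IsBoundedAtImInfty f) (k : ℕ) (s : Fin 3) :
    IsBoundedAtImInfty (halfTriple k f s) :=
  (bdd_halfPoint hf s).const_mul_left (![2 ^ k, 1, 1] s : ℂ)

theorem isModularTriple_halfTriple {k : ℕ} (F : ModularForm 𝒮ℒ k) :
    IsModularTriple k (halfTriple k F) := by
  have hc := isModularTriple_const F
  have hT : ∀ τ, F (ModularGroup.T • τ) = 1 * F τ := fun τ => by rw [hc.map_T 0, one_mul]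
  have hS : ∀ τ : ℍ, F (ModularGroup.S • τ) = (τ : ℂ) ^ (k : ℤ) * F τ + 0 := fun τ => by
    rw [hc.map_S 0, add_zero]
  refine ⟨fun s => mdiff_halfTriple F.holo' k s, fun s => bdd_halfTriple (hc.bdd 0) k s, ?_, ?_⟩
  · intro s τ
    fin_cases s
    · have := halfPoint_zero_T hT τ
      simp only [halfTriple, permT, Fin.zero_eta, Matrix.cons_val_zero, this]
      simp [Equiv.swap_apply_def]
    · simp only [halfTriple, permT, Fin.mk_one, halfPoint_one_T]
      simp
    · simp only [halfTriple, permT, Fin.reduceFinMk, halfPoint_two_T, hT]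
      simp
  · intro s τ
    have hτ := τ.ne_zero
    fin_cases s
    · simp only [halfTriple, permS, Fin.zero_eta, halfPoint_zero_S, hS, halfPoint_one_coe]
      simp only [Equiv.swap_apply_left, Matrix.cons_val_zero, Matrix.cons_val_one, zpow_natCast,
        div_pow]
      field_simp
      ring
    · simp only [halfTriple, permS, Fin.mk_one, halfPoint_one_S, hS, halfPoint_zero_coe]
      simp only [Equiv.swap_apply_right, Matrix.cons_val_zero, Matrix.cons_val_one, zpow_natCast,
        mul_pow]
      ring
    · have := halfPoint_two_S (e := fun _ => 0) hT (by simp) hS τ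
      simp only [halfTriple, permS, Fin.reduceFinMk, this]
      simp [Equiv.swap_apply_def]

/-- The weight two combinations `2 E₂(τ) - 4 E₂(2τ)`, `2 E₂(τ) - E₂(τ/2)`,
`2 E₂(τ) - E₂((τ+1)/2)`, in which the defects of `E₂` cancel. -/
theorem isModularTriple_E2 :
    IsModularTriple 2 (fun s τ => 2 * E2 τ - halfTriple 2 E2 s τ) := by
  have hT : ∀ τ, E2 (ModularGroup.T • τ) = 1 * E2 τ := fun τ => by
    have h := congrFun (E2_slash_action ModularGroup.T) τ
    rw [slash_T_apply, D2_T] at h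
    simpa using h
  -- The value of `c` is irrelevant: the defects cancel because `halfPoint_two_S` is linear in `e`.
  obtain ⟨c, hc⟩ : ∃ c : ℂ, ∀ τ : ℍ,
      E2 (ModularGroup.S • τ) = (τ : ℂ) ^ (2 : ℤ) * E2 τ + c * τ := by
    refine ⟨-(1 / (2 * riemannZeta 2) * (2 * Real.pi * Complex.I)), fun τ => ?_⟩
    have h := congrFun (E2_slash_action ModularGroup.S) τ
    have hτ := τ.ne_zero
    rw [SlashInvariantForm.slash_S_apply, ← modular_S_smul] at h
    simp only [Pi.sub_apply, Pi.smul_apply, D2_S, smul_eq_mul] at h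
    rw [zpow_neg, mul_inv_eq_iff_eq_mul₀ (zpow_ne_zero _ hτ)] at h
    rw [h]
    simp only [zpow_ofNat]
    field_simp
    ring
  have hb : IsBoundedAtImInfty E2 := isBoundedAtImInfty_E2
  refine ⟨fun s => (E2_mdifferentiable.const_smul (2 : ℂ)).sub
    (mdiff_halfTriple E2_mdifferentiable 2 s),
    fun s => (hb.const_mul_left 2).sub (bdd_halfTriple hb 2 s), ?_, ?_⟩
  · intro s τ
    fin_cases s
    · have := halfPoint_zero_T hT τ
      simp only [halfTriple, permT, Fin.zero_eta, Matrix.cons_val_zero, this, hT]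
      simp [Equiv.swap_apply_def]
    · simp only [halfTriple, permT, Fin.mk_one, halfPoint_one_T, hT]
      simp
    · simp only [halfTriple, permT, Fin.reduceFinMk, halfPoint_two_T, hT]
      simp
  · intro s τ
    have hτ := τ.ne_zero
    fin_cases s
    · simp only [halfTriple, permS, Fin.zero_eta, halfPoint_zero_S, hc, halfPoint_one_coe]
      simp only [Equiv.swap_apply_left, Matrix.cons_val_zero, Matrix.cons_val_one, zpow_ofNat]
      ring
    · simp only [halfTriple, permS, Fin.mk_one, halfPoint_one_S, hc, halfPoint_zero_coe]
      simp only [Equiv.swap_apply_right, Matrix.cons_val_zero, Matrix.cons_val_one, zpow_ofNat]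
      ring
    · have := halfPoint_two_S (e := fun z => c * z) hT (by simp) hc τ
      simp only [halfTriple, permS, Fin.reduceFinMk, this, hc]
      simp only [Equiv.swap_apply_def, zpow_neg, zpow_ofNat]
      have hp0 : (τ : ℂ) - 1 ≠ 0 := by
        intro h
        have h1 := congrArg Complex.im h
        simp at h1
        exact τ.im_ne_zero h1
      simp
      field_simp
      ring

/-! ### The eighth powers of the theta constants -/

/-- Euler's product `∏ (1 - qⁿ)`, `n ≥ 1`. -/
def eulerProd (q : ℂ) : ℂ := ∏' j : ℕ, (1 - q ^ (j + 1))

theorem norm_qParam_one_lt (τ : ℍ) : ‖Function.Periodic.qParam 1 (τ : ℂ)‖ < 1 := by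
  simpa using norm_qParam_lt_one 1 τ

theorem eta_eq (τ : ℍ) :
    eta τ = Function.Periodic.qParam 24 (τ : ℂ) * eulerProd (Function.Periodic.qParam 1 τ) := rfl

theorem eulerProd_qParam_ne_zero (τ : ℍ) : eulerProd (Function.Periodic.qParam 1 τ) ≠ 0 :=
  eta_tprod_ne_zero τ.im_pos

theorem tendsto_eulerProd :
    Tendsto (fun τ : ℍ => eulerProd (Function.Periodic.qParam 1 τ)) atImInfty (𝓝 1) := by
  have h : ContinuousAt eulerProd 0 :=
    (differentiableOn_tprod_one_sub_pow.differentiableAt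
      (Metric.ball_mem_nhds 0 one_pos)).continuousAt
  have h0 : eulerProd 0 = 1 := by simp [eulerProd]
  have := h.tendsto
  rw [h0] at this
  exact this.comp (qParam_tendsto_atImInfty one_pos)

/-- The cube root of unity by which `τ ↦ τ + 1` acts on `η⁸`. -/
def cubeRoot : ℂ := Complex.exp (2 * Real.pi * Complex.I / 3)

theorem cubeRoot_pow_three : cubeRoot ^ 3 = 1 := by
  rw [cubeRoot, ← Complex.exp_nat_mul]
  rw [show ((3 : ℕ) : ℂ) * (2 * Real.pi * Complex.I / 3) = 2 * Real.pi * Complex.I by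
    push_cast; ring]
  exact Complex.exp_two_pi_mul_I

theorem cubeRoot_ne_zero : cubeRoot ≠ 0 := Complex.exp_ne_zero _

theorem qParam_T (τ : ℍ) : Function.Periodic.qParam 1 ((ModularGroup.T • τ : ℍ) : ℂ) =
    Function.Periodic.qParam 1 (τ : ℂ) := by
  rw [coe_T_smul]
  rw [Function.Periodic.qParam, Function.Periodic.qParam]
  have := Complex.exp_periodic (2 * Real.pi * Complex.I * τ)
  simpa [mul_add] using this

theorem eta_pow_eight_T (τ : ℍ) : eta (ModularGroup.T • τ : ℍ) ^ 8 = cubeRoot * eta τ ^ 8 := by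
  rw [eta_eq, eta_eq, qParam_T, mul_pow, mul_pow, ← mul_assoc]
  congr 1
  rw [coe_T_smul, Function.Periodic.qParam, Function.Periodic.qParam, cubeRoot,
    ← Complex.exp_nat_mul, ← Complex.exp_nat_mul, ← Complex.exp_add]
  congr 1
  push_cast
  ring

theorem eta_pow_eight_S (τ : ℍ) :
    eta (ModularGroup.S • τ : ℍ) ^ 8 = (τ : ℂ) ^ 4 * eta τ ^ 8 := by
  have h := eta_comp_eq_csqrt_I_inv τ.im_pos
  have h1 : (eta ∘ fun z : ℂ => -1 / z) τ = eta (ModularGroup.S • τ : ℍ) := by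
    rw [coe_S_smul]
    simp [neg_div]
  -- The eighth power removes the ambiguity of the square root.
  have hs : ∀ z : ℂ, z ≠ 0 → Complex.sqrt z ^ 8 = z ^ 4 := by
    intro z hz
    rw [_root_.sqrt_eq_exp hz, ← Complex.exp_nat_mul]
    rw [show ((8 : ℕ) : ℂ) * (Complex.log z / 2) = (4 : ℕ) * Complex.log z by push_cast; ring,
      Complex.exp_nat_mul, Complex.exp_log hz]
  rw [← h1, h]
  simp only [Pi.smul_apply, Pi.mul_apply, smul_eq_mul, mul_pow, inv_pow, hs _ τ.ne_zero,
    hs _ Complex.I_ne_zero, Complex.I_pow_four]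
  ring

/-- The eighth powers of the values at `v = 0` of the theta functions `θ₁`, `θ₂`, `θ₃`, written as
the quotients `2⁸ η(2τ)¹⁶/η(τ)⁸`, `η(τ/2)¹⁶/η(τ)⁸` and `ζ⁻¹ η((τ+1)/2)¹⁶/η(τ)⁸`,
`ζ = e^{2πi/3}`. -/
def thetaTriple (s : Fin 3) (τ : ℍ) : ℂ :=
  ![1, 1, cubeRoot⁻¹] s * halfTriple 8 (fun τ => eta τ ^ 16) s τ / eta τ ^ 8

theorem mdiff_eta : MDiff (fun τ : ℍ => eta τ) := by
  rw [mdifferentiable_iff]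
  refine .congr (fun z hz => (differentiableAt_eta_of_mem_upperHalfPlaneSet
    hz).differentiableWithinAt) fun z hz => ?_
  simp [ofComplex_apply_of_im_pos hz]

theorem qParam_halfPoint_zero (τ : ℍ) : Function.Periodic.qParam 1 (halfPoint 0 τ : ℂ) =
    Function.Periodic.qParam 1 (τ : ℂ) ^ 2 := by
  rw [halfPoint_zero_coe, Function.Periodic.qParam, Function.Periodic.qParam,
    ← Complex.exp_nat_mul]
  congr 1
  push_cast
  ring

theorem qParam_halfPoint_one_sq (τ : ℍ) : Function.Periodic.qParam 1 (halfPoint 1 τ : ℂ) ^ 2 =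
    Function.Periodic.qParam 1 (τ : ℂ) := by
  rw [halfPoint_one_coe, Function.Periodic.qParam, Function.Periodic.qParam,
    ← Complex.exp_nat_mul]
  congr 1
  push_cast
  ring

theorem qParam_halfPoint_two (τ : ℍ) : Function.Periodic.qParam 1 (halfPoint 2 τ : ℂ) =
    -Function.Periodic.qParam 1 (halfPoint 1 τ : ℂ) := by
  rw [halfPoint_two_coe, halfPoint_one_coe, Function.Periodic.qParam, Function.Periodic.qParam,
    ← mul_neg_one, ← Complex.exp_pi_mul_I, ← Complex.exp_add]
  congr 1
  push_cast
  ring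

/-- The powers of `q^{1/24}` in the eta functions combine to an integral power of `q` for `θ₁`, and
cancel for `θ₂` and `θ₃`. -/
theorem thetaTriple_eq (s : Fin 3) (τ : ℍ) : thetaTriple s τ =
    ![2 ^ 8 * Function.Periodic.qParam 1 (τ : ℂ), 1, 1] s *
      eulerProd (Function.Periodic.qParam 1 (halfPoint s τ)) ^ 16 /
      eulerProd (Function.Periodic.qParam 1 τ) ^ 8 := by
  have h1 := eulerProd_qParam_ne_zero τ
  rw [thetaTriple, halfTriple, eta_eq, eta_eq, mul_pow, mul_pow]
  have hq : ∀ z : ℂ, Function.Periodic.qParam 24 z ^ 8 = Complex.exp (2 * Real.pi * Complex.I *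
      z / 3) := fun z => by
    rw [Function.Periodic.qParam, ← Complex.exp_nat_mul]
    congr 1
    push_cast
    ring
  have hq' : ∀ z : ℂ, Function.Periodic.qParam 24 z ^ 16 = Complex.exp (2 * Real.pi * Complex.I *
      z * 2 / 3) := fun z => by
    rw [Function.Periodic.qParam, ← Complex.exp_nat_mul]
    congr 1
    push_cast
    ring
  rw [hq, hq']
  have hE := Complex.exp_ne_zero (2 * Real.pi * Complex.I * τ / 3)
  rw [div_eq_div_iff (mul_ne_zero hE (pow_ne_zero _ h1)) (pow_ne_zero _ h1)]
  fin_cases s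
  · have : Complex.exp (2 * Real.pi * Complex.I * (halfPoint 0 τ) * 2 / 3) =
        Function.Periodic.qParam 1 (τ : ℂ) * Complex.exp (2 * Real.pi * Complex.I * τ / 3) := by
      rw [halfPoint_zero_coe, Function.Periodic.qParam, ← Complex.exp_add]
      congr 1
      push_cast
      ring
    simp only [Fin.zero_eta, this, Matrix.cons_val_zero]
    ring
  · have : Complex.exp (2 * Real.pi * Complex.I * (halfPoint 1 τ) * 2 / 3) =
        Complex.exp (2 * Real.pi * Complex.I * τ / 3) := by
      rw [halfPoint_one_coe]
      congr 1
      ring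
    simp only [Fin.mk_one, this, Matrix.cons_val_one, Matrix.cons_val_zero]
    ring
  · have : Complex.exp (2 * Real.pi * Complex.I * (halfPoint 2 τ) * 2 / 3) =
        cubeRoot * Complex.exp (2 * Real.pi * Complex.I * τ / 3) := by
      rw [halfPoint_two_coe, cubeRoot, ← Complex.exp_add]
      congr 1
      ring
    simp only [Fin.reduceFinMk, this, Matrix.cons_val]
    have := cubeRoot_ne_zero
    field_simp

/-- The eta quotients inherit their transformation law from `η⁸`, on which `T` acts by a cube root of
unity and `S` with weight four. -/
theorem isModularTriple_theta : IsModularTriple 4 thetaTriple where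
  holo s := by
    have h8 : MDiff (fun τ : ℍ => (eta τ ^ 8)⁻¹) := by
      rw [mdifferentiable_iff]
      intro z hz
      have := (((differentiableAt_eta_of_mem_upperHalfPlaneSet hz).pow 8).inv
        (pow_ne_zero _ (eta_ne_zero hz))).differentiableWithinAt (s := {z | 0 < z.im})
      refine this.congr (fun w hw => ?_) ?_
      · simp [ofComplex_apply_of_im_pos hw]
      · have hz' : 0 < z.im := hz
        simp [ofComplex_apply_of_im_pos hz']
    have := (((mdiff_halfTriple (mdiff_eta.pow 16) 8 s).const_smul
      (![1, 1, cubeRoot⁻¹] s : ℂ)).mul h8)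
    have e : thetaTriple s = _ := funext fun τ => by
      rw [thetaTriple, div_eq_mul_inv]
    rw [e]
    exact this
  bdd s := by
    have hb : IsBoundedAtImInfty fun τ : ℍ => eulerProd (Function.Periodic.qParam 1 τ) :=
      tendsto_eulerProd.isBigO_one ℝ
    have hi : IsBoundedAtImInfty fun τ : ℍ => (eulerProd (Function.Periodic.qParam 1 τ) ^ 8)⁻¹ :=
      ((tendsto_eulerProd.pow 8).inv₀ (by simp)).isBigO_one ℝ
    have hh := bdd_halfPoint (f := fun τ => eulerProd (Function.Periodic.qParam 1 τ) ^ 16)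
      ((tendsto_eulerProd.pow 16).isBigO_one ℝ) s
    have hq : IsBoundedAtImInfty
        fun τ : ℍ => (![2 ^ 8 * Function.Periodic.qParam 1 (τ : ℂ), 1, 1] s : ℂ) := by
      rw [isBoundedAtImInfty_iff]
      refine ⟨2 ^ 8, 0, fun z _ => ?_⟩
      have := (norm_qParam_one_lt z).le
      fin_cases s
      · simpa using this
      · norm_num
      · norm_num
    have := (hq.mul hh).mul hi
    refine this.congr (fun τ => ?_) (fun _ => rfl)
    simp only [Pi.mul_apply, thetaTriple_eq, div_eq_mul_inv]
  map_T s τ := by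
    have hT : ∀ τ : ℍ, eta (ModularGroup.T • τ : ℍ) ^ 16 = cubeRoot ^ 2 * eta τ ^ 16 := fun τ => by
      have := eta_pow_eight_T τ
      rw [show (16 : ℕ) = 8 * 2 from rfl, pow_mul, this]
      ring
    have h3 := cubeRoot_pow_three
    have h0 := cubeRoot_ne_zero
    have hη := pow_ne_zero 8 (eta_ne_zero τ.im_pos)
    simp only [thetaTriple, halfTriple, eta_pow_eight_T]
    fin_cases s
    · have := halfPoint_zero_T (g := fun τ => eta τ ^ 16) hT τ
      simp only [Fin.zero_eta, this]
      simp only [permT, Equiv.swap_apply_def]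
      simp
      field_simp
      linear_combination eta (halfPoint 0 τ) ^ 16 * (eta τ)⁻¹ ^ 8 * h3
    · simp only [Fin.mk_one, halfPoint_one_T]
      simp [permT]
      field_simp
    · simp only [Fin.reduceFinMk, halfPoint_two_T, hT]
      simp [permT]
      field_simp
  map_S s τ := by
    have hS : ∀ τ : ℍ, eta (ModularGroup.S • τ : ℍ) ^ 16 = (τ : ℂ) ^ (8 : ℤ) * eta τ ^ 16 + 0 :=
      fun τ => by
      have := eta_pow_eight_S τ
      rw [show (16 : ℕ) = 8 * 2 from rfl, pow_mul, this]
      rw [zpow_ofNat]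
      ring
    have hT : ∀ τ : ℍ, eta (ModularGroup.T • τ : ℍ) ^ 16 = cubeRoot ^ 2 * eta τ ^ 16 := fun τ => by
      have := eta_pow_eight_T τ
      rw [show (16 : ℕ) = 8 * 2 from rfl, pow_mul, this]
      ring
    have h3 := cubeRoot_pow_three
    have h0 := cubeRoot_ne_zero
    have hη := pow_ne_zero 8 (eta_ne_zero τ.im_pos)
    have hτ := τ.ne_zero
    simp only [thetaTriple, halfTriple, eta_pow_eight_S]
    fin_cases s
    · simp only [Fin.zero_eta, halfPoint_zero_S, hS, halfPoint_one_coe, permS]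
      simp only [zpow_ofNat]
      simp [halfPoint_one_coe]
      field_simp
    · simp only [Fin.mk_one, halfPoint_one_S, hS, halfPoint_zero_coe, permS]
      simp only [zpow_ofNat]
      simp [halfPoint_zero_coe]
      field_simp
    · have := halfPoint_two_S (g := fun τ => eta τ ^ 16) (e := fun _ => 0) hT
        (by rw [← pow_mul, mul_comm, pow_mul, h3, one_pow]) hS τ
      simp only [Fin.reduceFinMk, this, permS]
      simp only [Equiv.swap_apply_def]
      simp only [zpow_ofNat]
      simp
      field_simp

/-! ### Product expansions of the theta constants -/

theorem multipliable_one_add {f : ℕ → ℂ} (hf : Summable fun j => ‖f j‖) :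
    Multipliable fun j => 1 + f j := multipliable_one_add_of_summable hf

theorem summable_norm_pow_succ {q : ℂ} (hq : ‖q‖ < 1) : Summable fun j : ℕ => ‖q ^ (j + 1)‖ := by
  simpa [norm_pow] using
    (summable_nat_add_iff 1).mpr (summable_geometric_of_lt_one (norm_nonneg _) hq)

theorem summable_norm_pow_odd {q : ℂ} (hq : ‖q‖ < 1) :
    Summable fun j : ℕ => ‖q ^ (2 * j + 1)‖ := by
  have := (summable_geometric_of_lt_one (norm_nonneg _) hq).comp_injective
    (i := fun j : ℕ => 2 * j + 1) (fun a b h => by simpa using h)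
  simpa [norm_pow, Function.comp_def] using this

theorem norm_sq_lt_one {q : ℂ} (hq : ‖q‖ < 1) : ‖q ^ 2‖ < 1 := by
  rw [norm_pow]
  exact pow_lt_one₀ (norm_nonneg _) hq two_ne_zero

theorem tprod_one_add_mul_eulerProd {q : ℂ} (hq : ‖q‖ < 1) :
    (∏' j : ℕ, (1 + q ^ (j + 1))) * eulerProd q = eulerProd (q ^ 2) := by
  rw [eulerProd, eulerProd, ← (multipliable_one_add (summable_norm_pow_succ hq)).tprod_mul
    (multipliable_one_sub_pow hq)]
  refine tprod_congr fun j => ?_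
  ring

theorem tprod_one_sub_odd_mul_eulerProd {q : ℂ} (hq : ‖q‖ < 1) :
    (∏' j : ℕ, (1 + -q ^ (2 * j + 1))) * eulerProd (q ^ 2) = eulerProd q := by
  have h1 : Multipliable fun j : ℕ => (1 - q ^ (2 * j + 1)) := by
    simpa [sub_eq_add_neg] using multipliable_one_add (f := fun j => -q ^ (2 * j + 1))
      (by simpa using summable_norm_pow_odd hq)
  have h2 : Multipliable fun j : ℕ => (1 - q ^ (2 * j + 1 + 1)) := by
    have := multipliable_one_sub_pow (norm_sq_lt_one hq)
    refine this.congr fun j => ?_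
    ring
  have h := tprod_even_mul_odd (f := fun j => 1 - q ^ (j + 1)) h1 h2
  rw [eulerProd, eulerProd, ← h]
  congr 1
  refine tprod_congr fun j => ?_
  ring

theorem thetaTriple_zero (τ : ℍ) : thetaTriple 0 τ =
    2 ^ 8 * Function.Periodic.qParam 1 (τ : ℂ) *
      (∏' j : ℕ, (1 + Function.Periodic.qParam 1 (τ : ℂ) ^ (j + 1))) ^ 16 *
      eulerProd (Function.Periodic.qParam 1 (τ : ℂ)) ^ 8 := by
  have h := eulerProd_qParam_ne_zero τ
  rw [thetaTriple_eq, qParam_halfPoint_zero,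
    ← tprod_one_add_mul_eulerProd (norm_qParam_one_lt τ)]
  simp only [Matrix.cons_val_zero]
  field_simp

theorem thetaTriple_one (τ : ℍ) : thetaTriple 1 τ =
      (∏' j : ℕ, (1 + -Function.Periodic.qParam 1 (halfPoint 1 τ : ℂ) ^ (2 * j + 1))) ^ 16 *
      eulerProd (Function.Periodic.qParam 1 (τ : ℂ)) ^ 8 := by
  have h := eulerProd_qParam_ne_zero τ
  rw [thetaTriple_eq, ← tprod_one_sub_odd_mul_eulerProd (norm_qParam_one_lt (halfPoint 1 τ)),
    qParam_halfPoint_one_sq]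
  simp only [Matrix.cons_val_one, Matrix.cons_val_zero]
  field_simp

theorem thetaTriple_two (τ : ℍ) : thetaTriple 2 τ =
      (∏' j : ℕ, (1 + Function.Periodic.qParam 1 (halfPoint 1 τ : ℂ) ^ (2 * j + 1))) ^ 16 *
      eulerProd (Function.Periodic.qParam 1 (τ : ℂ)) ^ 8 := by
  have h := eulerProd_qParam_ne_zero τ
  rw [thetaTriple_eq, ← tprod_one_sub_odd_mul_eulerProd (norm_qParam_one_lt (halfPoint 2 τ)),
    qParam_halfPoint_two, neg_sq, qParam_halfPoint_one_sq]
  have : ∀ j : ℕ, -(-Function.Periodic.qParam 1 (halfPoint 1 τ : ℂ)) ^ (2 * j + 1) =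
      Function.Periodic.qParam 1 (halfPoint 1 τ : ℂ) ^ (2 * j + 1) := fun j => by
    rw [Odd.neg_pow ⟨j, rfl⟩, neg_neg]
  simp only [Matrix.cons_val, this]
  field_simp

/-! ### Lambert series -/

/-- The series `∑ mᵏ xᵐ`, `m ≥ 1`. -/
def powerSum (k : ℕ) (x : ℂ) : ℂ := ∑' m : ℕ, (m + 1 : ℂ) ^ k * x ^ (m + 1)

/-- The Lambert series `∑_{j, m ≥ 1} mᵏ q^{jm}`. -/
def lambert (k : ℕ) (q : ℂ) : ℂ := ∑' j : ℕ, powerSum k (q ^ (j + 1))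

theorem summable_powerSum (k : ℕ) {x : ℂ} (hx : ‖x‖ < 1) :
    Summable fun m : ℕ => (m + 1 : ℂ) ^ k * x ^ (m + 1) := by
  have h := (summable_norm_pow_mul_geometric_of_norm_lt_one k hx).of_norm
  have h' := (summable_nat_add_iff 1).mpr h
  simpa using h'

/-- Only the even terms survive in the sum of the values at `x` and `-x`. -/
theorem powerSum_add_powerSum_neg (k : ℕ) {x : ℂ} (hx : ‖x‖ < 1) :
    powerSum k x + powerSum k (-x) = 2 ^ (k + 1) * powerSum k (x ^ 2) := by
  have h1 : HasSum (fun m : ℕ => (m + 1 : ℂ) ^ k * x ^ (m + 1)) (powerSum k x) :=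
    (summable_powerSum k hx).hasSum
  have h2 : HasSum (fun m : ℕ => (m + 1 : ℂ) ^ k * (-x) ^ (m + 1)) (powerSum k (-x)) :=
    (summable_powerSum k (by simpa using hx)).hasSum
  have h3 : HasSum (fun m : ℕ => (m + 1 : ℂ) ^ k * (x ^ 2) ^ (m + 1)) (powerSum k (x ^ 2)) :=
    (summable_powerSum k (norm_sq_lt_one hx)).hasSum
  refine (h1.add h2).unique ?_
  rw [← zero_add (2 ^ (k + 1) * powerSum k (x ^ 2))]
  refine HasSum.even_add_odd ?_ ?_
  · convert (hasSum_zero : HasSum (fun _ : ℕ => (0 : ℂ)) 0) using 2 with j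
    rw [Odd.neg_pow ⟨j, rfl⟩]
    ring
  · refine (h3.mul_left (2 ^ (k + 1))).congr_fun fun j => ?_
    have e1 : (-x) ^ (2 * j + 1 + 1) = x ^ (2 * j + 1 + 1) := Even.neg_pow ⟨j + 1, by ring⟩ x
    have e2 : (((2 * j + 1 : ℕ) : ℂ) + 1) = 2 * (j + 1) := by push_cast; ring
    rw [e1, e2, mul_pow]
    ring

theorem summable_lambert_prod (k : ℕ) {q : ℂ} (hq : ‖q‖ < 1) :
    Summable fun p : ℕ × ℕ => (p.2 + 1 : ℂ) ^ k * (q ^ (p.1 + 1)) ^ (p.2 + 1) := by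
  have h := summable_prod_mul_pow k hq
  have h' := (Equiv.prodCongr Equiv.pnatEquivNat Equiv.pnatEquivNat).symm.summable_iff.mpr h
  refine h'.congr fun p => ?_
  simp [pow_mul]

theorem summable_lambert (k : ℕ) {q : ℂ} (hq : ‖q‖ < 1) :
    Summable fun j : ℕ => powerSum k (q ^ (j + 1)) :=
  (summable_lambert_prod k hq).prod

theorem hasSum_lambert (k : ℕ) {q : ℂ} (hq : ‖q‖ < 1) :
    HasSum (fun j : ℕ => powerSum k (q ^ (j + 1))) (lambert k q) :=
  (summable_lambert k hq).hasSum

theorem lambert_eq_tsum_sigma (k : ℕ) {q : ℂ} (hq : ‖q‖ < 1) :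
    lambert k q = ∑' n : ℕ+, ArithmeticFunction.sigma k n * q ^ (n : ℕ) := by
  rw [← tsum_prod_pow_eq_tsum_sigma k hq, lambert,
    tsum_pnat_eq_tsum_succ (f := fun d => ∑' c : ℕ+, (c : ℂ) ^ k * q ^ (d * c : ℕ))]
  refine tsum_congr fun j => ?_
  rw [powerSum, tsum_pnat_eq_tsum_succ (f := fun c : ℕ => (c : ℂ) ^ k * q ^ ((j + 1) * c : ℕ))]
  refine tsum_congr fun m => ?_
  rw [pow_mul]
  push_cast
  ring

theorem norm_pow_succ_lt_one {q : ℂ} (hq : ‖q‖ < 1) (j : ℕ) : ‖q ^ (j + 1)‖ < 1 := by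
  rw [norm_pow]
  exact pow_lt_one₀ (norm_nonneg _) hq j.succ_ne_zero

theorem hasSum_powerSum_neg (k : ℕ) {q : ℂ} (hq : ‖q‖ < 1) :
    HasSum (fun j : ℕ => powerSum k (-q ^ (j + 1)))
      (-(lambert k q - 2 ^ (k + 1) * lambert k (q ^ 2))) := by
  have h1 := hasSum_lambert k hq
  have h2 := (hasSum_lambert k (norm_sq_lt_one hq)).mul_left (2 ^ (k + 1))
  rw [neg_sub]
  refine (h2.sub h1).congr_fun fun j => ?_
  have := powerSum_add_powerSum_neg k (norm_pow_succ_lt_one hq j)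
  rw [← pow_mul, mul_comm (j + 1) 2, pow_mul] at this
  linear_combination this

/-- The exponents `2j + 1` are all the exponents without the even ones. -/
theorem hasSum_powerSum_odd (k : ℕ) {q : ℂ} (hq : ‖q‖ < 1) :
    HasSum (fun j : ℕ => powerSum k (q ^ (2 * j + 1)))
      (lambert k q - lambert k (q ^ 2)) := by
  have h1 := hasSum_lambert k hq
  have h2 := hasSum_lambert k (norm_sq_lt_one hq)
  have h3 : Summable fun j : ℕ => powerSum k (q ^ (2 * j + 1)) :=
    h1.summable.comp_injective (i := fun j : ℕ => 2 * j) fun a b h => by simpa using h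
  have h4 : HasSum (fun j : ℕ => powerSum k (q ^ (2 * j + 1 + 1))) (lambert k (q ^ 2)) := by
    refine h2.congr_fun fun j => ?_
    rw [← pow_mul]
    ring_nf
  have h5 := HasSum.even_add_odd (f := fun j => powerSum k (q ^ (j + 1))) h3.hasSum h4
  have h6 := h5.unique h1
  rw [← h6]
  simpa using h3.hasSum

/-! ### Eisenstein series -/

/-- The Eisenstein series `-B_k/2k + ∑ σ_{k-1}(n) qⁿ`. -/
def eis (k : ℕ) (τ : ℍ) : ℂ :=
  -(bernoulli k : ℂ) / (2 * k) + lambert (k - 1) (Function.Periodic.qParam 1 (τ : ℂ))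

theorem eis_eq_E {k : ℕ} (hk : 3 ≤ k) (hk2 : Even k) :
    eis k = fun τ => (-(bernoulli k : ℂ) / (2 * k)) * E hk τ := by
  ext τ
  -- Even Bernoulli numbers do not vanish, since they are multiples of values of the zeta function.
  have hB : (bernoulli k : ℂ) ≠ 0 := by
    obtain ⟨m, rfl⟩ := hk2
    rw [← two_mul]
    have hm : m ≠ 0 := by omega
    have h := riemannZeta_two_mul_nat hm
    intro h0
    rw [h0] at h
    have : riemannZeta (2 * m) ≠ 0 := by
      apply riemannZeta_ne_zero_of_one_lt_re
      have : 1 < 2 * m := by omega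
      have h2 : ((1 : ℕ) : ℝ) < ((2 * m : ℕ) : ℝ) := by exact_mod_cast this
      simpa using h2
    apply this
    rw [h]
    simp
  have hk0 : (k : ℂ) ≠ 0 := by
    have : k ≠ 0 := by omega
    exact_mod_cast this
  rw [eis, lambert_eq_tsum_sigma _ (norm_qParam_one_lt τ), q_expansion_bernoulli hk hk2]
  simp only [zpow_natCast, Function.Periodic.qParam]
  simp
  field_simp
  ring

theorem eis_two : eis 2 = fun τ => (-1 / 24 : ℂ) * E2 τ := by
  ext τ
  rw [eis, lambert_eq_tsum_sigma _ (norm_qParam_one_lt τ), E2_eq_tsum_cexp]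
  rw [bernoulli_two]
  simp only [Nat.add_one_sub_one, Function.Periodic.qParam, Complex.ofReal_one, div_one]
  push_cast
  ring

/-- The logarithmic expansion coefficients of the theta functions `θ₁`, `θ₂`, `θ₃`. -/
def eisTriple (k : ℕ) (s : Fin 3) (τ : ℍ) : ℂ := eis k τ - halfTriple k (eis k) s τ

theorem halfTriple_const_mul (k : ℕ) (a : ℂ) (g : ℍ → ℂ) (s : Fin 3) (τ : ℍ) :
    halfTriple k (fun τ => a * g τ) s τ = a * halfTriple k g s τ := by
  simp only [halfTriple]
  ring

theorem isModularTriple_eis {k : ℕ} (hk : 3 ≤ k) (hk2 : Even k) :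
    IsModularTriple k (fun _ => eis k) := by
  rw [eis_eq_E hk hk2]
  exact (isModularTriple_const (E hk)).const_smul _

theorem isModularTriple_eisTriple {k : ℕ} (hk : 3 ≤ k) (hk2 : Even k) :
    IsModularTriple k (eisTriple k) := by
  have h1 := isModularTriple_eis hk hk2
  have h2 := (isModularTriple_halfTriple (E hk)).const_smul ((bernoulli k : ℂ) / (2 * k))
  convert h1.add h2 using 1
  ext s τ
  simp only [eisTriple, Pi.add_apply, Pi.smul_apply, smul_eq_mul]
  conv_lhs => rw [eis_eq_E hk hk2]
  simp only [halfTriple_const_mul]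
  rw [eis_eq_E hk hk2]
  ring

/-- In weight two the logarithmic coefficients are modular after adding the quasimodular
Eisenstein series. -/
theorem isModularTriple_eisTriple_two :
    IsModularTriple 2 (fun s τ => eisTriple 2 s τ + eis 2 τ) := by
  convert isModularTriple_E2.const_smul (-1 / 24) using 1
  ext s τ
  simp only [eisTriple, Pi.smul_apply, smul_eq_mul]
  rw [eis_two]
  simp only [halfTriple_const_mul]
  ring

end SpincModular
end

noncomputable section
namespace SpincModular

/-! ### Power series in nilpotent elements -/

/-- The value at `X` of the power series `f` truncated after degree `N`; this is the value of `f`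
at `X` if `X ^ (N + 1) = 0`. -/
def nilEval (N : ℕ) (f : PowerSeries ℂ) {A : Type*} [Ring A] [Algebra ℂ A] (X : A) : A :=
  ∑ j ∈ Finset.range (N + 1), PowerSeries.coeff j f • X ^ j

section NilEval

variable {A A' : Type*} [Ring A] [Algebra ℂ A] [Ring A'] [Algebra ℂ A'] {N : ℕ} {X : A}

theorem nilEval_eq_aeval (f : PowerSeries ℂ) (X : A) :
    nilEval N f X = Polynomial.aeval X (PowerSeries.trunc (N + 1) f) := by
  rw [nilEval, Polynomial.aeval_def, PowerSeries.eval₂_trunc_eq_sum_range]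
  refine Finset.sum_congr rfl fun j _ => ?_
  rw [Algebra.smul_def]

theorem map_nilEval (φ : A →ₐ[ℂ] A') (f : PowerSeries ℂ) (X : A) :
    φ (nilEval N f X) = nilEval N f (φ X) := by
  simp [nilEval]

theorem nilEval_add (f g : PowerSeries ℂ) (X : A) :
    nilEval N (f + g) X = nilEval N f X + nilEval N g X := by
  simp [nilEval, add_smul, Finset.sum_add_distrib]

theorem nilEval_smul (a : ℂ) (f : PowerSeries ℂ) (X : A) :
    nilEval N (a • f) X = a • nilEval N f X := by
  simp [nilEval, mul_smul, Finset.smul_sum]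

theorem nilEval_one (X : A) : nilEval N 1 X = 1 := by
  rw [nilEval_eq_aeval]
  simp

theorem nilEval_zero (f : PowerSeries ℂ) :
    nilEval N f (0 : A) = algebraMap ℂ A (PowerSeries.constantCoeff f) := by
  rw [nilEval, Finset.sum_range_succ']
  simp [Algebra.algebraMap_eq_smul_one]

theorem nilEval_mul (hX : X ^ (N + 1) = 0) (f g : PowerSeries ℂ) :
    nilEval N (f * g) X = nilEval N f X * nilEval N g X := by
  simp only [nilEval_eq_aeval]
  rw [← map_mul, ← sub_eq_zero, ← map_sub]
  have hd : (Polynomial.X : Polynomial ℂ) ^ (N + 1) ∣ PowerSeries.trunc (N + 1) (f * g) -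
      PowerSeries.trunc (N + 1) f * PowerSeries.trunc (N + 1) g := by
    rw [Polynomial.X_pow_dvd_iff]
    intro d hd
    rw [Polynomial.coeff_sub, PowerSeries.coeff_trunc, if_pos hd,
      PowerSeries.coeff_mul_eq_coeff_trunc_mul_trunc f g hd, ← Polynomial.coe_mul,
      Polynomial.coeff_coe, sub_self]
  obtain ⟨p, hp⟩ := hd
  rw [hp, map_mul, map_pow, Polynomial.aeval_X, hX, zero_mul]

theorem nilEval_of_le {M : ℕ} (hX : X ^ (N + 1) = 0) (h : N ≤ M) (f : PowerSeries ℂ) :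
    nilEval M f X = nilEval N f X := by
  rw [nilEval, nilEval]
  symm
  apply Finset.sum_subset
  · intro j hj
    simp only [Finset.mem_range] at hj ⊢
    omega
  · intro j _ hj
    rw [pow_eq_zero_of_le (by simpa using hj) hX, smul_zero]

theorem expForm_eq_nilEval (N : ℕ) (X : A) : expForm N X = nilEval N (PowerSeries.exp ℂ) X := by
  rw [expForm, nilEval]
  refine Finset.sum_congr rfl fun j _ => ?_
  simp [PowerSeries.coeff_exp]

theorem expForm_add {Y : A} (hXY : Commute X Y) (hX : X ^ (N + 1) = 0) (hY : Y ^ (N + 1) = 0)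
    (hS : (X + Y) ^ (N + 1) = 0) : expForm N (X + Y) = expForm N X * expForm N Y := by
  let : Module ℚ A := Module.compHom A (algebraMap ℚ ℂ)
  have h : ∀ Z : A, Z ^ (N + 1) = 0 → expForm N Z = IsNilpotent.exp Z := fun Z hZ => by
    rw [IsNilpotent.exp_eq_sum hZ, expForm]
    refine Finset.sum_congr rfl fun j _ => ?_
    change _ = (algebraMap ℚ ℂ ((j.factorial : ℚ)⁻¹)) • Z ^ j
    simp
  rw [h _ hX, h _ hY, h _ hS, IsNilpotent.exp_add_of_commute hXY ⟨_, hX⟩ ⟨_, hY⟩]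

theorem expForm_zero : expForm N (0 : A) = 1 := by
  rw [expForm_eq_nilEval, nilEval_zero]
  simp

theorem expForm_mul_expForm_neg (hX : X ^ (N + 1) = 0) : expForm N X * expForm N (-X) = 1 := by
  rw [← expForm_add (Commute.refl X).neg_right hX (by rw [neg_pow, hX, mul_zero])]
  · rw [add_neg_cancel, expForm_zero]
  · simp

theorem expForm_smul_mul_smul (hX : X ^ (N + 1) = 0) (a b : ℂ) :
    expForm N (a • X) * expForm N (b • X) = expForm N ((a + b) • X) := by
  have h : ∀ c : ℂ, (c • X) ^ (N + 1) = 0 := fun c => by rw [smul_pow, hX, smul_zero]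
  rw [add_smul, expForm_add (((Commute.refl X).smul_left a).smul_right b) (h a) (h b)]
  rw [← add_smul, h]

end NilEval

/-! ### Determinants of power series in a nilpotent matrix -/

section Det

open Polynomial

/-- Jacobi's formula for the derivative of a determinant. -/
theorem derivative_det {R : Type*} [CommRing R] {s : Type*} [Fintype s] [DecidableEq s]
    (M : Matrix s s R[X]) :
    derivative M.det = (M.adjugate * M.map derivative).trace := by
  have h : ∀ i, (M.adjugate * M.map derivative) i i =
      ∑ σ : Equiv.Perm s, (Equiv.Perm.sign σ : ℤ) •
        ((∏ j ∈ Finset.univ.erase i, M (σ j) j) * derivative (M (σ i) i)) := by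
    intro i
    have h1 : (M.adjugate * M.map derivative) i i =
        (M.updateCol i fun j => derivative (M j i)).det := by
      rw [← Matrix.cramer_apply, Matrix.cramer_eq_adjugate_mulVec]
      rfl
    rw [h1, Matrix.det_apply]
    refine Finset.sum_congr rfl fun σ _ => ?_
    rw [← Finset.prod_erase_mul _ _ (Finset.mem_univ i)]
    simp only [Matrix.updateCol_self, Units.smul_def]
    congr 2
    refine Finset.prod_congr rfl fun j hj => ?_
    rw [Matrix.updateCol_ne (Finset.ne_of_mem_erase hj)]
  rw [Matrix.trace]
  simp only [Matrix.diag_apply, h]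
  rw [Finset.sum_comm, Matrix.det_apply, map_sum]
  refine Finset.sum_congr rfl fun σ _ => ?_
  rw [Units.smul_def, map_zsmul, derivative_prod_finset, Finset.smul_sum]

variable {B : Type*} [CommRing B] [Algebra ℂ B] {N : ℕ}

theorem eq_C_of_derivative_eq_zero_of_algebra {p : B[X]} (h : derivative p = 0) : p = C (p.eval 0) := by
  ext j
  rw [coeff_C]
  split_ifs with hj
  · rw [hj, coeff_zero_eq_eval_zero]
  · obtain ⟨i, rfl⟩ := Nat.exists_eq_succ_of_ne_zero hj
    have h1 := congrArg (fun q => coeff q i) h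
    simp only [coeff_derivative, coeff_zero] at h1
    have h2 : ((i + 1 : ℕ) : ℂ) • p.coeff (i + 1) = 0 := by
      rw [Algebra.smul_def, map_natCast, mul_comm]
      simpa using h1
    have h3 : ((i + 1 : ℕ) : ℂ) ≠ 0 := by exact_mod_cast i.succ_ne_zero
    simpa only [smul_smul, inv_mul_cancel₀ h3, one_smul, smul_zero] using
      congrArg (fun q => ((i + 1 : ℕ) : ℂ)⁻¹ • q) h2

theorem derivative_nilEval {a : B[X]} (ha : a ^ (N + 1) = 0) (f : PowerSeries ℂ) :
    derivative (nilEval N f a) = derivative a * nilEval N (PowerSeries.derivative ℂ f) a := by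
  -- The top term of the truncated series differentiates to zero, as seen by differentiating
  -- `a ^ (N + 1) = 0`.
  have h0 : a ^ N * derivative a = 0 := by
    have h1 := congrArg derivative ha
    rw [derivative_pow, derivative_zero] at h1
    have h2 : ((N + 1 : ℕ) : ℂ) • (a ^ N * derivative a) = 0 := by
      rw [Algebra.smul_def, map_natCast, ← mul_assoc]
      simpa using h1
    have h3 : ((N + 1 : ℕ) : ℂ) ≠ 0 := by exact_mod_cast N.succ_ne_zero
    simpa only [smul_smul, inv_mul_cancel₀ h3, one_smul, smul_zero] using
      congrArg (fun q => ((N + 1 : ℕ) : ℂ)⁻¹ • q) h2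
  rw [nilEval, nilEval, derivative_sum, Finset.sum_range_succ', Finset.sum_range_succ, mul_add,
    Finset.mul_sum]
  congr 1
  · refine Finset.sum_congr rfl fun j _ => ?_
    rw [derivative_smul, derivative_pow, PowerSeries.coeff_derivative]
    simp only [Algebra.smul_def, map_mul, map_add, map_natCast, map_one, Nat.add_sub_cancel]
    push_cast
    ring
  · rw [mul_smul_comm, mul_comm, h0, smul_zero]
    simp

/-- The linear differential equation `D' = a' D` in `B[s]`, with `a` nilpotent and `a(0) = 0`, has
the solution `D(0) exp a`. -/
theorem eval_one_eq_of_derivative_eq {D a : B[X]} (ha : a ^ (N + 1) = 0) (ha0 : a.eval 0 = 0)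
    (hD : derivative D = derivative a * D) :
    D.eval 1 = D.eval 0 * expForm N (a.eval 1) := by
  have hna : (-a) ^ (N + 1) = 0 := by rw [neg_pow, ha, mul_zero]
  have h1 : derivative (D * expForm N (-a)) = 0 := by
    rw [expForm_eq_nilEval, derivative_mul, derivative_nilEval hna, PowerSeries.derivative_exp, hD,
      derivative_neg]
    ring
  have h2 := eq_C_of_derivative_eq_zero_of_algebra h1
  let ev : B → (B[X] →ₐ[ℂ] B) := fun t => (aeval t).restrictScalars ℂ
  have hev : ∀ t p, ev t p = p.eval t := fun t p => by
    simp [ev, aeval_def, eval₂_eq_eval_map]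
  have hmap : ∀ t p, (expForm N p : B[X]).eval t = expForm N (p.eval t) := fun t p => by
    rw [← hev, expForm_eq_nilEval, map_nilEval, hev, expForm_eq_nilEval]
  have h3 := congrArg (eval 1) h2
  rw [eval_C, eval_mul, eval_mul, hmap, hmap, eval_neg, eval_neg, ha0, neg_zero, expForm_zero,
    mul_one] at h3
  have h4 : (a.eval 1) ^ (N + 1) = 0 := by rw [← eval_pow, ha, eval_zero]
  have h5 := expForm_mul_expForm_neg h4
  rw [← h3]
  linear_combination -(eval 1 D) * h5

variable {s : Type*} [Fintype s] [DecidableEq s]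

/-- The matrix `s X` of polynomials in the variable `s`; derivatives in `s` replace derivatives of
functions with values in `B`. -/
def scaleMatrix (X : Matrix s s B) : Matrix s s B[X] := (Polynomial.X : B[X]) • X.map C

omit [Algebra ℂ B] in
theorem scaleMatrix_pow (X : Matrix s s B) (j : ℕ) :
    scaleMatrix X ^ j = (Polynomial.X : B[X]) ^ j • (X ^ j).map C := by
  rw [scaleMatrix, _root_.smul_pow, ← RingHom.mapMatrix_apply, ← RingHom.mapMatrix_apply, map_pow]

omit [Algebra ℂ B] in
theorem scaleMatrix_pow_eq_zero {X : Matrix s s B} {j : ℕ} (h : X ^ j = 0) :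
    scaleMatrix X ^ j = 0 := by
  rw [scaleMatrix_pow, h]
  simp

theorem map_eval_nilEval_scaleMatrix (X : Matrix s s B) (f : PowerSeries ℂ) (t : B) :
    (nilEval N f (scaleMatrix X)).map (eval t) = nilEval N f (t • X) := by
  let ev : B[X] →ₐ[ℂ] B := (aeval t).restrictScalars ℂ
  have hev : ∀ p, ev p = p.eval t := fun p => by
    simp [ev, aeval_def, eval₂_eq_eval_map]
  have h := map_nilEval (N := N) ev.mapMatrix f (scaleMatrix X)
  have h1 : ev.mapMatrix (scaleMatrix X) = t • X := by
    ext a b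
    simp [scaleMatrix, hev]
    exact mul_comm _ _
  rw [h1] at h
  rw [← h]
  exact Matrix.ext fun a b => (hev _).symm

theorem map_derivative_nilEval_scaleMatrix {X : Matrix s s B} (hX : X ^ (N + 1) = 0)
    (f : PowerSeries ℂ) :
    (nilEval N f (scaleMatrix X)).map derivative =
      X.map C * nilEval N (PowerSeries.derivative ℂ f) (scaleMatrix X) := by
  have hsum : ∀ (c : ℕ → ℂ), (∑ j ∈ Finset.range (N + 1), c j • scaleMatrix X ^ j).map derivative =
      ∑ j ∈ Finset.range (N + 1), c j • (scaleMatrix X ^ j).map derivative := by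
    intro c
    ext a b
    simp [Matrix.sum_apply]
  have hpow : ∀ j : ℕ, (scaleMatrix X ^ (j + 1)).map derivative =
      ((j : ℂ) + 1) • (X.map C * scaleMatrix X ^ j) := by
    intro j
    rw [scaleMatrix_pow, scaleMatrix_pow, Matrix.mul_smul, ← Matrix.map_mul, ← pow_succ']
    ext a b : 1
    change derivative ((Polynomial.X : B[X]) ^ (j + 1) * C ((X ^ (j + 1)) a b)) =
      ((j : ℂ) + 1) • ((Polynomial.X : B[X]) ^ j * C ((X ^ (j + 1)) a b))
    rw [derivative_mul, derivative_C, mul_zero, add_zero, derivative_X_pow, Algebra.smul_def]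
    simp only [map_add, map_natCast, map_one, Nat.add_sub_cancel]
    push_cast
    ring
  rw [nilEval, hsum, Finset.sum_range_succ', nilEval, Finset.sum_range_succ, mul_add,
    Finset.mul_sum]
  congr 1
  · refine Finset.sum_congr rfl fun j _ => ?_
    rw [hpow, PowerSeries.coeff_derivative, smul_smul, Matrix.mul_smul]
  · have h0 : X.map C * scaleMatrix X ^ N = 0 := by
      rw [scaleMatrix_pow, Matrix.mul_smul, ← Matrix.map_mul, ← pow_succ', hX]
      simp
    rw [Matrix.mul_smul, h0, smul_zero, pow_zero]
    ext a b : 1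
    simp [Matrix.one_apply, apply_ite]

/-- If `f' = ℓ' f` and `ℓ(0) = 0`, that is `f = f(0) exp ℓ`, then
`det f(X) = f(0)^r exp (tr ℓ(X))` for a nilpotent `r × r`-matrix `X`. By Jacobi's formula both sides,
with `sX` in place of `X`, solve the same linear differential equation in `s`. -/
theorem det_nilEval {X : Matrix s s B} (hX : X ^ (N + 1) = 0) {f ℓ : PowerSeries ℂ}
    (hf : PowerSeries.derivative ℂ f = PowerSeries.derivative ℂ ℓ * f)
    (hℓ : PowerSeries.constantCoeff ℓ = 0)
    (ht : (nilEval N ℓ (scaleMatrix X)).trace ^ (N + 1) = 0) :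
    (nilEval N f X).det = algebraMap ℂ B (PowerSeries.constantCoeff f ^ Fintype.card s) *
      expForm N (nilEval N ℓ X).trace := by
  set F := nilEval N f (scaleMatrix X) with hF
  set a := (nilEval N ℓ (scaleMatrix X)).trace with ha
  have hs := scaleMatrix_pow_eq_zero hX
  have htr : ∀ (t : B) (M : Matrix s s B[X]), (M.trace).eval t = (M.map (eval t)).trace := by
    intro t M
    simp [Matrix.trace, eval_finsetSum]
  have hdet : ∀ (t : B) (M : Matrix s s B[X]), (M.det).eval t = (M.map (eval t)).det := by
    intro t M
    exact (evalRingHom t).map_det M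
  have hda : derivative a = (X.map C * nilEval N (PowerSeries.derivative ℂ ℓ)
      (scaleMatrix X)).trace := by
    rw [← map_derivative_nilEval_scaleMatrix hX, ha]
    simp [Matrix.trace]
  have hD : derivative F.det = derivative a * F.det := by
    rw [derivative_det, hF, map_derivative_nilEval_scaleMatrix hX, hf, nilEval_mul hs, ← hF,
      ← Matrix.mul_assoc, ← Matrix.mul_assoc, Matrix.trace_mul_comm, ← Matrix.mul_assoc,
      ← Matrix.mul_assoc, Matrix.mul_adjugate, hda]
    simp
    ring
  have h := eval_one_eq_of_derivative_eq ht (by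
    rw [ha, htr, map_eval_nilEval_scaleMatrix, zero_smul, nilEval_zero, hℓ]
    simp) hD
  rw [hdet, hdet, hF, map_eval_nilEval_scaleMatrix, map_eval_nilEval_scaleMatrix, one_smul,
    zero_smul, nilEval_zero, ha, htr, map_eval_nilEval_scaleMatrix, one_smul] at h
  rw [h, Matrix.algebraMap_eq_diagonal, Matrix.det_diagonal]
  simp

end Det

/-! ### Matrices with entries in a nilpotent ideal -/

section NilpotentIdeal

variable {B : Type*} [CommRing B] [Algebra ℂ B] {N : ℕ} {I : Ideal B}
variable {s : Type*} [Fintype s] [DecidableEq s]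

omit [Algebra ℂ B] in
theorem pow_eq_zero_of_mem_ideal (hI : I ^ (N + 1) = ⊥) {y : B} (hy : y ∈ I) : y ^ (N + 1) = 0 := by
  have := Ideal.pow_mem_pow hy (N + 1)
  rwa [hI, Ideal.mem_bot] at this

omit [Algebra ℂ B] in
theorem matrix_pow_mem {X : Matrix s s B} (hX : ∀ a b, X a b ∈ I) (j : ℕ) (a b : s) :
    (X ^ j) a b ∈ I ^ j := by
  induction j generalizing a b with
  | zero => simp
  | succ j ih =>
    rw [pow_succ, pow_succ, Matrix.mul_apply]
    exact Ideal.sum_mem _ fun c _ => Ideal.mul_mem_mul (ih a c) (hX c b)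

omit [Algebra ℂ B] in
theorem matrix_pow_eq_zero (hI : I ^ (N + 1) = ⊥) {X : Matrix s s B} (hX : ∀ a b, X a b ∈ I) :
    X ^ (N + 1) = 0 := by
  ext a b
  have := matrix_pow_mem hX (N + 1) a b
  rwa [hI, Ideal.mem_bot] at this

omit [Algebra ℂ B] in
theorem matrix_pow_mem_of_ne_zero {X : Matrix s s B} (hX : ∀ a b, X a b ∈ I) {j : ℕ} (hj : j ≠ 0)
    (a b : s) : (X ^ j) a b ∈ I :=
  Ideal.pow_le_self hj (matrix_pow_mem hX j a b)

omit [Algebra ℂ B] in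
theorem trace_pow_mem {X : Matrix s s B} (hX : ∀ a b, X a b ∈ I) {j : ℕ} (hj : j ≠ 0) :
    (X ^ j).trace ∈ I :=
  Ideal.sum_mem _ fun a _ => matrix_pow_mem_of_ne_zero hX hj a a

theorem smul_mem_ideal {y : B} (hy : y ∈ I) (c : ℂ) : c • y ∈ I := by
  rw [Algebra.smul_def]
  exact I.mul_mem_left _ hy

theorem trace_nilEval (f : PowerSeries ℂ) (X : Matrix s s B) :
    (nilEval N f X).trace =
      ∑ j ∈ Finset.range (N + 1), PowerSeries.coeff j f • (X ^ j).trace := by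
  simp [nilEval, Matrix.trace_sum, Matrix.trace_smul]

theorem trace_nilEval_mem {X : Matrix s s B} (hX : ∀ a b, X a b ∈ I) {f : PowerSeries ℂ}
    (hf : PowerSeries.constantCoeff f = 0) : (nilEval N f X).trace ∈ I := by
  rw [trace_nilEval]
  refine Ideal.sum_mem _ fun j _ => ?_
  rcases eq_or_ne j 0 with rfl | hj
  · rw [PowerSeries.coeff_zero_eq_constantCoeff_apply, hf, zero_smul]
    exact I.zero_mem
  · exact smul_mem_ideal (trace_pow_mem hX hj) _

omit [Algebra ℂ B] in
theorem map_C_ideal_pow (hI : I ^ (N + 1) = ⊥) :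
    (I.map (Polynomial.C : B →+* Polynomial B)) ^ (N + 1) = ⊥ := by
  rw [← Ideal.map_pow, hI, Ideal.map_bot]

omit [Algebra ℂ B] [Fintype s] [DecidableEq s] in
theorem scaleMatrix_mem {X : Matrix s s B} (hX : ∀ a b, X a b ∈ I) (a b : s) :
    scaleMatrix X a b ∈ I.map (Polynomial.C : B →+* Polynomial B) :=
  Ideal.mul_mem_left _ _ (Ideal.mem_map_of_mem _ (hX a b))

theorem trace_nilEval_scaleMatrix_pow (hI : I ^ (N + 1) = ⊥) {X : Matrix s s B}
    (hX : ∀ a b, X a b ∈ I) {f : PowerSeries ℂ} (hf : PowerSeries.constantCoeff f = 0) :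
    (nilEval N f (scaleMatrix X)).trace ^ (N + 1) = 0 :=
  pow_eq_zero_of_mem_ideal (map_C_ideal_pow hI) (trace_nilEval_mem (scaleMatrix_mem hX) hf)

theorem det_nilEval_of_mem (hI : I ^ (N + 1) = ⊥) {X : Matrix s s B} (hX : ∀ a b, X a b ∈ I)
    {f ℓ : PowerSeries ℂ} (hf : PowerSeries.derivative ℂ f = PowerSeries.derivative ℂ ℓ * f)
    (hℓ : PowerSeries.constantCoeff ℓ = 0) :
    (nilEval N f X).det = algebraMap ℂ B (PowerSeries.constantCoeff f ^ Fintype.card s) *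
      expForm N (nilEval N ℓ X).trace :=
  det_nilEval (matrix_pow_eq_zero hI hX) hf hℓ (trace_nilEval_scaleMatrix_pow hI hX hℓ)

/-- The scalar case: `f(y) = f(0) exp ℓ(y)` if `f' = ℓ' f` and `ℓ(0) = 0`. -/
theorem nilEval_eq_exp_of_mem (hI : I ^ (N + 1) = ⊥) {y : B} (hy : y ∈ I)
    {f ℓ : PowerSeries ℂ} (hf : PowerSeries.derivative ℂ f = PowerSeries.derivative ℂ ℓ * f)
    (hℓ : PowerSeries.constantCoeff ℓ = 0) :
    nilEval N f y = algebraMap ℂ B (PowerSeries.constantCoeff f) * expForm N (nilEval N ℓ y) := by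
  have h := det_nilEval_of_mem (X := Matrix.scalar Unit y) (s := Unit) hI (fun a b => by
    simpa [Matrix.scalar_apply] using hy) hf hℓ
  have h1 : ∀ g : PowerSeries ℂ, nilEval N g (Matrix.scalar Unit y) =
      Matrix.scalar Unit (nilEval N g y) := fun g => by
    ext
    simp [nilEval, ← map_pow, Matrix.sum_apply, -Matrix.scalar_apply]
    simp
  rw [h1, h1] at h
  simpa using h

end NilpotentIdeal

/-! ### The power series that occur -/

section PowerSeries

open PowerSeries

/-- The logarithm of `(1 + t eˣ)/(1 + t)`: its derivative is `∑_{m ≥ 1} -(-t)ᵐ e^{mx}`. -/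
def logOneAddExp (t : ℂ) : PowerSeries ℂ :=
  PowerSeries.mk fun k => if k = 0 then 0 else -powerSum (k - 1) (-t) / k.factorial

theorem constantCoeff_logOneAddExp (t : ℂ) : constantCoeff (logOneAddExp t) = 0 := by
  rw [← coeff_zero_eq_constantCoeff_apply, logOneAddExp, coeff_mk, if_pos rfl]

/-- The `k`-th coefficients in the equation `x eʸ G(y) = G(y) - x eʸ` for `G(y) = ∑ xᵐ e^{my}`. -/
theorem powerSum_recursion (k : ℕ) {x : ℂ} (hx : ‖x‖ < 1) :
    x * ∑ i ∈ Finset.range (k + 1), (k.choose i : ℂ) * powerSum i x = powerSum k x - x := by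
  have h1 : ∀ i, HasSum (fun m : ℕ => (m + 1 : ℂ) ^ i * x ^ (m + 1)) (powerSum i x) :=
    fun i => (summable_powerSum i hx).hasSum
  have h2 := (hasSum_sum (s := Finset.range (k + 1)) fun i _ =>
    (h1 i).mul_left (k.choose i : ℂ)).mul_left x
  have h3 : HasSum (fun m : ℕ => ((m + 1 : ℕ) + 1 : ℂ) ^ k * x ^ (m + 1 + 1)) (powerSum k x - x) := by
    have := (hasSum_nat_add_iff' (f := fun m : ℕ => (m + 1 : ℂ) ^ k * x ^ (m + 1)) 1).mpr (h1 k)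
    simpa using this
  refine h2.unique (h3.congr_fun fun m => ?_)
  have h4 : ((m + 1 : ℕ) + 1 : ℂ) ^ k =
      ∑ i ∈ Finset.range (k + 1), (k.choose i : ℂ) * (m + 1 : ℂ) ^ i := by
    rw [add_pow]
    refine Finset.sum_congr rfl fun i _ => ?_
    push_cast
    ring
  rw [h4, Finset.mul_sum, Finset.sum_mul]
  refine Finset.sum_congr rfl fun i _ => ?_
  ring

theorem derivative_one_add_exp {t : ℂ} (ht : ‖t‖ < 1) :
    derivative ℂ (1 + t • exp ℂ) = derivative ℂ (logOneAddExp t) * (1 + t • exp ℂ) := by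
  have hd : derivative ℂ (1 + t • exp ℂ) = t • exp ℂ := by
    rw [map_add, derivative_one, zero_add, Derivation.map_smul, derivative_exp]
  have hc : ∀ k : ℕ, coeff k (derivative ℂ (logOneAddExp t)) =
      -powerSum k (-t) / k.factorial := fun k => by
    rw [coeff_derivative, logOneAddExp, coeff_mk, if_neg k.succ_ne_zero, Nat.factorial_succ]
    have h1 : (k.factorial : ℂ) ≠ 0 := by exact_mod_cast k.factorial_ne_zero
    have h2 : (k : ℂ) + 1 ≠ 0 := by exact_mod_cast k.succ_ne_zero
    simp only [Nat.add_sub_cancel]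
    push_cast
    field_simp
  rw [hd]
  ext k
  rw [mul_add, mul_one, map_add, hc, mul_smul_comm, coeff_smul, coeff_smul, coeff_mul,
    Finset.Nat.sum_antidiagonal_eq_sum_range_succ_mk]
  have h := powerSum_recursion k (x := -t) (by simpa using ht)
  have hk : (k.factorial : ℂ) ≠ 0 := by exact_mod_cast k.factorial_ne_zero
  have hs : ∑ i ∈ Finset.range (k + 1), coeff i (derivative ℂ (logOneAddExp t)) *
      coeff (k - i) (exp ℂ) =
      -(∑ i ∈ Finset.range (k + 1), (k.choose i : ℂ) * powerSum i (-t)) / k.factorial := by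
    rw [← Finset.sum_neg_distrib, Finset.sum_div]
    refine Finset.sum_congr rfl fun i hi => ?_
    have hik : i ≤ k := by simpa [Nat.lt_succ_iff] using hi
    rw [hc, coeff_exp, Nat.cast_choose ℂ hik]
    have h1 : (i.factorial : ℂ) ≠ 0 := by exact_mod_cast i.factorial_ne_zero
    have h2 : ((k - i).factorial : ℂ) ≠ 0 := by exact_mod_cast (k - i).factorial_ne_zero
    simp
    field_simp
  rw [Nat.succ_eq_add_one, hs, coeff_exp]
  simp only [smul_eq_mul, one_div, map_inv₀, map_natCast]
  field_simp
  linear_combination -h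

/-- The series `sinh x / x`. -/
def sinhc : PowerSeries ℂ :=
  PowerSeries.mk fun k => if Even k then ((k + 1).factorial : ℂ)⁻¹ else 0

/-- The logarithm of `sinh x / x`: its derivative is `coth x - 1/x`. -/
def logSinhc : PowerSeries ℂ :=
  PowerSeries.mk fun k => if Even k ∧ k ≠ 0 then 2 ^ k * bernoulli k / (k * k.factorial) else 0

theorem constantCoeff_logSinhc : constantCoeff logSinhc = 0 := by
  rw [← coeff_zero_eq_constantCoeff_apply, logSinhc, coeff_mk]
  simp

theorem constantCoeff_sinhc : constantCoeff sinhc = 1 := by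
  rw [← coeff_zero_eq_constantCoeff_apply, sinhc, coeff_mk]
  simp

theorem rescale_exp_mul (a b : ℂ) :
    rescale a (exp ℂ) * rescale b (exp ℂ) = rescale (a + b) (exp ℂ) := by
  rw [exp_mul_exp_eq_exp_add]

theorem two_X_mul_sinhc : 2 * X * sinhc = exp ℂ - rescale (-1) (exp ℂ) := by
  ext k
  rcases k with _ | k
  · rw [mul_assoc, mul_left_comm, coeff_zero_X_mul, map_sub, coeff_rescale]
    simp
  · rw [mul_assoc, mul_left_comm, coeff_succ_X_mul, map_sub, coeff_rescale, coeff_exp,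
      show (2 : PowerSeries ℂ) = C (2 : ℂ) from (map_ofNat (C (R := ℂ)) 2).symm, coeff_C_mul,
      sinhc, coeff_mk]
    rcases Nat.even_or_odd k with h | h
    · rw [if_pos h, Odd.neg_one_pow h.add_one]
      simp
      ring
    · rw [if_neg (Nat.not_even_iff_odd.mpr h), Even.neg_one_pow h.add_one]
      simp

theorem derivative_rescale_neg_exp :
    derivative ℂ (rescale (-1) (exp ℂ)) = -rescale (-1) (exp ℂ) := by
  ext k
  rw [coeff_derivative, map_neg, coeff_rescale, coeff_rescale, coeff_exp, coeff_exp,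
    Nat.factorial_succ]
  have h1 : (k.factorial : ℂ) ≠ 0 := by exact_mod_cast k.factorial_ne_zero
  have h2 : (k : ℂ) + 1 ≠ 0 := by exact_mod_cast k.succ_ne_zero
  simp
  field_simp
  ring

/-- The Bernoulli generating function at `2x` is `x coth x - x`. -/
theorem derivative_sinhc :
    derivative ℂ sinhc = derivative ℂ logSinhc * sinhc := by
  -- `β = x coth x`
  set β : PowerSeries ℂ := X * derivative ℂ logSinhc + 1 with hβ
  have hb : rescale 2 (bernoulliPowerSeries ℂ) = β - X := by
    ext k
    rw [coeff_rescale, bernoulliPowerSeries, coeff_mk, hβ]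
    rcases k with _ | k
    · simp
    · rw [map_sub, map_add, coeff_succ_X_mul, coeff_derivative, logSinhc, coeff_mk, coeff_one,
        coeff_X, if_neg k.succ_ne_zero]
      have h1 : ((k + 1).factorial : ℂ) ≠ 0 := by exact_mod_cast (k + 1).factorial_ne_zero
      have h2 : (k : ℂ) + 1 ≠ 0 := by exact_mod_cast k.succ_ne_zero
      rcases Nat.even_or_odd (k + 1) with h | h
      · have hk : k + 1 ≠ 1 := by rintro h'; rw [h'] at h; simp at h
        rw [if_pos ⟨h, k.succ_ne_zero⟩, if_neg hk]
        simp
        field_simp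
      · rw [if_neg (by simp [Nat.not_even_iff_odd.mpr h])]
        rcases eq_or_ne k 0 with rfl | hk
        · simp [bernoulli_one]
          norm_num
        · rw [bernoulli_eq_zero_of_odd h (by omega), if_neg (by omega)]
          simp
  have h1 := congrArg (rescale (2 : ℂ)) (bernoulliPowerSeries_mul_exp_sub_one ℂ)
  rw [map_mul, map_sub, map_one, hb, rescale_X] at h1
  have h2 : rescale (2 : ℂ) (exp ℂ) * rescale (-1) (exp ℂ) = exp ℂ := by
    rw [rescale_exp_mul, show (2 : ℂ) + -1 = 1 by ring, rescale_one, RingHom.id_apply]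
  have hC : (C (2 : ℂ) : PowerSeries ℂ) = 2 := map_ofNat (C (R := ℂ)) 2
  rw [hC] at h1
  have h3 := two_X_mul_sinhc
  have h4 := congrArg (derivative ℂ) h3
  rw [map_sub, derivative_exp, derivative_rescale_neg_exp, mul_assoc, ← hC, ← smul_eq_C_mul,
    Derivation.map_smul, Derivation.leibniz, derivative_X, smul_eq_C_mul, hC] at h4
  simp only [smul_eq_mul, mul_one] at h4
  have h5 : (4 * X * X) * (derivative ℂ sinhc) =
      (4 * X * X) * (derivative ℂ logSinhc * sinhc) := by
    have h6 : (β - X) * (exp ℂ - rescale (-1) (exp ℂ)) = 2 * X * rescale (-1) (exp ℂ) := by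
      linear_combination rescale (-1) (exp ℂ) * h1 - (β - X) * h2
    rw [← h3] at h6
    rw [hβ] at h6
    linear_combination -2 * h6 + 2 * X * h4 - 2 * X * h3
  have h0 : (4 * X * X : PowerSeries ℂ) ≠ 0 := by
    have : (4 : PowerSeries ℂ) ≠ 0 := by
      rw [show (4 : PowerSeries ℂ) = C (4 : ℂ) from (map_ofNat (C (R := ℂ)) 4).symm]
      simp
    exact mul_ne_zero (mul_ne_zero this X_ne_zero) X_ne_zero
  exact mul_left_cancel₀ h0 h5

/-- The logarithm of `(1 + eˣ)/2`: its derivative `eˣ/(eˣ + 1) = 1 - 1/(eˣ - 1) + 2/(e^{2x} - 1)` is a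
combination of Bernoulli generating functions. -/
def logOneAddExpHalf : PowerSeries ℂ :=
  PowerSeries.mk fun k => if k = 1 then 1 / 2 else (2 ^ k - 1) * bernoulli k / (k * k.factorial)

theorem constantCoeff_logOneAddExpHalf : constantCoeff logOneAddExpHalf = 0 := by
  rw [← coeff_zero_eq_constantCoeff_apply, logOneAddExpHalf, coeff_mk]
  simp

theorem derivative_logOneAddExpHalf :
    derivative ℂ logOneAddExpHalf * (1 + exp ℂ) = exp ℂ := by
  have hb : rescale 2 (bernoulliPowerSeries ℂ) - bernoulliPowerSeries ℂ =
      X * (derivative ℂ logOneAddExpHalf - 1) := by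
    ext k
    rw [map_sub, coeff_rescale, bernoulliPowerSeries, coeff_mk]
    rcases k with _ | k
    · simp
    · rw [coeff_succ_X_mul, map_sub, coeff_derivative, logOneAddExpHalf, coeff_mk, coeff_one]
      have h1 : ((k + 1).factorial : ℂ) ≠ 0 := by exact_mod_cast (k + 1).factorial_ne_zero
      have h2 : (k : ℂ) + 1 ≠ 0 := by exact_mod_cast k.succ_ne_zero
      rcases eq_or_ne k 0 with rfl | hk
      · simp [bernoulli_one]
        norm_num
      · rw [if_neg (by omega), if_neg hk]
        simp
        field_simp
  have h1 := congrArg (rescale (2 : ℂ)) (bernoulliPowerSeries_mul_exp_sub_one ℂ)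
  have h2 := bernoulliPowerSeries_mul_exp_sub_one ℂ
  have hC : (C (2 : ℂ) : PowerSeries ℂ) = 2 := map_ofNat (C (R := ℂ)) 2
  have h3 : rescale (2 : ℂ) (exp ℂ) = exp ℂ * exp ℂ := by
    have := rescale_exp_mul 1 1
    rw [rescale_one, RingHom.id_apply, one_add_one_eq_two] at this
    exact this.symm
  rw [map_mul, map_sub, map_one, rescale_X, hC, h3] at h1
  have he : exp ℂ - 1 ≠ 0 := by
    intro h
    rw [h, mul_zero] at h2
    exact X_ne_zero h2.symm
  have h4 : X * (exp ℂ - 1) * (derivative ℂ logOneAddExpHalf * (1 + exp ℂ)) =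
      X * (exp ℂ - 1) * exp ℂ := by
    linear_combination -(exp ℂ - 1) * (1 + exp ℂ) * hb + h1 - (1 + exp ℂ) * h2
  exact mul_left_cancel₀ (mul_ne_zero X_ne_zero he) h4

/-- The binomial series of `(1 + x)^{-1/2}`. -/
def rsqrtSeries : PowerSeries ℂ :=
  PowerSeries.mk fun j => (-1 / 4 : ℂ) ^ j * (Nat.centralBinom j : ℂ)

/-- The recursion of the central binomial coefficients is the equation `2 (1 + x) y' = -y`. -/
theorem rsqrtSeries_sq : rsqrtSeries * rsqrtSeries * (1 + X) = 1 := by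
  have h : 2 * (derivative ℂ rsqrtSeries * (1 + X)) = -rsqrtSeries := by
    ext j
    rw [show (2 : PowerSeries ℂ) = C (2 : ℂ) from (map_ofNat (C (R := ℂ)) 2).symm, coeff_C_mul,
      mul_add, mul_one, map_add, map_neg]
    have hrec : ∀ i : ℕ, coeff (i + 1) rsqrtSeries * (i + 1) =
        -(2 * i + 1) / 2 * coeff i rsqrtSeries := by
      intro i
      rw [rsqrtSeries, coeff_mk, coeff_mk, pow_succ]
      have h1 : ((i + 1 : ℕ) : ℂ) * (Nat.centralBinom (i + 1) : ℂ) =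
          2 * (2 * i + 1) * Nat.centralBinom i := by
        exact_mod_cast Nat.succ_mul_centralBinom_succ i
      push_cast at h1
      linear_combination (-1 / 4 : ℂ) ^ i * (-1 / 4) * h1
    rcases j with _ | j
    · rw [coeff_zero_mul_X, coeff_derivative]
      have := hrec 0
      push_cast at this ⊢
      linear_combination 2 * this
    · rw [coeff_succ_mul_X, coeff_derivative, coeff_derivative]
      have h1 := hrec (j + 1)
      have h2 := hrec j
      push_cast at h1 h2 ⊢
      linear_combination 2 * h1
  have hcc : constantCoeff rsqrtSeries = 1 := by
    rw [← coeff_zero_eq_constantCoeff_apply, rsqrtSeries, coeff_mk]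
    simp
  refine derivative.ext ?_ ?_
  · rw [derivative_one, Derivation.leibniz, Derivation.leibniz, map_add, derivative_one,
      derivative_X]
    simp only [smul_eq_mul]
    linear_combination rsqrtSeries * h
  · simp [hcc]

end PowerSeries

/-! ### Exterior powers -/

section ExteriorPower

variable {R : Type*} [CommRing R]

/-- The trace of the `p`-th exterior power of a matrix is the sum of the principal minors of
size `p`. -/
theorem trace_exteriorPower_map {r : ℕ} (p : ℕ) (M : Matrix (Fin r) (Fin r) R) :
    LinearMap.trace R (⋀[R]^p (Fin r → R)) (exteriorPower.map p (Matrix.toLin' M)) =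
      ∑ s ∈ Finset.univ.powersetCard p,
        (M.submatrix (Subtype.val : s → Fin r) (Subtype.val : s → Fin r)).det := by
  classical
  rw [LinearMap.trace_eq_matrix_trace R ((Pi.basisFun R (Fin r)).exteriorPower p), Matrix.trace]
  have h : ∀ s : Set.powersetCard (Fin r) p,
      (LinearMap.toMatrix ((Pi.basisFun R (Fin r)).exteriorPower p)
        ((Pi.basisFun R (Fin r)).exteriorPower p)
        (exteriorPower.map p (Matrix.toLin' M))).diag s =
      (M.submatrix (Subtype.val : {x // x ∈ s.1} → Fin r)
        (Subtype.val : {x // x ∈ s.1} → Fin r)).det := by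
    intro s
    rw [Matrix.diag_apply, LinearMap.toMatrix_apply, exteriorPower.basis_apply,
      exteriorPower.map_apply_ιMulti_family, exteriorPower.basis_repr_apply,
      exteriorPower.ιMulti_family, exteriorPower.ιMultiDual_apply_ιMulti, ← Matrix.det_transpose]
    rw [← Matrix.det_submatrix_equiv_self
      (s.1.orderIsoOfFin s.2).toEquiv]
    congr 1
    ext i j
    simp [Matrix.toLin'_apply, Set.powersetCard.ofFinEmbEquiv_symm_apply]
    rfl
  rw [Finset.sum_congr rfl fun s _ => h s]
  refine Finset.sum_bij (fun s _ => (s : Finset (Fin r))) ?_ ?_ ?_ ?_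
  · intro s _
    simp
  · intro s _ t _ hst
    exact Subtype.ext hst
  · intro s hs
    exact ⟨⟨s, by simpa [Finset.mem_powersetCard] using hs⟩, Finset.mem_univ _, rfl⟩
  · intro s _
    rfl

/-- The coefficients of `det (1 + t M)` are the sums of principal minors. -/
theorem sum_pow_mul_trace_exteriorPower_map {r : ℕ} (t : R) (M : Matrix (Fin r) (Fin r) R) :
    ∑ p ∈ Finset.range (r + 1), t ^ p *
      LinearMap.trace R (⋀[R]^p (Fin r → R)) (exteriorPower.map p (Matrix.toLin' M)) =
    (1 + t • M).det := by
  classical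
  set P : Polynomial R := (1 + (Polynomial.X : Polynomial R) • M.map Polynomial.C).det with hP
  have hdeg : P.natDegree < r + 1 := by
    have h := Polynomial.natDegree_det_X_add_C_le M (1 : Matrix (Fin r) (Fin r) R)
    rw [Fintype.card_fin] at h
    have e : (Polynomial.X : Polynomial R) • M.map Polynomial.C +
        (1 : Matrix (Fin r) (Fin r) R).map Polynomial.C =
        1 + (Polynomial.X : Polynomial R) • M.map Polynomial.C := by
      rw [add_comm]
      congr 1
      ext i j : 1
      rcases eq_or_ne i j with rfl | hij <;> simp [*]
    rw [e] at h
    exact Nat.lt_succ_of_le h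
  have hev : (1 + t • M).det = P.eval t := by
    rw [hP, ← Polynomial.coe_evalRingHom, RingHom.map_det]
    congr 1
    ext i j
    simp [Matrix.one_apply, apply_ite]
    exact mul_comm _ _
  rw [hev, Polynomial.eval_eq_sum_range' hdeg]
  refine Finset.sum_congr rfl fun p _ => ?_
  rw [trace_exteriorPower_map, hP, Matrix.coeff_det_one_add_X_smul_eq_sum_minors, mul_comm]

end ExteriorPower

theorem chLambda_eq_det {n r : ℕ} (t : ℂ) (R : Matrix (Fin r) (Fin r) (EvenForms n)) :
    chLambda t R = (1 + t • expCurvature R).det := by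
  have h := sum_pow_mul_trace_exteriorPower_map (algebraMap ℂ (EvenForms n) t) (expCurvature R)
  rw [algebraMap_smul] at h
  rw [← h, chLambda]
  refine Finset.sum_congr rfl fun p _ => ?_
  rw [chExteriorPower, Algebra.smul_def, map_pow]

/-! ### The character of the spin representation -/

theorem gamma_mul_apply (m a b : ℕ) (s t : Fin m → Fin 2) :
    (gamma m a * gamma m b) s t =
      ∏ i : Fin m, (gammaFactor a i * gammaFactor b i) (s i) (t i) := by
  simp only [gamma, Matrix.mul_apply, Matrix.of_apply]
  rw [Finset.prod_univ_sum]
  simp only [Fintype.piFinset_univ, Finset.prod_mul_distrib]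

theorem gammaFactor_sq (a i : ℕ) : gammaFactor a i * gammaFactor a i = 1 := by
  unfold gammaFactor
  split_ifs <;> ext i j <;> fin_cases i <;> fin_cases j <;> simp [Matrix.mul_apply]

theorem gamma_sq (m a : ℕ) : gamma m a * gamma m a = 1 := by
  ext s t
  rw [gamma_mul_apply]
  simp only [gammaFactor_sq, Matrix.one_apply, funext_iff]
  rw [Finset.prod_ite_zero]
  simp

theorem gammaFactor_comm {a b i : ℕ} (hab : a < b) (hi : i ≠ a / 2) :
    gammaFactor b i * gammaFactor a i = gammaFactor a i * gammaFactor b i := by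
  unfold gammaFactor
  split_ifs <;> first | omega | simp

theorem gammaFactor_anticomm {a b : ℕ} (hab : a < b) :
    gammaFactor b (a / 2) * gammaFactor a (a / 2) =
      -(gammaFactor a (a / 2) * gammaFactor b (a / 2)) := by
  unfold gammaFactor
  split_ifs <;> first | omega | skip
  all_goals ext i j; fin_cases i <;> fin_cases j <;> simp [Matrix.mul_apply]

theorem gamma_anticomm_of_lt {m a b : ℕ} (hab : a < b) (ha : a < 2 * m) :
    gamma m b * gamma m a = -(gamma m a * gamma m b) := by
  ext s t
  rw [Matrix.neg_apply, gamma_mul_apply, gamma_mul_apply]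
  have hi : a / 2 < m := by omega
  rw [← Finset.mul_prod_erase _ _ (Finset.mem_univ (⟨a / 2, hi⟩ : Fin m)),
    ← Finset.mul_prod_erase _ _ (Finset.mem_univ (⟨a / 2, hi⟩ : Fin m)), ← neg_mul]
  simp only [gammaFactor_anticomm hab, Matrix.neg_apply]
  congr 1
  refine Finset.prod_congr rfl fun i hi => ?_
  rw [gammaFactor_comm hab]
  intro h
  exact Finset.ne_of_mem_erase hi (Fin.ext h)

theorem gamma_clifford (m : ℕ) {a b : ℕ} (ha : a < 2 * m) (hb : b < 2 * m) :
    gamma m a * gamma m b + gamma m b * gamma m a = if a = b then 2 else 0 := by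
  rcases lt_trichotomy a b with h | rfl | h
  · rw [gamma_anticomm_of_lt h ha, if_neg h.ne]
    simp
  · rw [gamma_sq, if_pos rfl, one_add_one_eq_two]
  · rw [gamma_anticomm_of_lt h hb, if_neg h.ne']
    simp

section Spin

variable {A : Type*} [CommRing A] [Algebra ℂ A] {N : ℕ}
variable {σ : Type*} [Fintype σ] [DecidableEq σ] {r : ℕ}

/-- Matrices `γ_a` with `γ_a γ_b + γ_b γ_a = 2 δ_{ab}`. -/
def IsClifford (γ : Fin r → Matrix σ σ A) : Prop :=
  ∀ a b, γ a * γ b + γ b * γ a = if a = b then 2 else 0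

/-- The element `¼ ∑ Y_{ab} γ_a γ_b` of the spin representation of the Lie algebra of
skew-symmetric matrices. -/
def spinRep (γ : Fin r → Matrix σ σ A) (Y : Matrix (Fin r) (Fin r) A) : Matrix σ σ A :=
  ∑ a, ∑ b, Y a b • ((1 / 4 : ℂ) • (γ a * γ b))

theorem spinRep_mul_gamma {γ : Fin r → Matrix σ σ A} (hγ : IsClifford γ)
    {Y : Matrix (Fin r) (Fin r) A} (hY : Y.transpose = -Y) (c : Fin r) :
    spinRep γ Y * γ c = γ c * spinRep γ Y + ∑ a, Y a c • γ a := by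
  have h1 : ∀ a b, γ a * γ b * γ c = γ c * (γ a * γ b) +
      (γ a * (if b = c then 2 else 0) - (if a = c then 2 else 0) * γ b) := by
    intro a b
    rw [← hγ b c, ← hγ a c]
    noncomm_ring
  have hsk : ∀ b, Y c b = -Y b c := fun b => by
    have := congrFun (congrFun hY b) c
    simpa using this
  have h2 : ∀ (b : Fin r), (γ b * 2 : Matrix σ σ A) = (2 : ℂ) • γ b := fun b => by
    rw [mul_two, two_smul]
  have h3 : ∀ (b : Fin r), (2 * γ b : Matrix σ σ A) = (2 : ℂ) • γ b := fun b => by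
    rw [two_mul, two_smul]
  simp only [spinRep, Finset.sum_mul, Finset.mul_sum, smul_mul_assoc, mul_smul_comm, h1, smul_add,
    Finset.sum_add_distrib, smul_sub, Finset.sum_sub_distrib]
  congr 1
  simp only [mul_ite, ite_mul, mul_zero, zero_mul, smul_ite, smul_zero, Finset.sum_ite_eq',
    Finset.mem_univ, if_true, h2, h3, smul_smul]
  rw [Finset.sum_comm (f := fun a b => if a = c then _ else _)]
  simp only [Finset.sum_ite_eq', Finset.mem_univ, if_true, hsk, neg_smul, Finset.sum_neg_distrib,
    sub_neg_eq_add]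
  rw [← Finset.sum_add_distrib]
  refine Finset.sum_congr rfl fun a _ => ?_
  rw [← smul_add, ← add_smul]
  norm_num

/-- Conjugation by `exp S`, `S` the spin representation of `Y`, acts on the `γ_c` as the vector
representation of `exp Y`. -/
theorem exp_spinRep_mul_gamma {γ : Fin r → Matrix σ σ A} (hγ : IsClifford γ)
    {Y : Matrix (Fin r) (Fin r) A} (hY : Y.transpose = -Y) (hYN : Y ^ (N + 1) = 0)
    (hSN : spinRep γ Y ^ (N + 1) = 0) (c : Fin r) :
    expForm N (spinRep γ Y) * γ c = ∑ a, expForm N Y a c • (γ a * expForm N (spinRep γ Y)) := by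
  set S := spinRep γ Y with hS
  -- In the matrices over the algebra generated by the `γ_a`, the spin representation acts by scalar
  -- matrices `i₁` and the vector representation by `i₂`; these actions commute.
  let i₁ : Matrix σ σ A →ₐ[ℂ] Matrix (Fin r) (Fin r) (Matrix σ σ A) :=
    Matrix.scalarAlgHom (Fin r) ℂ
  let i₂ : Matrix (Fin r) (Fin r) A →ₐ[ℂ] Matrix (Fin r) (Fin r) (Matrix σ σ A) :=
    (Algebra.ofId A (Matrix σ σ A)).restrictScalars ℂ |>.mapMatrix
  have hi₁ : ∀ x, i₁ x = Matrix.scalar (Fin r) x := fun x => rfl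
  have hi₂ : ∀ x a b, i₂ x a b = algebraMap A (Matrix σ σ A) (x a b) := fun x a b => rfl
  have hcomm : Commute (i₁ S) (i₂ Y) := by
    ext a b : 1
    rw [hi₁, Matrix.scalar_apply, Matrix.diagonal_mul, Matrix.mul_diagonal, hi₂]
    exact (Algebra.commutes _ _).symm
  have hstep : ∀ v : Fin r → Matrix σ σ A, v = γ → (fun c => S * v c) =
      Matrix.vecMul v (i₁ S + i₂ Y) := by
    rintro v rfl
    ext c : 1
    rw [hS, spinRep_mul_gamma hγ hY, Matrix.vecMul_add, Pi.add_apply, hi₁, Matrix.scalar_apply,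
      Matrix.vecMul_diagonal]
    congr 1
    simp only [Matrix.vecMul, dotProduct, hi₂]
    refine Finset.sum_congr rfl fun a _ => ?_
    rw [← Algebra.commutes, ← Algebra.smul_def]
  have hpow : ∀ j : ℕ, (fun c => S ^ j * γ c) = Matrix.vecMul γ ((i₁ S + i₂ Y) ^ j) := by
    intro j
    induction j with
    | zero => simp
    | succ j ih =>
      rw [pow_succ' (i₁ S + i₂ Y), ← Matrix.vecMul_vecMul, ← hstep γ rfl]
      ext c : 1
      have h1 := congrFun ih c
      simp only [Matrix.vecMul, dotProduct] at h1 ⊢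
      rw [pow_succ', mul_assoc, h1, Finset.mul_sum]
      refine Finset.sum_congr rfl fun a _ => ?_
      rw [mul_assoc]
  have hexp : ∀ M : ℕ, (fun c => expForm M S * γ c) = Matrix.vecMul γ (expForm M (i₁ S + i₂ Y)) := by
    intro M
    ext c : 1
    simp only [expForm, Finset.sum_mul, smul_mul_assoc, Matrix.vecMul, dotProduct,
      Matrix.sum_apply, Finset.mul_sum, Matrix.smul_apply, mul_smul_comm]
    rw [Finset.sum_comm]
    refine Finset.sum_congr rfl fun j _ => ?_
    rw [← Finset.smul_sum]
    congr 1
    exact congrFun (hpow j) c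
  -- The sum of two commuting elements of nilpotency order `N + 1` has order at most `2 N + 1`.
  have hle : N ≤ 2 * N + 1 := by omega
  have h1 : i₁ S ^ (N + 1) = 0 := by rw [← map_pow, hSN, map_zero]
  have h2 : i₂ Y ^ (N + 1) = 0 := by rw [← map_pow, hYN, map_zero]
  have h3 : (i₂ Y + i₁ S) ^ (2 * N + 1 + 1) = 0 :=
    hcomm.symm.add_pow_eq_zero_of_add_le_succ_of_pow_eq_zero h2 h1 (by omega)
  have h4 := congrFun (hexp (2 * N + 1)) c
  have h1' : i₁ S ^ (2 * N + 1 + 1) = 0 := pow_eq_zero_of_le (by omega) h1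
  have h2' : i₂ Y ^ (2 * N + 1 + 1) = 0 := pow_eq_zero_of_le (by omega) h2
  rw [add_comm (i₁ S) (i₂ Y), expForm_add hcomm.symm h2' h1' h3] at h4
  simp only [expForm_eq_nilEval] at h4 ⊢
  rw [nilEval_of_le hSN hle, nilEval_of_le h1 hle, nilEval_of_le h2 hle] at h4
  rw [h4, ← map_nilEval, ← map_nilEval, ← Matrix.vecMul_vecMul, hi₁, Matrix.scalar_apply,
    Matrix.vecMul_diagonal]
  simp only [Matrix.vecMul, dotProduct, hi₂, Finset.sum_mul]
  refine Finset.sum_congr rfl fun a _ => ?_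
  rw [← Algebra.commutes, ← Algebra.smul_def, smul_mul_assoc]

/-- The two-point function `m_{ab} = tr (γ_a γ_b exp S)` satisfies `m (1 + exp Y) = 2 tr (exp S)`,
by the cyclicity of the trace and the Clifford relations. -/
theorem twoPoint_mul {γ : Fin r → Matrix σ σ A} (hγ : IsClifford γ)
    {Y : Matrix (Fin r) (Fin r) A} (hY : Y.transpose = -Y) (hYN : Y ^ (N + 1) = 0)
    (hSN : spinRep γ Y ^ (N + 1) = 0) :
    (Matrix.of fun a b => (γ a * γ b * expForm N (spinRep γ Y)).trace) * (1 + expForm N Y) =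
      (2 * (expForm N (spinRep γ Y)).trace) • 1 := by
  set U := expForm N (spinRep γ Y) with hU
  ext d c
  rw [mul_add, mul_one, Matrix.add_apply, Matrix.mul_apply, Matrix.smul_apply, Matrix.one_apply]
  simp only [Matrix.of_apply]
  -- Moving `exp S` past `γ_c` cyclically turns `γ_d γ_a exp S` into `γ_c γ_d exp S`.
  have h1 : ∑ a, (γ d * γ a * U).trace * expForm N Y a c = (γ c * γ d * U).trace := by
    rw [mul_assoc, Matrix.trace_mul_comm, mul_assoc, hU,
      exp_spinRep_mul_gamma hγ hY hYN hSN c, ← hU]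
    rw [Finset.mul_sum, Matrix.trace_sum]
    refine Finset.sum_congr rfl fun a _ => ?_
    rw [mul_smul_comm, Matrix.trace_smul, smul_eq_mul, mul_comm, mul_assoc]
  rw [h1, ← Matrix.trace_add, ← add_mul, hγ d c]
  split_ifs with h
  · rw [two_mul U.trace, ← Matrix.trace_add, two_mul, smul_eq_mul, mul_one]
  · simp

theorem trace_eq_zero_of_transpose_eq_neg {X : Matrix (Fin r) (Fin r) A}
    (hX : X.transpose = -X) : X.trace = 0 := by
  have h1 := Matrix.trace_transpose X
  rw [hX, Matrix.trace_neg] at h1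
  have h2 : (2 : ℂ) • X.trace = 0 := by
    rw [two_smul]
    linear_combination -h1
  simpa only [smul_smul, inv_mul_cancel₀ (two_ne_zero (α := ℂ)), one_smul, smul_zero] using
    congrArg (fun y => (2 : ℂ)⁻¹ • y) h2

omit [DecidableEq σ] in
theorem spinRep_apply (γ : Fin r → Matrix σ σ A) (Y : Matrix (Fin r) (Fin r) A) (s t : σ) :
    spinRep γ Y s t = ∑ a, ∑ b, Y a b * ((1 / 4 : ℂ) • (γ a * γ b) s t) := by
  simp only [spinRep, Matrix.sum_apply, Matrix.smul_apply, smul_eq_mul]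

omit [DecidableEq σ] in
theorem spinRep_mem {I : Ideal A} (γ : Fin r → Matrix σ σ A) {X : Matrix (Fin r) (Fin r) A}
    (hX : ∀ a b, X a b ∈ I) (s t : σ) : spinRep γ X s t ∈ I := by
  rw [spinRep_apply]
  exact Ideal.sum_mem _ fun a _ => Ideal.sum_mem _ fun b _ => I.mul_mem_right _ (hX a b)

open Polynomial in
/-- The character of the spin representation: for a skew-symmetric matrix `X` with entries in a
nilpotent ideal and `S` its spin representation, `tr (exp S) = 2ᵐ det ((1 + exp X)/2)^{1/2}`. The
logarithmic derivative of `tr (exp sS)` in `s` is expressed by the two-point function. -/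
theorem trace_expForm_spinRep {I : Ideal A} (hI : I ^ (N + 1) = ⊥) {γ : Fin r → Matrix σ σ A}
    (hγ : IsClifford γ) {X : Matrix (Fin r) (Fin r) A} (hX : X.transpose = -X)
    (hXI : ∀ a b, X a b ∈ I) :
    (expForm N (spinRep γ X)).trace = (Fintype.card σ : A) *
      expForm N ((1 / 2 : ℂ) • (nilEval N logOneAddExpHalf X).trace) := by
  set γ' : Fin r → Matrix σ σ A[X] := fun a => (γ a).map C with hγ'
  have hγc : IsClifford γ' := fun a b => by
    have h := congrArg (fun M : Matrix σ σ A => (C : A →+* A[X]).mapMatrix M) (hγ a b)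
    simp only [map_add, map_mul, apply_ite ((C : A →+* A[X]).mapMatrix), map_ofNat, map_zero] at h
    exact h
  set S := spinRep γ X with hS
  have hmapS : S.map C = spinRep γ' (X.map C) := by
    ext s t : 1
    rw [hS, Matrix.map_apply, spinRep_apply, spinRep_apply, map_sum]
    refine Finset.sum_congr rfl fun a _ => ?_
    rw [map_sum]
    refine Finset.sum_congr rfl fun b _ => ?_
    have h1 : (γ' a * γ' b) s t = C ((γ a * γ b) s t) := by
      rw [hγ', ← Matrix.map_mul, Matrix.map_apply]
    rw [h1, map_mul, ← smul_C, Matrix.map_apply]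
  have hscale : scaleMatrix S = spinRep γ' (scaleMatrix X) := by
    rw [scaleMatrix, hmapS, scaleMatrix]
    simp only [spinRep, Finset.smul_sum, smul_smul, Matrix.smul_apply, smul_eq_mul]
  set Y := scaleMatrix X with hYdef
  have hskC : (X.map (C : A → A[X])).transpose = -X.map C := by
    rw [← Matrix.transpose_map, hX]
    ext a b : 1
    simp
  have hY : Y.transpose = -Y := by
    rw [hYdef, scaleMatrix, Matrix.transpose_smul, hskC, smul_neg]
  have hYN : Y ^ (N + 1) = 0 := scaleMatrix_pow_eq_zero (matrix_pow_eq_zero hI hXI)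
  have hSI := spinRep_mem γ hXI
  have hS0 : S ^ (N + 1) = 0 := matrix_pow_eq_zero hI hSI
  have hSN : spinRep γ' Y ^ (N + 1) = 0 := by
    rw [← hscale]
    exact scaleMatrix_pow_eq_zero hS0
  set U := expForm N (spinRep γ' Y) with hU
  set a : A[X] := (1 / 2 : ℂ) • (nilEval N logOneAddExpHalf Y).trace with ha
  set L := nilEval N (PowerSeries.derivative ℂ logOneAddExpHalf) Y with hL
  have htr : ∀ {κ : Type _} [Fintype κ] (t : A) (M : Matrix κ κ A[X]),
      (M.trace).eval t = (M.map (eval t)).trace := by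
    intro κ _ t M
    simp [Matrix.trace, eval_finsetSum]
  have htr' : ∀ (t : A) (M : Matrix σ σ A[X]), (M.trace).eval t = (M.map (eval t)).trace := by
    intro t M
    simp [Matrix.trace, eval_finsetSum]
  have hinv : (1 + expForm N Y) * (1 - L) = 1 := by
    have h1 := congrArg (fun f => nilEval N f Y) derivative_logOneAddExpHalf
    simp only [mul_comm _ (1 + PowerSeries.exp ℂ)] at h1
    rw [nilEval_mul hYN, nilEval_add, nilEval_one, ← expForm_eq_nilEval, ← hL] at h1
    rw [mul_sub, h1, mul_one, add_sub_cancel_right]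
  have hm := twoPoint_mul hγc hY hYN hSN
  rw [← hU] at hm
  set m : Matrix (Fin r) (Fin r) A[X] := Matrix.of fun a b => (γ' a * γ' b * U).trace with hmdef
  have hm' : m = (2 * U.trace) • (1 - L) := by
    calc m = m * ((1 + expForm N Y) * (1 - L)) := by rw [hinv, mul_one]
      _ = _ := by rw [← mul_assoc, hm, smul_mul_assoc, one_mul]
  have hda : derivative a = (1 / 2 : ℂ) • (X.map C * L).trace := by
    rw [hL, hYdef, ← map_derivative_nilEval_scaleMatrix (matrix_pow_eq_zero hI hXI), ha]
    simp [Matrix.trace, hYdef]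
  have hdU : derivative U.trace = (spinRep γ' (X.map C) * U).trace := by
    have h1 := map_derivative_nilEval_scaleMatrix hS0 (PowerSeries.exp ℂ)
    rw [PowerSeries.derivative_exp, ← expForm_eq_nilEval, hscale, ← hU, hmapS] at h1
    rw [← h1]
    simp [Matrix.trace]
  have hD : derivative U.trace = derivative a * U.trace := by
    have h1 : (spinRep γ' (X.map C) * U).trace = (1 / 4 : ℂ) • ((X.map C).transpose * m).trace := by
      have h2 : ((X.map C).transpose * m).trace = ∑ b, ∑ a, X.map C a b * (γ' a * γ' b * U).trace :=
        rfl
      rw [h2, Finset.sum_comm]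
      simp only [spinRep, Finset.sum_mul, Matrix.trace_sum, smul_mul_assoc, Matrix.trace_smul,
        Finset.smul_sum]
      refine Finset.sum_congr rfl fun a _ => Finset.sum_congr rfl fun b _ => ?_
      rw [smul_comm, smul_eq_mul]
    rw [hdU, h1, hm', hskC, Matrix.mul_smul, Matrix.trace_smul, neg_mul, Matrix.trace_neg, mul_sub,
      mul_one, Matrix.trace_sub, trace_eq_zero_of_transpose_eq_neg hskC, hda, zero_sub, neg_neg,
      smul_eq_mul, smul_mul_assoc, two_mul, add_mul, smul_add, ← add_smul, mul_comm U.trace]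
    norm_num
  have h0 : a.eval 0 = 0 := by
    have h1 := htr (κ := Fin r) 0 (nilEval N logOneAddExpHalf Y)
    rw [hYdef, map_eval_nilEval_scaleMatrix, zero_smul, nilEval_zero,
      constantCoeff_logOneAddExpHalf, map_zero, Matrix.trace_zero] at h1
    rw [ha, eval_smul, hYdef, h1, smul_zero]
  have haN : a ^ (N + 1) = 0 :=
    pow_eq_zero_of_mem_ideal (map_C_ideal_pow hI) (smul_mem_ideal
      (trace_nilEval_mem (scaleMatrix_mem hXI) constantCoeff_logOneAddExpHalf) _)
  have h := eval_one_eq_of_derivative_eq haN h0 hD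
  rw [hU, ← hscale, expForm_eq_nilEval, htr', htr', map_eval_nilEval_scaleMatrix,
    map_eval_nilEval_scaleMatrix, one_smul, zero_smul, nilEval_zero, ha, eval_smul,
    htr (κ := Fin r), hYdef, map_eval_nilEval_scaleMatrix, one_smul, ← expForm_eq_nilEval] at h
  rw [h]
  simp

/-- The Chern character form of the spinor bundle. -/
theorem ch_spinorCurvature {n m r : ℕ} (hr : r = 2 * m) {I : Ideal (EvenForms n)}
    (hI : I ^ (n + 1) = ⊥) {R : Matrix (Fin r) (Fin r) (EvenForms n)} (hR : R.transpose = -R)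
    (hRI : ∀ a b, R a b ∈ I) :
    ch (spinorCurvature m R) = (2 ^ m : ℂ) • expForm n ((1 / 2 : ℂ) •
      (nilEval n logOneAddExpHalf ((Complex.I / (2 * Real.pi)) • R)).trace) := by
  set γ : Fin r → Matrix (Fin m → Fin 2) (Fin m → Fin 2) (EvenForms n) :=
    fun a => (gamma m a).map (algebraMap ℂ (EvenForms n)) with hγ
  have hγc : IsClifford γ := fun a b => by
    have h := congrArg (fun M => (algebraMap ℂ (EvenForms n)).mapMatrix M)
      (gamma_clifford m (a := a) (b := b) (by omega) (by omega))
    simp only [map_add, map_mul, apply_ite ((algebraMap ℂ (EvenForms n)).mapMatrix), map_ofNat,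
      map_zero, Fin.val_inj] at h
    exact h
  have h1 : (Complex.I / (2 * Real.pi)) • spinorCurvature m R =
      spinRep γ ((Complex.I / (2 * Real.pi)) • R) := by
    ext s t : 1
    rw [spinRep_apply]
    simp only [spinorCurvature, Matrix.smul_apply, Matrix.of_apply, Finset.smul_sum]
    refine Finset.sum_congr rfl fun a _ => Finset.sum_congr rfl fun b _ => ?_
    have h2 : (γ a * γ b) s t = algebraMap ℂ (EvenForms n) ((gamma m a * gamma m b) s t) := by
      rw [hγ, ← Matrix.map_mul, Matrix.map_apply]
    rw [h2, smul_mul_assoc]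
    congr 1
    rw [mul_smul, Algebra.smul_def ((gamma m a * gamma m b) s t), mul_smul_comm, mul_comm]
  rw [ch, expCurvature, h1, trace_expForm_spinRep hI hγc]
  · rw [Algebra.smul_def (2 ^ m : ℂ), map_pow, map_ofNat]
    simp only [Fintype.card_pi, Fintype.card_fin, Finset.prod_const, Finset.card_univ,
      Nat.cast_pow, Nat.cast_ofNat]
  · rw [Matrix.transpose_smul, hR, smul_neg]
  · exact fun a b => smul_mem_ideal (hRI a b) _

end Spin

/-! ### Even forms: nilpotency and topology -/

section EvenForms

variable {n : ℕ}

/-- The ideal of even forms of positive degree. -/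
def positiveForms (n : ℕ) : Ideal (EvenForms n) :=
  Ideal.span {w | ∃ u v : Fin n → ℂ,
    (w : Forms n) = ExteriorAlgebra.ι ℂ u * ExteriorAlgebra.ι ℂ v}

theorem dxdx_mem (μ ν : Fin n) : dxdx μ ν ∈ positiveForms n :=
  Ideal.subset_span ⟨_, _, rfl⟩

theorem degreeForms_eq_bot {p : ℕ} (hp : n < p) : degreeForms n p = ⊥ := by
  rw [← Submodule.finrank_eq_zero (R := ℂ), exteriorPower.finrank_eq, Module.finrank_fin_fun,
    Nat.choose_eq_zero_of_lt hp]

theorem one_mem_degreeForms : (1 : Forms n) ∈ degreeForms n 0 :=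
  SetLike.GradedOne.one_mem (A := fun i : ℕ => ⋀[ℂ]^i (Fin n → ℂ))

theorem mul_mem_degreeForms {p q : ℕ} {x y : Forms n} (hx : x ∈ degreeForms n p)
    (hy : y ∈ degreeForms n q) : x * y ∈ degreeForms n (p + q) :=
  SetLike.GradedMul.mul_mem (A := fun i : ℕ => ⋀[ℂ]^i (Fin n → ℂ)) hx hy

theorem ι_mem_degreeForms (u : Fin n → ℂ) : ExteriorAlgebra.ι ℂ u ∈ degreeForms n 1 := by
  change _ ∈ LinearMap.range (ExteriorAlgebra.ι ℂ) ^ 1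
  rw [pow_one]
  exact ⟨u, rfl⟩

theorem dx_mem_degreeForms (μ : Fin n) : dx μ ∈ degreeForms n 1 := ι_mem_degreeForms _

theorem dxdx_mem_degreeForms (μ ν : Fin n) : (dxdx μ ν : Forms n) ∈ degreeForms n 2 :=
  mul_mem_degreeForms (dx_mem_degreeForms μ) (dx_mem_degreeForms ν)

open Pointwise in
/-- A product of `n + 1` even forms of positive degree has degree greater than `n`. -/
theorem positiveForms_pow (n : ℕ) : positiveForms n ^ (n + 1) = ⊥ := by
  have h : ∀ k : ℕ, ∀ w ∈ {w : EvenForms n | ∃ u v : Fin n → ℂ,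
    (w : Forms n) = ExteriorAlgebra.ι ℂ u * ExteriorAlgebra.ι ℂ v} ^ k,
      (w : Forms n) ∈ degreeForms n (2 * k) := by
    intro k
    induction k with
    | zero =>
      intro w hw
      rw [pow_zero, Set.mem_one] at hw
      rw [hw]
      exact one_mem_degreeForms
    | succ k ih =>
      intro w hw
      rw [pow_succ, Set.mem_mul] at hw
      obtain ⟨x, hx, y, ⟨u, v, hy⟩, rfl⟩ := hw
      rw [MulMemClass.coe_mul, hy]
      exact mul_mem_degreeForms (ih x hx)
        (mul_mem_degreeForms (ι_mem_degreeForms u) (ι_mem_degreeForms v))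
  rw [positiveForms, Ideal.span, Submodule.span_pow, Submodule.span_eq_bot]
  intro w hw
  have := h (n + 1) w hw
  rw [degreeForms_eq_bot (by omega), Submodule.mem_bot] at this
  exact Subtype.ext this

instance : IsModuleTopology ℂ (EvenForms n) := ⟨rfl⟩

instance : Module.Finite ℂ (Forms n) := Module.Finite.of_basis (dxBasis n)

instance : Module.Finite ℂ (EvenForms n) :=
  inferInstanceAs (Module.Finite ℂ (Subalgebra.toSubmodule (evenForms n)))

instance : IsTopologicalRing (EvenForms n) := IsModuleTopology.isTopologicalRing ℂ (EvenForms n)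

instance : T2Space (EvenForms n) :=
  T2Space.of_injective_continuous
    (f := (dxBasis n).equivFun.toLinearMap ∘ₗ (evenForms n).val.toLinearMap)
    ((dxBasis n).equivFun.injective.comp Subtype.val_injective)
    (IsModuleTopology.continuous_of_linearMap _)

instance : ContinuousSMul ℂ (EvenForms n) := IsModuleTopology.toContinuousSMul ℂ (EvenForms n)

theorem continuous_expForm : Continuous (expForm n : EvenForms n → EvenForms n) := by
  unfold expForm
  fun_prop

theorem expForm_add_of_mem {x y : EvenForms n} (hx : x ∈ positiveForms n)
    (hy : y ∈ positiveForms n) : expForm n (x + y) = expForm n x * expForm n y :=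
  expForm_add (Commute.all x y) (pow_eq_zero_of_mem_ideal (positiveForms_pow n) hx)
    (pow_eq_zero_of_mem_ideal (positiveForms_pow n) hy)
    (pow_eq_zero_of_mem_ideal (positiveForms_pow n) (Ideal.add_mem _ hx hy))

theorem expForm_sum {κ : Type*} (s : Finset κ) {x : κ → EvenForms n}
    (hx : ∀ k, x k ∈ positiveForms n) :
    expForm n (∑ k ∈ s, x k) = ∏ k ∈ s, expForm n (x k) := by
  classical
  induction s using Finset.induction_on with
  | empty => rw [Finset.sum_empty, Finset.prod_empty, expForm_zero]
  | insert a s ha ih =>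
    rw [Finset.sum_insert ha, Finset.prod_insert ha,
      expForm_add_of_mem (hx a) (Ideal.sum_mem _ fun k _ => hx k), ih]

/-- Infinite products of exponentials of even forms of positive degree, with scalar factors. -/
theorem hasProd_smul_expForm {c : ℕ → ℂ} (hc : Multipliable c) {κ : Type*} {s : Finset κ}
    {a : κ → ℕ → ℂ} {b : κ → ℂ} (hab : ∀ k ∈ s, HasSum (a k) (b k)) {v : κ → EvenForms n}
    (hv : ∀ k ∈ s, v k ∈ positiveForms n) :
    HasProd (fun j => c j • expForm n (∑ k ∈ s, a k j • v k))
      ((∏' j, c j) • expForm n (∑ k ∈ s, b k • v k)) := by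
  have hmem : ∀ j, ∑ k ∈ s, a k j • v k ∈ positiveForms n := fun j =>
    Ideal.sum_mem _ fun k hk => smul_mem_ideal (hv k hk) _
  have h1 : HasSum (fun j => ∑ k ∈ s, a k j • v k) (∑ k ∈ s, b k • v k) :=
    hasSum_sum fun k hk => (hab k hk).smul_const (v k)
  have h2 := hc.hasProd
  rw [HasSum] at h1
  rw [HasProd] at h2 ⊢
  refine ((h2.smul ((continuous_expForm.tendsto _).comp h1))).congr fun F => ?_
  rw [Function.comp_apply, expForm_sum F hmem]
  simp only [Algebra.smul_def, Finset.prod_mul_distrib, map_prod]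

end EvenForms

/-! ### Characteristic forms as exponentials of power traces -/

section CharacteristicForms

variable {n r : ℕ} {R : Matrix (Fin r) (Fin r) (EvenForms n)}

/-- The form `tr (√-1 R/2π)ᵏ`. -/
def powerTrace (k : ℕ) (R : Matrix (Fin r) (Fin r) (EvenForms n)) : EvenForms n :=
  (((Complex.I / (2 * Real.pi)) • R) ^ k).trace

/-- The even numbers `k` with `2 ≤ k ≤ n`. -/
def evenDegrees (n : ℕ) : Finset ℕ := (Finset.range (n + 1)).filter fun k => Even k ∧ k ≠ 0

/-- The form `∑ aₖ/k! · tr (√-1 R/2π)ᵏ`, the sum being over the even `k ≥ 2`. -/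
def traceSum (a : ℕ → ℂ) (R : Matrix (Fin r) (Fin r) (EvenForms n)) : EvenForms n :=
  ∑ k ∈ evenDegrees n, (a k / k.factorial) • powerTrace k R

theorem even_of_mem_evenDegrees {k : ℕ} (hk : k ∈ evenDegrees n) : Even k ∧ k ≠ 0 :=
  (Finset.mem_filter.mp hk).2

theorem traceSum_congr {a b : ℕ → ℂ} (h : ∀ k, Even k → k ≠ 0 → a k = b k) :
    traceSum a R = traceSum b R :=
  Finset.sum_congr rfl fun k hk => by
    rw [h k (even_of_mem_evenDegrees hk).1 (even_of_mem_evenDegrees hk).2]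

theorem traceSum_add (a b : ℕ → ℂ) :
    traceSum (fun k => a k + b k) R = traceSum a R + traceSum b R := by
  simp only [traceSum, ← Finset.sum_add_distrib, ← add_smul, add_div]

theorem traceSum_neg (a : ℕ → ℂ) : traceSum (fun k => -a k) R = -traceSum a R := by
  simp only [traceSum, ← Finset.sum_neg_distrib, ← neg_smul, neg_div]

/-- The odd power traces of a skew-symmetric matrix of commuting elements vanish. -/
theorem trace_pow_eq_zero_of_odd {A : Type*} [CommRing A] [Algebra ℂ A]
    {X : Matrix (Fin r) (Fin r) A} (hX : X.transpose = -X) {k : ℕ} (hk : Odd k) :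
    (X ^ k).trace = 0 := by
  refine trace_eq_zero_of_transpose_eq_neg ?_
  rw [Matrix.transpose_pow, hX, hk.neg_pow]

theorem transpose_smul_eq_neg (hR : R.transpose = -R) (z : ℂ) :
    (z • R).transpose = -(z • R) := by
  rw [Matrix.transpose_smul, hR, smul_neg]

theorem smul_mem_positiveForms (hRI : ∀ a b, R a b ∈ positiveForms n) (z : ℂ) (a b : Fin r) :
    (z • R) a b ∈ positiveForms n :=
  smul_mem_ideal (hRI a b) z

theorem powerTrace_mem (hRI : ∀ a b, R a b ∈ positiveForms n) {k : ℕ} (hk : k ≠ 0) :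
    powerTrace k R ∈ positiveForms n :=
  trace_pow_mem (smul_mem_positiveForms hRI _) hk

theorem traceSum_mem (hRI : ∀ a b, R a b ∈ positiveForms n) (a : ℕ → ℂ) :
    traceSum a R ∈ positiveForms n :=
  Ideal.sum_mem _ fun _ hk =>
    smul_mem_ideal (powerTrace_mem hRI (even_of_mem_evenDegrees hk).2) _

/-- Only even powers contribute, by skew-symmetry. -/
theorem trace_nilEval_eq_traceSum (hR : R.transpose = -R) {f : PowerSeries ℂ}
    (hf : PowerSeries.constantCoeff f = 0) :
    (nilEval n f ((Complex.I / (2 * Real.pi)) • R)).trace =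
      traceSum (fun k => k.factorial * PowerSeries.coeff k f) R := by
  rw [trace_nilEval, traceSum, evenDegrees, Finset.sum_filter]
  refine Finset.sum_congr rfl fun k _ => ?_
  split_ifs with h
  · have : (k.factorial : ℂ) ≠ 0 := by exact_mod_cast k.factorial_ne_zero
    rw [mul_div_cancel_left₀ _ this, powerTrace]
  · rcases eq_or_ne k 0 with rfl | hk
    · rw [PowerSeries.coeff_zero_eq_constantCoeff_apply, hf, zero_smul]
    · rw [trace_pow_eq_zero_of_odd (transpose_smul_eq_neg hR _), smul_zero]
      rw [← Nat.not_even_iff_odd]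
      exact fun h' => h ⟨h', hk⟩

/-- `ch(∧_t E)` is the determinant of `1 + t exp(√-1 R/2π)`. -/
theorem chLambda_eq_expForm (hR : R.transpose = -R) (hRI : ∀ a b, R a b ∈ positiveForms n) {t : ℂ}
    (ht : ‖t‖ < 1) : chLambda t R =
      ((1 + t) ^ r) • expForm n (traceSum (fun k => -powerSum (k - 1) (-t)) R) := by
  have h1 : 1 + t • expCurvature R =
      nilEval n (1 + t • PowerSeries.exp ℂ) ((Complex.I / (2 * Real.pi)) • R) := by
    rw [nilEval_add, nilEval_one, nilEval_smul, ← expForm_eq_nilEval, expCurvature]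
  rw [chLambda_eq_det, h1, det_nilEval_of_mem (positiveForms_pow n) (smul_mem_positiveForms hRI _)
    (derivative_one_add_exp ht) (constantCoeff_logOneAddExp t),
    trace_nilEval_eq_traceSum hR (constantCoeff_logOneAddExp t), ← Algebra.smul_def, Fintype.card_fin]
  congr 2
  · simp
  · refine traceSum_congr fun k _ hk => ?_
    have : (k.factorial : ℂ) ≠ 0 := by exact_mod_cast k.factorial_ne_zero
    rw [logOneAddExp, PowerSeries.coeff_mk, if_neg hk]
    field_simp

theorem one_add_ne_zero_of_norm_lt_one {t : ℂ} (ht : ‖t‖ < 1) : 1 + t ≠ 0 := by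
  intro h
  have : t = -1 := eq_neg_of_add_eq_zero_right h
  rw [this] at ht
  simp at ht

theorem chLambdaTilde_eq_expForm (hR : R.transpose = -R) (hRI : ∀ a b, R a b ∈ positiveForms n)
    {t : ℂ} (ht : ‖t‖ < 1) : chLambdaTilde t R =
      expForm n (traceSum (fun k => -powerSum (k - 1) (-t)) R) := by
  rw [chLambdaTilde, chLambda_eq_expForm hR hRI ht, smul_smul,
    inv_mul_cancel₀ (pow_ne_zero _ (one_add_ne_zero_of_norm_lt_one ht)), one_smul]

theorem expForm_mul_neg_of_mem {x : EvenForms n} (hx : x ∈ positiveForms n) :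
    expForm n x * expForm n (-x) = 1 :=
  expForm_mul_expForm_neg (pow_eq_zero_of_mem_ideal (positiveForms_pow n) hx)

theorem chSymTilde_eq_expForm (hR : R.transpose = -R) (hRI : ∀ a b, R a b ∈ positiveForms n)
    {t : ℂ} (ht : ‖t‖ < 1) : chSymTilde t R =
      expForm n (traceSum (fun k => powerSum (k - 1) t) R) := by
  rw [chSymTilde, chLambdaTilde_eq_expForm hR hRI (by rwa [norm_neg]), neg_neg, traceSum_neg]
  have h := expForm_mul_neg_of_mem (traceSum_mem hRI fun k => powerSum (k - 1) t)
  have hu : IsUnit (expForm n (-traceSum (fun k => powerSum (k - 1) t) R)) :=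
    IsUnit.of_mul_eq_one _ ((mul_comm _ _).trans h)
  rw [← mul_one (Ring.inverse _), ← h, mul_left_comm, Ring.inverse_mul_cancel _ hu, mul_one]

theorem nilEval_X_of_mem {y : EvenForms n} (hy : y ∈ positiveForms n) :
    nilEval n PowerSeries.X y = y := by
  rcases n with _ | n
  · have h0 : y = 0 := by simpa using pow_eq_zero_of_mem_ideal (positiveForms_pow 0) hy
    rw [h0, nilEval_zero]
    simp
  · simp only [nilEval, PowerSeries.coeff_X, ite_smul, one_smul, zero_smul]
    rw [Finset.sum_ite_eq', if_pos (by simp), pow_one]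

/-- Square roots with constant term one are unique. -/
theorem rsqrtOneAdd_expForm_sub_one {z : EvenForms n} (hz : z ∈ positiveForms n) :
    rsqrtOneAdd (expForm n z - 1) = expForm n ((-1 / 2 : ℂ) • z) := by
  have hI := positiveForms_pow n
  have hzN := pow_eq_zero_of_mem_ideal hI hz
  have hmem : ∀ w ∈ positiveForms n, ∀ f : PowerSeries ℂ,
      nilEval n f w - algebraMap ℂ _ (PowerSeries.constantCoeff f) ∈ positiveForms n := by
    intro w hw f
    rw [nilEval, Finset.sum_range_succ', pow_zero, PowerSeries.coeff_zero_eq_constantCoeff_apply,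
      ← Algebra.algebraMap_eq_smul_one, add_sub_cancel_right]
    exact Ideal.sum_mem _ fun j _ => smul_mem_ideal
      (Ideal.pow_le_self j.succ_ne_zero (Ideal.pow_mem_pow hw _)) _
  have hy : expForm n z - 1 ∈ positiveForms n := by
    have := hmem z hz (PowerSeries.exp ℂ)
    rwa [← expForm_eq_nilEval, PowerSeries.constantCoeff_exp, map_one] at this
  have hr : rsqrtOneAdd (expForm n z - 1) = nilEval n rsqrtSeries (expForm n z - 1) := by
    simp only [rsqrtOneAdd, nilEval, rsqrtSeries, PowerSeries.coeff_mk]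
  set y := expForm n z - 1 with hydef
  set u := nilEval n rsqrtSeries y with hu
  set v := expForm n ((-1 / 2 : ℂ) • z) with hv
  have hyN := pow_eq_zero_of_mem_ideal hI hy
  have h1 : u * u * (1 + y) = 1 := by
    have := congrArg (fun f => nilEval n f y) rsqrtSeries_sq
    rw [nilEval_mul hyN, nilEval_mul hyN, nilEval_add, nilEval_one] at this
    rwa [nilEval_X_of_mem hy] at this
  have h2 : v * v * (1 + y) = 1 := by
    have h3 := expForm_smul_mul_smul hzN (-1 / 2) (-1 / 2)
    have h4 := expForm_smul_mul_smul hzN (-1) 1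
    rw [one_smul] at h4
    rw [hv, h3, hydef, add_sub_cancel, show (-1 / 2 + -1 / 2 : ℂ) = -1 by norm_num, h4]
    norm_num
    exact expForm_zero
  have hvI : v - 1 ∈ positiveForms n := by
    have := hmem _ (smul_mem_ideal hz (-1 / 2 : ℂ)) (PowerSeries.exp ℂ)
    rwa [← expForm_eq_nilEval, PowerSeries.constantCoeff_exp, map_one] at this
  have huI : u - 1 ∈ positiveForms n := by
    have := hmem y hy rsqrtSeries
    have hc : PowerSeries.constantCoeff rsqrtSeries = 1 := by
      rw [← PowerSeries.coeff_zero_eq_constantCoeff_apply, rsqrtSeries, PowerSeries.coeff_mk]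
      simp
    rwa [hc, map_one] at this
  -- `u + v` is the sum of `2` and a nilpotent element.
  have hunit : IsUnit (u + v) := by
    have h3 : IsNilpotent ((u - 1) + (v - 1)) :=
      ⟨n + 1, pow_eq_zero_of_mem_ideal hI (Ideal.add_mem _ huI hvI)⟩
    have h4 : IsUnit (2 : EvenForms n) := by
      have := (IsUnit.mk0 (2 : ℂ) two_ne_zero).map (algebraMap ℂ (EvenForms n))
      rwa [map_ofNat] at this
    have h5 := h3.isUnit_add_left_of_commute h4 (Commute.all _ _)
    have h6 : u + v = 2 + (u - 1 + (v - 1)) := by ring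
    rwa [h6]
  have h7 : (u - v) * (u + v) = 0 := by
    linear_combination v * v * h1 - u * u * h2
  rw [hr]
  exact sub_eq_zero.mp ((hunit.mul_left_eq_zero).mp h7)

/-- `log (sinh x / x)` has the coefficients `2ᵏ Bₖ/(k · k!)`; the factor `2ᵏ` is absorbed by the
normalization `√-1 R/4π` in the `Â`-form. -/
theorem AHat_eq_expForm (hR : R.transpose = -R) (hRI : ∀ a b, R a b ∈ positiveForms n) :
    AHat R = expForm n (traceSum (fun k => -(bernoulli k : ℂ) / (2 * k)) R) := by
  have hI := positiveForms_pow n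
  set X := (Complex.I / (2 * Real.pi)) • R with hX
  have hY : (Complex.I / (4 * Real.pi)) • R = (1 / 2 : ℂ) • X := by
    rw [hX, smul_smul]
    congr 1
    ring
  have hYI : ∀ a b, ((1 / 2 : ℂ) • X) a b ∈ positiveForms n := fun a b => by
    rw [← hY]
    exact smul_mem_positiveForms hRI _ a b
  have h1 : sinhDiv ((1 / 2 : ℂ) • X) = nilEval n sinhc ((1 / 2 : ℂ) • X) := by
    rw [← nilEval_of_le (matrix_pow_eq_zero hI hYI) (show n ≤ 2 * n + 1 by omega), nilEval, sinhDiv]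
    have : ∀ m : ℕ, ∑ j ∈ Finset.range (2 * m), PowerSeries.coeff j sinhc • ((1 / 2 : ℂ) • X) ^ j =
        ∑ j ∈ Finset.range m, (((2 * j + 1).factorial : ℂ)⁻¹) • ((1 / 2 : ℂ) • X) ^ (2 * j) := by
      intro m
      induction m with
      | zero => simp
      | succ m ih =>
        rw [mul_add, mul_one, Finset.sum_range_succ, Finset.sum_range_succ, ih,
          Finset.sum_range_succ, sinhc, PowerSeries.coeff_mk, PowerSeries.coeff_mk,
          if_pos (even_two_mul m), if_neg (by simp), zero_smul, add_zero]
    exact (this (n + 1)).symm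
  have h2 : (nilEval n logSinhc ((1 / 2 : ℂ) • X)).trace =
      traceSum (fun k => (bernoulli k : ℂ) / k) R := by
    have h3 : (nilEval n logSinhc ((1 / 2 : ℂ) • X)) =
        nilEval n (PowerSeries.rescale (1 / 2 : ℂ) logSinhc) X := by
      simp only [nilEval, PowerSeries.coeff_rescale, smul_pow, smul_smul]
      refine Finset.sum_congr rfl fun j _ => ?_
      rw [mul_comm]
    rw [h3, hX, trace_nilEval_eq_traceSum hR]
    · refine traceSum_congr fun k hk hk0 => ?_
      rw [PowerSeries.coeff_rescale, logSinhc, PowerSeries.coeff_mk, if_pos ⟨hk, hk0⟩]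
      have : (k.factorial : ℂ) ≠ 0 := by exact_mod_cast k.factorial_ne_zero
      have : (k : ℂ) ≠ 0 := by exact_mod_cast hk0
      rw [one_div, inv_pow]
      field_simp
    · rw [← PowerSeries.coeff_zero_eq_constantCoeff_apply, PowerSeries.coeff_rescale,
        PowerSeries.coeff_zero_eq_constantCoeff_apply, constantCoeff_logSinhc, mul_zero]
  rw [AHat, hY, h1, det_nilEval_of_mem hI hYI derivative_sinhc constantCoeff_logSinhc,
    constantCoeff_sinhc, one_pow, map_one, one_mul, h2,
    rsqrtOneAdd_expForm_sub_one (traceSum_mem hRI _)]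
  congr 1
  rw [traceSum, traceSum, Finset.smul_sum]
  refine Finset.sum_congr rfl fun k _ => ?_
  rw [smul_smul]
  congr 1
  ring

theorem ch_spinorCurvature_eq_expForm {m : ℕ} (hr : r = 2 * m) (hR : R.transpose = -R)
    (hRI : ∀ a b, R a b ∈ positiveForms n) : ch (spinorCurvature m R) = (2 ^ m : ℂ) •
      expForm n (traceSum (fun k => (2 ^ k - 1) * (bernoulli k : ℂ) / (2 * k)) R) := by
  rw [ch_spinorCurvature hr (positiveForms_pow n) hR hRI,
    trace_nilEval_eq_traceSum hR constantCoeff_logOneAddExpHalf]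
  congr 2
  rw [traceSum, traceSum, Finset.smul_sum]
  refine Finset.sum_congr rfl fun k hk => ?_
  obtain ⟨hk, hk0⟩ := even_of_mem_evenDegrees hk
  have h1 : (k.factorial : ℂ) ≠ 0 := by exact_mod_cast k.factorial_ne_zero
  have h2 : (k : ℂ) ≠ 0 := by exact_mod_cast hk0
  rw [smul_smul, logOneAddExpHalf, PowerSeries.coeff_mk,
    if_neg (by rintro rfl; simp at hk)]
  congr 1
  field_simp

end CharacteristicForms

/-! ### The infinite products -/

section InfiniteProducts

variable {n r : ℕ} {R : Matrix (Fin r) (Fin r) (EvenForms n)}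

theorem hasProd_smul_expForm_traceSum (hRI : ∀ a b, R a b ∈ positiveForms n) {c : ℕ → ℂ}
    (hc : Multipliable c) {a : ℕ → ℕ → ℂ} {b : ℕ → ℂ}
    (hab : ∀ k, Even k → k ≠ 0 → HasSum (fun j => a j k) (b k)) :
    HasProd (fun j => c j • expForm n (traceSum (a j) R))
      ((∏' j, c j) • expForm n (traceSum b R)) :=
  hasProd_smul_expForm hc (s := evenDegrees n) (a := fun k j => a j k / k.factorial)
    (fun k hk => (hab k (even_of_mem_evenDegrees hk).1 (even_of_mem_evenDegrees hk).2).div_const _)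
    (fun _ hk => powerTrace_mem hRI (even_of_mem_evenDegrees hk).2)

theorem tprod_chLambda (hR : R.transpose = -R) (hRI : ∀ a b, R a b ∈ positiveForms n) {t : ℕ → ℂ}
    (ht : ∀ j, ‖t j‖ < 1) (hm : Multipliable fun j => 1 + t j) {b : ℕ → ℂ}
    (hb : ∀ k, Even k → k ≠ 0 → HasSum (fun j => powerSum (k - 1) (-t j)) (b k)) :
    ∏' j, chLambda (t j) R =
      ((∏' j, (1 + t j)) ^ r) • expForm n (traceSum (fun k => -b k) R) := by
  have h1 : HasProd (fun j => (1 + t j) ^ r) ((∏' j, (1 + t j)) ^ r) :=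
    hm.hasProd.map (powMonoidHom r) (continuous_pow r)
  have h2 := hasProd_smul_expForm_traceSum hRI h1.multipliable
    (fun k hk hk0 => (hb k hk hk0).neg)
  rw [h1.tprod_eq] at h2
  simp only [← chLambda_eq_expForm hR hRI (ht _)] at h2
  exact h2.tprod_eq

theorem tprod_chLambdaTilde (hR : R.transpose = -R) (hRI : ∀ a b, R a b ∈ positiveForms n)
    {t : ℕ → ℂ} (ht : ∀ j, ‖t j‖ < 1) {b : ℕ → ℂ}
    (hb : ∀ k, Even k → k ≠ 0 → HasSum (fun j => powerSum (k - 1) (-t j)) (b k)) :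
    ∏' j, chLambdaTilde (t j) R = expForm n (traceSum (fun k => -b k) R) := by
  have h2 := hasProd_smul_expForm_traceSum hRI (c := fun _ => 1) multipliable_one
    (fun k hk hk0 => (hb k hk hk0).neg)
  simp only [tprod_one, one_smul, ← chLambdaTilde_eq_expForm hR hRI (ht _)] at h2
  exact h2.tprod_eq

theorem tprod_chSymTilde (hR : R.transpose = -R) (hRI : ∀ a b, R a b ∈ positiveForms n)
    {t : ℕ → ℂ} (ht : ∀ j, ‖t j‖ < 1) {b : ℕ → ℂ}
    (hb : ∀ k, Even k → k ≠ 0 → HasSum (fun j => powerSum (k - 1) (t j)) (b k)) :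
    ∏' j, chSymTilde (t j) R = expForm n (traceSum b R) := by
  have h2 := hasProd_smul_expForm_traceSum hRI (c := fun _ => 1) multipliable_one hb
  simp only [tprod_one, one_smul, ← chSymTilde_eq_expForm hR hRI (ht _)] at h2
  exact h2.tprod_eq

theorem qpow_eq_qParam_pow (τ : ℍ) (j : ℕ) :
    qpow τ j = Function.Periodic.qParam 1 (τ : ℂ) ^ j := by
  rw [qpow, Function.Periodic.qParam, ← Complex.exp_nat_mul]
  congr 1
  push_cast
  ring

theorem qpow_add_one (τ : ℍ) (j : ℕ) :
    qpow τ (j + 1) = Function.Periodic.qParam 1 (τ : ℂ) ^ (j + 1) := by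
  rw [← qpow_eq_qParam_pow, Nat.cast_succ]

theorem qpow_add_half (τ : ℍ) (j : ℕ) :
    qpow τ (j + 1 / 2) = Function.Periodic.qParam 1 (halfPoint 1 τ : ℂ) ^ (2 * j + 1) := by
  have h : qpow τ (1 / 2) = Function.Periodic.qParam 1 (halfPoint 1 τ : ℂ) := by
    rw [qpow, Function.Periodic.qParam, halfPoint_one_coe]
    congr 1
    push_cast
    ring
  have h2 : qpow τ (j + 1 / 2) = qpow τ j * qpow τ (1 / 2) := by
    rw [qpow, qpow, qpow, ← Complex.exp_add]
    congr 1
    push_cast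
    ring
  rw [h2, h, qpow_eq_qParam_pow, ← qParam_halfPoint_one_sq]
  ring

theorem eisTriple_zero {k : ℕ} (τ : ℍ) : eisTriple k 0 τ =
    (2 ^ k - 1) * (bernoulli k : ℂ) / (2 * k) +
      (lambert (k - 1) (Function.Periodic.qParam 1 (τ : ℂ)) -
        2 ^ k * lambert (k - 1) (Function.Periodic.qParam 1 (τ : ℂ) ^ 2)) := by
  simp only [eisTriple, halfTriple, eis, qParam_halfPoint_zero, Matrix.cons_val_zero]
  ring

theorem eisTriple_one {k : ℕ} (τ : ℍ) : eisTriple k 1 τ =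
    -(lambert (k - 1) (Function.Periodic.qParam 1 (halfPoint 1 τ : ℂ)) -
      lambert (k - 1) (Function.Periodic.qParam 1 (halfPoint 1 τ : ℂ) ^ 2)) := by
  simp only [eisTriple, halfTriple, eis, qParam_halfPoint_one_sq, Matrix.cons_val_one]
  simp

theorem eisTriple_two {k : ℕ} (τ : ℍ) : eisTriple k 2 τ =
    -(lambert (k - 1) (-Function.Periodic.qParam 1 (halfPoint 1 τ : ℂ)) -
      lambert (k - 1) ((-Function.Periodic.qParam 1 (halfPoint 1 τ : ℂ)) ^ 2)) := by
  simp only [eisTriple, halfTriple, eis, qParam_halfPoint_two, neg_sq, qParam_halfPoint_one_sq,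
    Matrix.cons_val_two]
  simp

theorem norm_pow_odd_lt_one {q : ℂ} (hq : ‖q‖ < 1) (j : ℕ) : ‖q ^ (2 * j + 1)‖ < 1 :=
  norm_pow_succ_lt_one hq (2 * j)

/-- The contribution of the tangent bundle: the Bernoulli numbers in `Â` are the constant terms of
the Eisenstein series whose remaining terms come from the symmetric powers. -/
theorem AHat_mul_tprod_chSymTilde (hR : R.transpose = -R)
    (hRI : ∀ a b, R a b ∈ positiveForms n) (τ : ℍ) :
    AHat R * ∏' j : ℕ, chSymTilde (qpow τ (j + 1)) R =
      expForm n (traceSum (fun k => eis k τ) R) := by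
  have hq := norm_qParam_one_lt τ
  simp only [qpow_add_one]
  rw [tprod_chSymTilde hR hRI (norm_pow_succ_lt_one hq) (fun k _ _ => hasSum_lambert (k - 1) hq),
    AHat_eq_expForm hR hRI, ← expForm_add_of_mem (traceSum_mem hRI _) (traceSum_mem hRI _),
    ← traceSum_add]
  rfl

theorem tprod_chLambdaTilde_qpow (hR : R.transpose = -R)
    (hRI : ∀ a b, R a b ∈ positiveForms n) (τ : ℍ) :
    ∏' j : ℕ, chLambdaTilde (-qpow τ (j + 1)) R = expForm n (traceSum (fun k =>
      -lambert (k - 1) (Function.Periodic.qParam 1 (τ : ℂ))) R) := by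
  have hq := norm_qParam_one_lt τ
  simp only [qpow_add_one]
  refine tprod_chLambdaTilde hR hRI (fun j => ?_) (fun k _ _ => ?_)
  · rw [norm_neg]
    exact norm_pow_succ_lt_one hq j
  · simp only [neg_neg]
    exact hasSum_lambert (k - 1) hq

theorem hasSum_powerSum_neg_pred {k : ℕ} (hk : k ≠ 0) {q : ℂ} (hq : ‖q‖ < 1) :
    HasSum (fun j : ℕ => powerSum (k - 1) (-q ^ (j + 1)))
      (-(lambert (k - 1) q - 2 ^ k * lambert (k - 1) (q ^ 2))) := by
  have h := hasSum_powerSum_neg (k - 1) hq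
  rwa [Nat.sub_add_cancel (Nat.one_le_iff_ne_zero.mpr hk)] at h

/-- The contribution of the auxiliary spin bundle of rank `16 l`: three theta functions that the
modular group permutes, each times an exponential of differences of Eisenstein series. -/
theorem spin_bundle_factor {l : ℕ} {R : Matrix (Fin (16 * l)) (Fin (16 * l)) (EvenForms n)}
    (hR : R.transpose = -R) (hRI : ∀ a b, R a b ∈ positiveForms n) (τ : ℍ) :
    algebraMap ℂ (EvenForms n) ((∏' j : ℕ, (1 - qpow τ (j + 1))) ^ (8 * l)) *
      (qpow τ l • (ch (spinorCurvature (8 * l) R) * ∏' j : ℕ, chLambda (qpow τ (j + 1)) R) +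
        (∏' j : ℕ, chLambda (-qpow τ (j + 1 / 2)) R) +
        (∏' j : ℕ, chLambda (qpow τ (j + 1 / 2)) R)) =
      ∑ s, thetaTriple s τ ^ l • expForm n (traceSum (fun k => eisTriple k s τ) R) := by
  have hq := norm_qParam_one_lt τ
  have hr := norm_qParam_one_lt (halfPoint 1 τ)
  simp only [qpow_add_one, qpow_add_half, qpow_eq_qParam_pow]
  rw [Fin.sum_univ_three, thetaTriple_zero, thetaTriple_one, thetaTriple_two]
  set q := Function.Periodic.qParam 1 (τ : ℂ) with hqdef
  set z := Function.Periodic.qParam 1 (halfPoint 1 τ : ℂ) with hzdef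
  have hP : ∏' j : ℕ, (1 - q ^ (j + 1)) = eulerProd q := rfl
  have hneg : ∀ j : ℕ, -z ^ (2 * j + 1) = (-z) ^ (2 * j + 1) := fun j =>
    ((odd_two_mul_add_one j).neg_pow z).symm
  have hz' : ‖-z‖ < 1 := by rwa [norm_neg]
  have h0 := tprod_chLambda hR hRI (t := fun j => q ^ (j + 1)) (norm_pow_succ_lt_one hq)
    (multipliable_one_add (summable_norm_pow_succ hq))
    (fun k _ hk => hasSum_powerSum_neg_pred hk hq)
  have h1 := tprod_chLambda hR hRI (t := fun j => -z ^ (2 * j + 1))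
    (fun j => by rw [norm_neg]; exact norm_pow_odd_lt_one hr j)
    (multipliable_one_add (by simpa only [norm_neg] using summable_norm_pow_odd hr))
    (fun k _ _ => by simpa only [neg_neg] using hasSum_powerSum_odd (k - 1) hr)
  have h2 := tprod_chLambda hR hRI (t := fun j => z ^ (2 * j + 1)) (norm_pow_odd_lt_one hr)
    (multipliable_one_add (summable_norm_pow_odd hr))
    (fun k _ _ => by simpa only [hneg] using hasSum_powerSum_odd (k - 1) hz')
  rw [h0, h1, h2, ch_spinorCurvature_eq_expForm (show 16 * l = 2 * (8 * l) by ring) hR hRI, hP,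
    ← Algebra.smul_def, smul_add, smul_add]
  simp only [eisTriple_one, eisTriple_two, eisTriple_zero, neg_neg, ← hqdef, ← hzdef,
    smul_mul_smul_comm, smul_smul]
  rw [← expForm_add_of_mem (traceSum_mem hRI _) (traceSum_mem hRI _), ← traceSum_add]
  congr 1
  · congr 1
    · congr 1
      rw [mul_pow, mul_pow, mul_pow, ← pow_mul, ← pow_mul, ← pow_mul, pow_mul 2 8 l]
      ring
    · congr 1
      rw [mul_pow, ← pow_mul, ← pow_mul, mul_comm]
  · congr 1
    rw [mul_pow, ← pow_mul, ← pow_mul, mul_comm]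

/-- The curvature matrix of the real plane bundle underlying a line bundle whose curvature is
`√-1 F`. -/
def planeCurvature (F : EvenForms n) : Matrix (Fin 2) (Fin 2) (EvenForms n) := !![0, -F; F, 0]

theorem planeCurvature_transpose (F : EvenForms n) :
    (planeCurvature F).transpose = -planeCurvature F := by
  ext i j : 1
  fin_cases i <;> fin_cases j <;> simp [planeCurvature]

theorem planeCurvature_mem {F : EvenForms n} (hF : F ∈ positiveForms n) (a b : Fin 2) :
    planeCurvature F a b ∈ positiveForms n := by
  fin_cases a <;> fin_cases b <;> simp [planeCurvature, hF]

theorem powerTrace_planeCurvature (F : EvenForms n) {k : ℕ} (hk : Even k) :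
    powerTrace k (planeCurvature F) =
      (2 : ℂ) • ((Complex.I / (2 * Real.pi)) • (Complex.I • F)) ^ k := by
  obtain ⟨m, rfl⟩ := hk
  have h : ((Complex.I / (2 * Real.pi)) • planeCurvature F) ^ 2 =
      Matrix.scalar (Fin 2) (((Complex.I / (2 * Real.pi)) • (Complex.I • F)) ^ 2) := by
    rw [sq]
    ext i j : 1
    have h1 : ∀ z : ℂ, -(z • z • (F * F)) = (z • Complex.I • F) ^ 2 := fun z => by
      rw [sq, smul_mul_smul_comm, smul_mul_smul_comm, Complex.I_mul_I, neg_one_smul, smul_neg,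
        smul_smul]
    fin_cases i <;> fin_cases j <;> simp [planeCurvature, Matrix.mul_apply, h1]
  rw [powerTrace, ← two_mul, pow_mul, h, ← map_pow, ← pow_mul]
  simp [Matrix.trace, two_smul]

/-- The odd part of `e^{c/2}` contributes the Bernoulli numbers that complete the Eisenstein series
of the plane bundle `ξ_ℝ`. -/
theorem sinh_eq_expForm {F c : EvenForms n} (hF : F ∈ positiveForms n)
    (hc : c = (Complex.I / (2 * Real.pi)) • (Complex.I • F)) :
    (1 / 2 : ℂ) • (expForm n ((1 / 2 : ℂ) • c) - expForm n (-((1 / 2 : ℂ) • c))) =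
      (1 / 2 : ℂ) • c *
        expForm n (traceSum (fun k => (bernoulli k : ℂ) / (2 * k)) (planeCurvature F)) := by
  have hcI : c ∈ positiveForms n := by
    rw [hc]
    exact smul_mem_ideal (smul_mem_ideal hF _) _
  set y := (1 / 2 : ℂ) • c with hy
  have hyI : y ∈ positiveForms n := smul_mem_ideal hcI _
  have hI := positiveForms_pow n
  have hyN := pow_eq_zero_of_mem_ideal hI hyI
  have h1 := congrArg (fun f => nilEval n f y) two_X_mul_sinhc
  have h2 : (2 * PowerSeries.X : PowerSeries ℂ) = (2 : ℂ) • PowerSeries.X := by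
    rw [two_smul, two_mul]
  have h3 : nilEval n (PowerSeries.rescale (-1) (PowerSeries.exp ℂ)) y = expForm n (-y) := by
    simp only [expForm_eq_nilEval, nilEval, PowerSeries.coeff_rescale]
    refine Finset.sum_congr rfl fun j _ => ?_
    rw [neg_pow y, mul_comm, mul_smul]
    congr 1
    rcases Nat.even_or_odd j with h | h
    · rw [h.neg_one_pow, h.neg_one_pow, one_smul, one_mul]
    · rw [h.neg_one_pow, h.neg_one_pow, neg_one_smul, neg_one_mul]
  have h4 : PowerSeries.exp ℂ - PowerSeries.rescale (-1) (PowerSeries.exp ℂ) =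
      PowerSeries.exp ℂ + (-1 : ℂ) • PowerSeries.rescale (-1) (PowerSeries.exp ℂ) := by
    rw [neg_one_smul, sub_eq_add_neg]
  rw [nilEval_mul hyN, h2, nilEval_smul, nilEval_X_of_mem hyI, h4, nilEval_add, nilEval_smul,
    ← expForm_eq_nilEval, h3, neg_one_smul, ← sub_eq_add_neg] at h1
  have h5 : nilEval n logSinhc y =
      traceSum (fun k => (bernoulli k : ℂ) / (2 * k)) (planeCurvature F) := by
    rw [nilEval, traceSum, evenDegrees, Finset.sum_filter]
    refine Finset.sum_congr rfl fun k _ => ?_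
    rw [logSinhc, PowerSeries.coeff_mk]
    split_ifs with h
    · have : (k.factorial : ℂ) ≠ 0 := by exact_mod_cast k.factorial_ne_zero
      have : (k : ℂ) ≠ 0 := by exact_mod_cast h.2
      rw [powerTrace_planeCurvature F h.1, ← hc, hy, smul_pow, smul_smul, smul_smul]
      congr 1
      rw [one_div, inv_pow]
      field_simp
    · rw [zero_smul]
  rw [← h1, nilEval_eq_exp_of_mem hI hyI derivative_sinhc constantCoeff_logSinhc,
    constantCoeff_sinhc, map_one, one_mul, h5, smul_mul_assoc, smul_smul]
  norm_num

theorem Q₁Integrand_eq {l : ℕ} {RT : Matrix (Fin n) (Fin n) (EvenForms n)}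
    {RV : Matrix (Fin (16 * l)) (Fin (16 * l)) (EvenForms n)} {F : EvenForms n}
    (hRT : RT.transpose = -RT) (hRTI : ∀ a b, RT a b ∈ positiveForms n)
    (hRV : RV.transpose = -RV) (hRVI : ∀ a b, RV a b ∈ positiveForms n)
    (hF : F ∈ positiveForms n) (c : EvenForms n) (τ : ℍ) :
    Q₁Integrand l RT c (planeCurvature F) RV τ = expForm n ((1 / 2 : ℂ) • c) *
      (expForm n (traceSum (fun k => eis k τ) RT) *
        expForm n (traceSum (fun k => -lambert (k - 1) (Function.Periodic.qParam 1 (τ : ℂ)))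
          (planeCurvature F)) *
        ∑ s, thetaTriple s τ ^ l • expForm n (traceSum (fun k => eisTriple k s τ) RV)) := by
  rw [Q₁Integrand, mul_assoc _ (algebraMap ℂ (EvenForms n) _), spin_bundle_factor hRV hRVI,
    ← AHat_mul_tprod_chSymTilde hRT hRTI,
    tprod_chLambdaTilde_qpow (planeCurvature_transpose F) (planeCurvature_mem hF)]
  ring

end InfiniteProducts

/-! ### Calculus of differential forms in coordinates -/

section Calculus

variable {n : ℕ} {x : Coord n} {f g : Coord n → Forms n}

/-- The coefficients of `f` are differentiable at `x`. The exterior algebra carries no norm here, so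
differentiability is a condition on coefficients. -/
def DifferentiableFormAt (f : Coord n → Forms n) (x : Coord n) : Prop :=
  ∀ S, DifferentiableAt ℝ (fun y => (dxBasis n).repr (f y) S) x

/-- The coefficients of `f` are smooth on `U`. -/
def SmoothFormOn (f : Coord n → Forms n) (U : Set (Coord n)) : Prop :=
  ∀ S, ContDiffOn ℝ ∞ (fun y => (dxBasis n).repr (f y) S) U

/-- The coefficientwise partial derivative of a form. -/
def partialForm (μ : Fin n) (f : Coord n → Forms n) (x : Coord n) : Forms n :=
  ∑ S, pderiv μ (fun y => (dxBasis n).repr (f y) S) x • dxBasis n S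

theorem extD_eq_sum_dx_mul (f : Coord n → Forms n) (x : Coord n) :
    extD f x = ∑ μ, dx μ * partialForm μ f x := by
  simp only [extD, partialForm, Finset.mul_sum, mul_smul_comm]
  exact Finset.sum_comm

theorem SmoothFormOn.differentiableFormAt {U : Set (Coord n)} (hf : SmoothFormOn f U)
    (hU : IsOpen U) (hx : x ∈ U) : DifferentiableFormAt f x := fun S =>
  ((hf S).contDiffAt (hU.mem_nhds hx)).differentiableAt (by simp)

theorem pderiv_congr {F : Type*} [NormedAddCommGroup F] [NormedSpace ℝ F] {u v : Coord n → F}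
    (h : u =ᶠ[nhds x] v) (μ : Fin n) : pderiv μ u x = pderiv μ v x := by
  rw [pderiv, pderiv, h.fderiv_eq]

theorem partialForm_congr (h : f =ᶠ[nhds x] g) (μ : Fin n) :
    partialForm μ f x = partialForm μ g x := by
  refine Finset.sum_congr rfl fun S _ => ?_
  have h1 : (fun y => (dxBasis n).repr (f y) S) =ᶠ[nhds x] fun y => (dxBasis n).repr (g y) S :=
    h.fun_comp fun w => (dxBasis n).repr w S
  rw [pderiv_congr h1]

theorem extD_congr (h : f =ᶠ[nhds x] g) : extD f x = extD g x := by
  simp only [extD_eq_sum_dx_mul, partialForm_congr h]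

section SumSmul

variable {κ : Type*} {s : Finset κ} {u : κ → Coord n → ℂ} {w : κ → Forms n}

theorem repr_sum_smul (y : Coord n) (S : Finset (Fin n)) :
    (dxBasis n).repr (∑ k ∈ s, u k y • w k) S = ∑ k ∈ s, u k y * (dxBasis n).repr (w k) S := by
  simp [map_sum]

theorem differentiableFormAt_sum_smul (hu : ∀ k ∈ s, DifferentiableAt ℝ (u k) x) :
    DifferentiableFormAt (fun y => ∑ k ∈ s, u k y • w k) x := fun S => by
  simp only [repr_sum_smul]
  exact DifferentiableAt.fun_sum fun k hk => (hu k hk).mul_const _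

theorem smoothFormOn_sum_smul {U : Set (Coord n)} (hu : ∀ k ∈ s, ContDiffOn ℝ ∞ (u k) U) :
    SmoothFormOn (fun y => ∑ k ∈ s, u k y • w k) U := fun S => by
  simp only [repr_sum_smul]
  exact ContDiffOn.sum fun k hk => (hu k hk).mul contDiffOn_const

theorem partialForm_sum_smul (hu : ∀ k ∈ s, DifferentiableAt ℝ (u k) x) (μ : Fin n) :
    partialForm μ (fun y => ∑ k ∈ s, u k y • w k) x = ∑ k ∈ s, pderiv μ (u k) x • w k := by
  have h : ∀ S, pderiv μ (fun y => ∑ k ∈ s, u k y * (dxBasis n).repr (w k) S) x =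
      ∑ k ∈ s, pderiv μ (u k) x * (dxBasis n).repr (w k) S := by
    intro S
    rw [pderiv, fderiv_fun_sum fun k hk => (hu k hk).mul_const _, sum_apply]
    refine Finset.sum_congr rfl fun k hk => ?_
    rw [fderiv_mul_const (hu k hk), pderiv]
    simp [mul_comm]
  simp only [partialForm, repr_sum_smul, h, Finset.sum_smul, mul_smul]
  rw [Finset.sum_comm]
  refine Finset.sum_congr rfl fun k _ => ?_
  rw [← Finset.smul_sum, Module.Basis.sum_repr]

theorem extD_sum_smul (hu : ∀ k ∈ s, DifferentiableAt ℝ (u k) x) :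
    extD (fun y => ∑ k ∈ s, u k y • w k) x =
      ∑ k ∈ s, ∑ μ, pderiv μ (u k) x • (dx μ * w k) := by
  simp only [extD_eq_sum_dx_mul, partialForm_sum_smul hu, Finset.mul_sum, mul_smul_comm]
  exact Finset.sum_comm

end SumSmul

theorem mul_eq_sum_repr (f g : Coord n → Forms n) : (fun y => f y * g y) = fun y =>
    ∑ p : Finset (Fin n) × Finset (Fin n),
      ((dxBasis n).repr (f y) p.1 * (dxBasis n).repr (g y) p.2) •
        (dxBasis n p.1 * dxBasis n p.2) := by
  ext y : 1
  rw [Fintype.sum_prod_type]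
  conv_lhs => rw [← (dxBasis n).sum_repr (f y), ← (dxBasis n).sum_repr (g y), Finset.sum_mul_sum]
  simp only [smul_mul_smul_comm]

theorem DifferentiableFormAt.mul (hf : DifferentiableFormAt f x) (hg : DifferentiableFormAt g x) :
    DifferentiableFormAt (fun y => f y * g y) x := by
  rw [mul_eq_sum_repr]
  exact differentiableFormAt_sum_smul fun p _ => (hf p.1).mul (hg p.2)

theorem SmoothFormOn.mul {U : Set (Coord n)} (hf : SmoothFormOn f U) (hg : SmoothFormOn g U) :
    SmoothFormOn (fun y => f y * g y) U := by
  rw [mul_eq_sum_repr]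
  exact smoothFormOn_sum_smul fun p _ => (hf p.1).mul (hg p.2)

theorem partialForm_mul (hf : DifferentiableFormAt f x) (hg : DifferentiableFormAt g x)
    (μ : Fin n) : partialForm μ (fun y => f y * g y) x =
      partialForm μ f x * g x + f x * partialForm μ g x := by
  rw [mul_eq_sum_repr, partialForm_sum_smul fun p _ => (hf p.1).mul (hg p.2)]
  have h : ∀ p : Finset (Fin n) × Finset (Fin n), pderiv μ (fun y => (dxBasis n).repr (f y) p.1 *
      (dxBasis n).repr (g y) p.2) x =
      pderiv μ (fun y => (dxBasis n).repr (f y) p.1) x * (dxBasis n).repr (g x) p.2 +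
        (dxBasis n).repr (f x) p.1 * pderiv μ (fun y => (dxBasis n).repr (g y) p.2) x := by
    intro p
    rw [pderiv, fderiv_fun_mul (hf p.1) (hg p.2)]
    simp only [add_apply, smul_apply, smul_eq_mul, pderiv]
    ring
  conv_rhs => rw [← (dxBasis n).sum_repr (f x), ← (dxBasis n).sum_repr (g x)]
  change _ = (∑ S, pderiv μ (fun y => (dxBasis n).repr (f y) S) x • dxBasis n S) * _ +
    _ * ∑ S, pderiv μ (fun y => (dxBasis n).repr (g y) S) x • dxBasis n S
  rw [Finset.sum_mul_sum, Finset.sum_mul_sum, Fintype.sum_prod_type, ← Finset.sum_add_distrib]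
  refine Finset.sum_congr rfl fun S _ => ?_
  rw [← Finset.sum_add_distrib]
  refine Finset.sum_congr rfl fun T _ => ?_
  rw [smul_mul_smul_comm, smul_mul_smul_comm, ← add_smul]
  exact congrArg (· • (dxBasis n S * dxBasis n T)) (h (S, T))

theorem SmoothFormOn.sum {κ : Type*} {s : Finset κ} {f : κ → Coord n → Forms n}
    {U : Set (Coord n)} (hf : ∀ k ∈ s, SmoothFormOn (f k) U) :
    SmoothFormOn (fun y => ∑ k ∈ s, f k y) U := fun S => by
  simp only [map_sum, Finsupp.finsetSum_apply]
  exact ContDiffOn.sum fun k hk => hf k hk S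

theorem extD_sum {κ : Type*} {s : Finset κ} {f : κ → Coord n → Forms n}
    (hf : ∀ k ∈ s, DifferentiableFormAt (f k) x) :
    extD (fun y => ∑ k ∈ s, f k y) x = ∑ k ∈ s, extD (f k) x := by
  have h : ∀ S μ, pderiv μ (fun y => ∑ k ∈ s, (dxBasis n).repr (f k y) S) x =
      ∑ k ∈ s, pderiv μ (fun y => (dxBasis n).repr (f k y) S) x := fun S μ => by
    rw [pderiv, fderiv_fun_sum fun k hk => hf k hk S, sum_apply]
    rfl
  simp only [extD, map_sum, Finsupp.finsetSum_apply, h, Finset.sum_smul]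
  rw [Finset.sum_comm]
  refine (Finset.sum_congr rfl fun μ _ => Finset.sum_comm).trans ?_
  rw [Finset.sum_comm]
  exact Finset.sum_congr rfl fun k _ => Finset.sum_comm

theorem extD_add (hf : DifferentiableFormAt f x) (hg : DifferentiableFormAt g x) :
    extD (fun y => f y + g y) x = extD f x + extD g x := by
  have h := extD_sum (s := Finset.univ) (f := ![f, g]) (x := x) (by
    intro k _
    fin_cases k <;> assumption)
  simpa [Fin.sum_univ_two] using h

theorem SmoothFormOn.add {U : Set (Coord n)} (hf : SmoothFormOn f U) (hg : SmoothFormOn g U) :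
    SmoothFormOn (fun y => f y + g y) U := fun S => by
  simp only [map_add, Finsupp.add_apply]
  exact (hf S).add (hg S)

theorem smoothFormOn_const (w : Forms n) (U : Set (Coord n)) : SmoothFormOn (fun _ => w) U :=
  fun _ => contDiffOn_const

theorem extD_const (w : Forms n) : extD (fun _ : Coord n => w) x = 0 := by
  simp [extD, pderiv]

/-- The Leibniz rule before `dx_μ` is moved past the first factor. -/
theorem extD_mul (hf : DifferentiableFormAt f x) (hg : DifferentiableFormAt g x) :
    extD (fun y => f y * g y) x = extD f x * g x + ∑ μ, dx μ * f x * partialForm μ g x := by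
  simp only [extD_eq_sum_dx_mul, partialForm_mul hf hg, mul_add, Finset.sum_add_distrib,
    Finset.sum_mul, mul_assoc]

/-- Even forms are central in the exterior algebra. -/
theorem evenForms_commute (v : EvenForms n) (w : Forms n) : (v : Forms n) * w = w * v := by
  have h : evenForms n ≤ Subalgebra.center ℂ (Forms n) := by
    refine Algebra.adjoin_le ?_
    rintro _ ⟨a, b, rfl⟩
    rw [SetLike.mem_coe, Subalgebra.mem_center_iff]
    intro w
    induction w using ExteriorAlgebra.induction with
    | algebraMap r => exact Algebra.commutes _ _
    | ι c =>
      rw [← mul_assoc, ι_anticomm c a, neg_mul, mul_assoc, ι_anticomm c b, mul_neg, neg_neg,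
        mul_assoc]
    | mul x y hx hy => rw [mul_assoc, hy, ← mul_assoc, hx, mul_assoc]
    | add x y hx hy => rw [add_mul, mul_add, hx, hy]
  exact ((Subalgebra.mem_center_iff.mp (h v.2)) w).symm

theorem extD_mul_of_commute (hf : DifferentiableFormAt f x) (hg : DifferentiableFormAt g x)
    (h : ∀ μ, dx μ * f x = f x * dx μ) :
    extD (fun y => f y * g y) x = extD f x * g x + f x * extD g x := by
  rw [extD_mul hf hg, extD_eq_sum_dx_mul g, Finset.mul_sum]
  congr 1
  refine Finset.sum_congr rfl fun μ _ => ?_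
  rw [h, mul_assoc]

theorem extD_mul_of_anticommute (hf : DifferentiableFormAt f x) (hg : DifferentiableFormAt g x)
    (h : ∀ μ, dx μ * f x = -(f x * dx μ)) :
    extD (fun y => f y * g y) x = extD f x * g x - f x * extD g x := by
  rw [extD_mul hf hg, extD_eq_sum_dx_mul g, Finset.mul_sum, sub_eq_add_neg,
    ← Finset.sum_neg_distrib]
  congr 1
  refine Finset.sum_congr rfl fun μ _ => ?_
  rw [h, neg_mul, mul_assoc]

theorem dx_anticomm (μ ν : Fin n) : dx μ * dx ν = -(dx ν * dx μ) := ι_anticomm _ _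

/-- Contraction of a symmetric array with `dx_μ ∧ dx_ν` gives zero. -/
theorem sum_symm_smul_dx_mul_dx {K : Fin n → Fin n → ℂ} (hK : ∀ μ ν, K μ ν = K ν μ) :
    ∑ μ, ∑ ν, K μ ν • (dx μ * dx ν) = 0 := by
  have h : ∑ μ, ∑ ν, K μ ν • (dx μ * dx ν) = -∑ μ, ∑ ν, K μ ν • (dx μ * dx ν) := by
    conv_lhs => rw [Finset.sum_comm]
    simp only [← Finset.sum_neg_distrib]
    refine Finset.sum_congr rfl fun μ _ => Finset.sum_congr rfl fun ν _ => ?_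
    rw [dx_anticomm, hK, smul_neg]
  have h2 : (2 : ℂ) • ∑ μ, ∑ ν, K μ ν • (dx μ * dx ν) = 0 := by
    rw [two_smul]
    nth_rewrite 2 [h]
    exact add_neg_cancel _
  exact (smul_eq_zero.mp h2).resolve_left two_ne_zero

section SecondDerivatives

variable {F : Type*} [NormedAddCommGroup F] [NormedSpace ℝ F]

theorem contDiffOn_pderiv {U : Set (Coord n)} (hU : IsOpen U) {u : Coord n → F}
    (hu : ContDiffOn ℝ ∞ u U) (μ : Fin n) : ContDiffOn ℝ ∞ (pderiv μ u) U :=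
  (hu.fderiv_of_isOpen hU (by simp)).clm_apply contDiffOn_const

theorem pderiv_pderiv_comm {U : Set (Coord n)} (hU : IsOpen U) {u : Coord n → F}
    (hu : ContDiffOn ℝ ∞ u U) (hx : x ∈ U) (μ ν : Fin n) :
    pderiv μ (pderiv ν u) x = pderiv ν (pderiv μ u) x := by
  have hd : DifferentiableAt ℝ (fderiv ℝ u) x :=
    ((hu.fderiv_of_isOpen hU (m := ∞) (by simp)).contDiffAt (hU.mem_nhds hx)).differentiableAt
      (by simp)
  have h : ∀ κ ρ : Fin n, pderiv κ (pderiv ρ u) x =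
      fderiv ℝ (fderiv ℝ u) x (EuclideanSpace.single κ 1) (EuclideanSpace.single ρ 1) := by
    intro κ ρ
    have h1 : pderiv ρ u = fun y => fderiv ℝ u y (EuclideanSpace.single ρ 1) := rfl
    rw [h1, pderiv, fderiv_clm_apply hd (differentiableAt_const _)]
    simp
  rw [h, h]
  have hs : IsSymmSndFDerivAt ℝ u x :=
    (hu.contDiffAt (hU.mem_nhds hx)).isSymmSndFDerivAt (by
      rw [minSmoothness_of_isRCLikeNormedField]
      exact WithTop.coe_le_coe.mpr le_top)
  exact hs.eq _ _

end SecondDerivatives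

theorem extD_eq_sum_prod (f : Coord n → Forms n) : extD f = fun y =>
    ∑ p : Finset (Fin n) × Fin n,
      pderiv p.2 (fun y => (dxBasis n).repr (f y) p.1) y • (dx p.2 * dxBasis n p.1) := by
  ext y : 1
  rw [extD, Fintype.sum_prod_type]

theorem SmoothFormOn.extD {U : Set (Coord n)} (hU : IsOpen U) (hf : SmoothFormOn f U) :
    SmoothFormOn (extD f) U := by
  rw [extD_eq_sum_prod]
  exact smoothFormOn_sum_smul fun p _ => contDiffOn_pderiv hU (hf p.1) p.2

/-- `d² = 0`, by the symmetry of second derivatives. -/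
theorem extD_extD {U : Set (Coord n)} (hU : IsOpen U) (hf : SmoothFormOn f U) (hx : x ∈ U) :
    extD (extD f) x = 0 := by
  rw [extD_eq_sum_prod f, extD_sum_smul fun p _ =>
    ((contDiffOn_pderiv hU (hf p.1) p.2).contDiffAt (hU.mem_nhds hx)).differentiableAt (by simp),
    Fintype.sum_prod_type]
  refine Finset.sum_eq_zero fun S _ => ?_
  rw [Finset.sum_comm]
  have h := sum_symm_smul_dx_mul_dx fun μ ν => pderiv_pderiv_comm hU (hf S) hx μ ν
  have h1 := congrArg (· * dxBasis n S) h
  simp only [Finset.sum_mul, smul_mul_assoc, mul_assoc, zero_mul] at h1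
  exact h1

end Calculus

/-! ### Connections, curvature and the Bianchi identity -/

section Connections

variable {n : ℕ} {x : Coord n} {U : Set (Coord n)} {s : Type*} [Fintype s] [DecidableEq s]

/-- The entrywise exterior derivative of a matrix of forms. -/
def extDMatrix (M : Coord n → Matrix s s (Forms n)) (x : Coord n) : Matrix s s (Forms n) :=
  Matrix.of fun a b => extD (fun y => M y a b) x

/-- The entries of the matrix of forms are smooth on `U`. -/
def SmoothMatrixOn (M : Coord n → Matrix s s (Forms n)) (U : Set (Coord n)) : Prop :=
  ∀ a b, SmoothFormOn (fun y => M y a b) U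

omit [DecidableEq s] in
theorem SmoothMatrixOn.mul {M N : Coord n → Matrix s s (Forms n)} (hM : SmoothMatrixOn M U)
    (hN : SmoothMatrixOn N U) : SmoothMatrixOn (fun y => M y * N y) U := fun a b => by
  simp only [Matrix.mul_apply]
  exact SmoothFormOn.sum fun c _ => (hM a c).mul (hN c b)

omit [Fintype s] [DecidableEq s] in
theorem SmoothMatrixOn.add {M N : Coord n → Matrix s s (Forms n)} (hM : SmoothMatrixOn M U)
    (hN : SmoothMatrixOn N U) : SmoothMatrixOn (fun y => M y + N y) U := fun a b =>
  (hM a b).add (hN a b)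

omit [Fintype s] [DecidableEq s] in
theorem SmoothMatrixOn.extDMatrix {M : Coord n → Matrix s s (Forms n)} (hU : IsOpen U)
    (hM : SmoothMatrixOn M U) : SmoothMatrixOn (extDMatrix M) U := fun a b =>
  (hM a b).extD hU

omit [Fintype s] [DecidableEq s] in
theorem extDMatrix_extDMatrix {M : Coord n → Matrix s s (Forms n)} (hU : IsOpen U)
    (hM : SmoothMatrixOn M U) (hx : x ∈ U) : extDMatrix (extDMatrix M) x = 0 := by
  ext a b : 1
  exact extD_extD hU (hM a b) hx

omit [Fintype s] [DecidableEq s] in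
theorem extDMatrix_congr {M N : Coord n → Matrix s s (Forms n)} (h : M =ᶠ[nhds x] N) :
    extDMatrix M x = extDMatrix N x := by
  ext a b : 1
  exact extD_congr (h.fun_comp fun K => K a b)

omit [Fintype s] [DecidableEq s] in
theorem extDMatrix_add {M N : Coord n → Matrix s s (Forms n)} (hU : IsOpen U)
    (hM : SmoothMatrixOn M U) (hN : SmoothMatrixOn N U) (hx : x ∈ U) :
    extDMatrix (fun y => M y + N y) x = extDMatrix M x + extDMatrix N x := by
  ext a b : 1
  exact extD_add ((hM a b).differentiableFormAt hU hx) ((hN a b).differentiableFormAt hU hx)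

omit [DecidableEq s] in
/-- The Leibniz rule when the first factor has even degree. -/
theorem extDMatrix_mul_of_commute {M N : Coord n → Matrix s s (Forms n)} (hU : IsOpen U)
    (hM : SmoothMatrixOn M U) (hN : SmoothMatrixOn N U) (hx : x ∈ U)
    (h : ∀ a b μ, dx μ * M x a b = M x a b * dx μ) :
    extDMatrix (fun y => M y * N y) x = extDMatrix M x * N x + M x * extDMatrix N x := by
  ext a b : 1
  simp only [extDMatrix, Matrix.add_apply, Matrix.mul_apply, Matrix.of_apply]
  rw [extD_sum fun c _ => (((hM a c).mul (hN c b)).differentiableFormAt hU hx),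
    ← Finset.sum_add_distrib]
  exact Finset.sum_congr rfl fun c _ =>
    extD_mul_of_commute ((hM a c).differentiableFormAt hU hx)
      ((hN c b).differentiableFormAt hU hx) (h a c)

omit [DecidableEq s] in
/-- The Leibniz rule when the first factor has odd degree. -/
theorem extDMatrix_mul_of_anticommute {M N : Coord n → Matrix s s (Forms n)} (hU : IsOpen U)
    (hM : SmoothMatrixOn M U) (hN : SmoothMatrixOn N U) (hx : x ∈ U)
    (h : ∀ a b μ, dx μ * M x a b = -(M x a b * dx μ)) :
    extDMatrix (fun y => M y * N y) x = extDMatrix M x * N x - M x * extDMatrix N x := by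
  ext a b : 1
  simp only [extDMatrix, Matrix.sub_apply, Matrix.mul_apply, Matrix.of_apply]
  rw [extD_sum fun c _ => (((hM a c).mul (hN c b)).differentiableFormAt hU hx),
    ← Finset.sum_sub_distrib]
  exact Finset.sum_congr rfl fun c _ =>
    extD_mul_of_anticommute ((hM a c).differentiableFormAt hU hx)
      ((hN c b).differentiableFormAt hU hx) (h a c)

/-- The matrix of `1`-forms `∑ A_ν dx_ν`. -/
def connForm (A : Coord n → Fin n → Matrix s s ℂ) (x : Coord n) : Matrix s s (Forms n) :=
  Matrix.of fun a b => ∑ ν, A x ν a b • dx ν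

/-- A matrix of functions as a matrix of forms of degree `0`. -/
def scalarForm (n : ℕ) (g : Matrix s s ℂ) : Matrix s s (Forms n) :=
  g.map (algebraMap ℂ (Forms n))

/-- The curvature `dA + A ∧ A`, as a matrix of even forms. -/
def connCurvature (A : Coord n → Fin n → Matrix s s ℂ) (x : Coord n) :
    Matrix s s (EvenForms n) :=
  Matrix.of fun a b => ∑ μ, ∑ ν,
    (pderiv μ (fun y => A y ν a b) x + (A x μ * A x ν) a b) • dxdx μ ν

/-- The inclusion of the even forms, as a homomorphism of algebras. -/
def evenVal (n : ℕ) : EvenForms n →ₐ[ℂ] Forms n := (evenForms n).val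

omit [Fintype s] [DecidableEq s] in
theorem connForm_anticomm (A : Coord n → Fin n → Matrix s s ℂ) (a b : s) (μ : Fin n) :
    dx μ * connForm A x a b = -(connForm A x a b * dx μ) := by
  simp only [connForm, Matrix.of_apply, Finset.mul_sum, Finset.sum_mul, mul_smul_comm,
    smul_mul_assoc, ← Finset.sum_neg_distrib]
  refine Finset.sum_congr rfl fun ν _ => ?_
  rw [dx_anticomm, smul_neg]

omit [Fintype s] [DecidableEq s] in
theorem scalarForm_comm (g : Matrix s s ℂ) (a b : s) (w : Forms n) :
    w * scalarForm n g a b = scalarForm n g a b * w :=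
  (Algebra.commutes (g a b) w).symm

omit [Fintype s] [DecidableEq s] in
theorem evenVal_comm (R : Matrix s s (EvenForms n)) (a b : s) (w : Forms n) :
    w * R.map (evenVal n) a b = R.map (evenVal n) a b * w :=
  (evenForms_commute _ _).symm

omit [Fintype s] [DecidableEq s] in
theorem smoothMatrixOn_connForm {A : Coord n → Fin n → Matrix s s ℂ}
    (hA : ∀ ν a b, ContDiffOn ℝ ∞ (fun y => A y ν a b) U) : SmoothMatrixOn (connForm A) U :=
  fun a b => smoothFormOn_sum_smul (s := Finset.univ) (u := fun ν y => A y ν a b) (w := dx)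
    fun ν _ => hA ν a b

omit [Fintype s] [DecidableEq s] in
theorem smoothMatrixOn_scalarForm {g : Coord n → Matrix s s ℂ}
    (hg : ∀ a b, ContDiffOn ℝ ∞ (fun y => g y a b) U) :
    SmoothMatrixOn (fun y => scalarForm n (g y)) U := fun a b => by
  have h := smoothFormOn_sum_smul (s := {()}) (u := fun _ y => g y a b) (w := fun _ => 1)
    (fun _ _ => hg a b)
  simp only [Finset.sum_singleton, ← Algebra.algebraMap_eq_smul_one] at h
  exact h

omit [Fintype s] [DecidableEq s] in
theorem extDMatrix_scalarForm {g : Coord n → Matrix s s ℂ} (hU : IsOpen U)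
    (hg : ∀ a b, ContDiffOn ℝ ∞ (fun y => g y a b) U) (hx : x ∈ U) :
    extDMatrix (fun y => scalarForm n (g y)) x =
      connForm (fun y μ => Matrix.of fun a b => pderiv μ (fun y => g y a b) y) x := by
  ext a b : 1
  have h := extD_sum_smul (x := x) (s := {()}) (u := fun _ y => g y a b) (w := fun _ => 1)
    (fun _ _ => ((hg a b).contDiffAt (hU.mem_nhds hx)).differentiableAt (by simp))
  simp only [Finset.sum_singleton, ← Algebra.algebraMap_eq_smul_one, mul_one] at h
  exact h

omit [DecidableEq s] in
theorem connCurvature_map {A : Coord n → Fin n → Matrix s s ℂ} (hU : IsOpen U)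
    (hA : ∀ ν a b, ContDiffOn ℝ ∞ (fun y => A y ν a b) U) (hx : x ∈ U) :
    (connCurvature A x).map (evenVal n) =
      extDMatrix (connForm A) x + connForm A x * connForm A x := by
  ext a b : 1
  have h := extD_sum_smul (x := x) (s := Finset.univ) (u := fun ν y => A y ν a b) (w := dx)
    (fun ν _ => ((hA ν a b).contDiffAt (hU.mem_nhds hx)).differentiableAt (by simp))
  have h1 : extDMatrix (connForm A) x a b =
      ∑ μ, ∑ ν, pderiv μ (fun y => A y ν a b) x • (dx μ * dx ν) := by
    rw [Finset.sum_comm]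
    exact h
  have h2 : (connForm A x * connForm A x) a b =
      ∑ μ, ∑ ν, (A x μ * A x ν) a b • (dx μ * dx ν) := by
    simp only [Matrix.mul_apply, connForm, Matrix.of_apply, Finset.sum_mul_sum,
      smul_mul_smul_comm, Finset.sum_smul]
    rw [Finset.sum_comm]
    exact Finset.sum_congr rfl fun μ _ => Finset.sum_comm
  rw [Matrix.add_apply, h1, h2, Matrix.map_apply, connCurvature, Matrix.of_apply, map_sum,
    ← Finset.sum_add_distrib]
  refine Finset.sum_congr rfl fun μ _ => ?_
  rw [map_sum, ← Finset.sum_add_distrib]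
  refine Finset.sum_congr rfl fun ν _ => ?_
  rw [← add_smul, map_smul]
  rfl

omit [DecidableEq s] in
theorem smoothMatrixOn_connCurvature {A : Coord n → Fin n → Matrix s s ℂ} (hU : IsOpen U)
    (hA : ∀ ν a b, ContDiffOn ℝ ∞ (fun y => A y ν a b) U) :
    SmoothMatrixOn (fun y => (connCurvature A y).map (evenVal n)) U := by
  have h := ((smoothMatrixOn_connForm hA).extDMatrix hU).add
    ((smoothMatrixOn_connForm hA).mul (smoothMatrixOn_connForm hA))
  intro a b S
  refine (h a b S).congr fun y hy => ?_
  simp only [connCurvature_map hU hA hy]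

/-- The Bianchi identity `dR = R ∧ A - A ∧ R`. -/
theorem bianchi {A : Coord n → Fin n → Matrix s s ℂ} (hU : IsOpen U)
    (hA : ∀ ν a b, ContDiffOn ℝ ∞ (fun y => A y ν a b) U) (hx : x ∈ U) :
    extDMatrix (fun y => (connCurvature A y).map (evenVal n)) x =
      (connCurvature A x).map (evenVal n) * connForm A x -
        connForm A x * (connCurvature A x).map (evenVal n) := by
  have hs := smoothMatrixOn_connForm hA
  have h1 : extDMatrix (fun y => (connCurvature A y).map (evenVal n)) x =
      extDMatrix (fun y => extDMatrix (connForm A) y + connForm A y * connForm A y) x :=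
    extDMatrix_congr (Filter.eventually_of_mem (hU.mem_nhds hx) fun y hy =>
      connCurvature_map hU hA hy)
  rw [h1, extDMatrix_add hU (hs.extDMatrix hU) (hs.mul hs) hx,
    extDMatrix_extDMatrix hU hs hx,
    extDMatrix_mul_of_anticommute hU hs hs hx (connForm_anticomm A), connCurvature_map hU hA hx]
  noncomm_ring

theorem smoothMatrixOn_connCurvature_pow {A : Coord n → Fin n → Matrix s s ℂ} (hU : IsOpen U)
    (hA : ∀ ν a b, ContDiffOn ℝ ∞ (fun y => A y ν a b) U) (m : ℕ) :
    SmoothMatrixOn (fun y => (connCurvature A y ^ m).map (evenVal n)) U := by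
  induction m with
  | zero =>
    intro a b
    simp only [pow_zero]
    exact smoothFormOn_const ((1 : Matrix s s (EvenForms n)).map (evenVal n) a b) U
  | succ m ih =>
    simp only [pow_succ, Matrix.map_mul]
    exact ih.mul (smoothMatrixOn_connCurvature hU hA)

/-- The Bianchi identity `d(Rᵐ) = Rᵐ ∧ A - A ∧ Rᵐ` for powers, from the Leibniz rule. -/
theorem bianchi_pow {A : Coord n → Fin n → Matrix s s ℂ} (hU : IsOpen U)
    (hA : ∀ ν a b, ContDiffOn ℝ ∞ (fun y => A y ν a b) U) (hx : x ∈ U) (m : ℕ) :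
    extDMatrix (fun y => (connCurvature A y ^ m).map (evenVal n)) x =
      (connCurvature A x ^ m).map (evenVal n) * connForm A x -
        connForm A x * (connCurvature A x ^ m).map (evenVal n) := by
  induction m with
  | zero =>
    have h1 : (1 : Matrix s s (EvenForms n)).map (evenVal n) = 1 :=
      Matrix.map_one _ (map_zero _) (map_one _)
    simp only [pow_zero, h1, one_mul, mul_one, sub_self]
    ext a b : 1
    exact extD_const ((1 : Matrix s s (Forms n)) a b)
  | succ m ih =>
    simp only [pow_succ, Matrix.map_mul]
    rw [extDMatrix_mul_of_commute hU (smoothMatrixOn_connCurvature_pow hU hA m)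
      (smoothMatrixOn_connCurvature hU hA) hx (fun a b μ => evenVal_comm _ a b _), ih,
      bianchi hU hA hx]
    noncomm_ring

theorem smoothFormOn_trace_pow {A : Coord n → Fin n → Matrix s s ℂ} (hU : IsOpen U)
    (hA : ∀ ν a b, ContDiffOn ℝ ∞ (fun y => A y ν a b) U) (m : ℕ) :
    SmoothFormOn (fun y => ((connCurvature A y ^ m).trace : Forms n)) U := by
  have h := SmoothFormOn.sum (s := Finset.univ) fun a _ =>
    smoothMatrixOn_connCurvature_pow hU hA m a a
  intro S
  refine (h S).congr fun y _ => ?_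
  simp only [Matrix.trace, Matrix.diag_apply]
  change (dxBasis n).repr (evenVal n _) S = _
  rw [map_sum]
  rfl

/-- The forms `tr Rᵐ` are closed, since `tr (Rᵐ ∧ A) = tr (A ∧ Rᵐ)`. -/
theorem extD_trace_pow {A : Coord n → Fin n → Matrix s s ℂ} (hU : IsOpen U)
    (hA : ∀ ν a b, ContDiffOn ℝ ∞ (fun y => A y ν a b) U) (hx : x ∈ U) (m : ℕ) :
    extD (fun y => ((connCurvature A y ^ m).trace : Forms n)) x = 0 := by
  have h1 : (fun y => ((connCurvature A y ^ m).trace : Forms n)) = fun y =>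
      ∑ a, (connCurvature A y ^ m).map (evenVal n) a a := by
    ext y : 1
    simp only [Matrix.trace, Matrix.diag_apply]
    change evenVal n _ = _
    rw [map_sum]
    rfl
  have h2 : ∀ a, extD (fun y => (connCurvature A y ^ m).map (evenVal n) a a) x = _ := fun a =>
    congrFun (congrFun (bianchi_pow hU hA hx m) a) a
  rw [h1, extD_sum fun a _ =>
    (smoothMatrixOn_connCurvature_pow hU hA m a a).differentiableFormAt hU hx]
  simp only [h2, Matrix.sub_apply, Matrix.mul_apply, Finset.sum_sub_distrib]
  rw [sub_eq_zero, Finset.sum_comm]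
  exact Finset.sum_congr rfl fun a _ => Finset.sum_congr rfl fun b _ =>
    (evenVal_comm _ _ _ _).symm

end Connections

/-! ### Change of coordinates and gauge transformations -/

section Gauge

variable {n : ℕ} {x : Coord n} {U W : Set (Coord n)} {φ : Coord n → Coord n}

theorem pullback_dx (J : Matrix (Fin n) (Fin n) ℝ) (a : Fin n) :
    pullback J (dx a) = ∑ b, (J a b : ℂ) • dx b := by
  rw [pullback, dx, ExteriorAlgebra.map_apply_ι]
  have h : Matrix.toLin' (J.transpose.map fun t : ℝ => (t : ℂ)) (Pi.single a 1) =
      ∑ b, (J a b : ℂ) • (Pi.single b 1 : Fin n → ℂ) := by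
    ext c
    simp [Matrix.toLin'_apply, Finset.sum_apply, Pi.single_apply]
  rw [h, map_sum]
  simp only [map_smul]
  rfl

/-- The chain rule. -/
theorem pderiv_comp {F : Type*} [NormedAddCommGroup F] [NormedSpace ℝ F] {u : Coord n → F}
    (hu : DifferentiableAt ℝ u (φ x)) (hφ : DifferentiableAt ℝ φ x) (κ : Fin n) :
    pderiv κ (fun y => u (φ y)) x = ∑ ρ, jac φ x ρ κ • pderiv ρ u (φ x) := by
  have h := fderiv_comp x hu hφ
  have h1 : ∀ v : Coord n, v = ∑ ρ, v ρ • EuclideanSpace.single ρ (1 : ℝ) := fun v => by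
    have := (EuclideanSpace.basisFun (Fin n) ℝ).sum_repr v
    simpa using this.symm
  rw [pderiv]
  change fderiv ℝ (u ∘ φ) x _ = _
  rw [h, ContinuousLinearMap.comp_apply]
  conv_lhs => rw [h1 (fderiv ℝ φ x (EuclideanSpace.single κ 1)), map_sum]
  simp only [map_smul]
  rfl

theorem pderiv_ofReal {u : Coord n → ℝ} (hu : DifferentiableAt ℝ u x) (μ : Fin n) :
    pderiv μ (fun y => (u y : ℂ)) x = ((pderiv μ u x : ℝ) : ℂ) := by
  have h : HasFDerivAt (fun y => (u y : ℂ)) (Complex.ofRealCLM.comp (fderiv ℝ u x)) x :=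
    Complex.ofRealCLM.hasFDerivAt.comp x hu.hasFDerivAt
  rw [pderiv, h.fderiv]
  rfl

theorem contDiffOn_coord (hφ : ContDiffOn ℝ ∞ φ W) (ν : Fin n) :
    ContDiffOn ℝ ∞ (fun y => φ y ν) W :=
  (EuclideanSpace.proj (𝕜 := ℝ) ν).contDiff.comp_contDiffOn hφ

theorem contDiffOn_ofReal {u : Coord n → ℝ} (hu : ContDiffOn ℝ ∞ u W) :
    ContDiffOn ℝ ∞ (fun y => (u y : ℂ)) W :=
  Complex.ofRealCLM.contDiff.comp_contDiffOn hu

theorem pderiv_coord (hφ : DifferentiableAt ℝ φ x) (μ ν : Fin n) :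
    pderiv μ (fun y => φ y ν) x = jac φ x ν μ := by
  have h : HasFDerivAt (fun y => φ y ν)
      ((EuclideanSpace.proj (𝕜 := ℝ) ν).comp (fderiv ℝ φ x)) x :=
    (EuclideanSpace.proj (𝕜 := ℝ) ν).hasFDerivAt.comp x hφ.hasFDerivAt
  rw [pderiv, h.fderiv]
  rfl

theorem jac_ofReal (hφ : DifferentiableAt ℝ φ x) (μ ν : Fin n) :
    (jac φ x ν μ : ℂ) = pderiv μ (fun y => ((φ y ν : ℝ) : ℂ)) x := by
  rw [← pderiv_coord hφ, pderiv_ofReal]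
  exact ((EuclideanSpace.proj (𝕜 := ℝ) ν).hasFDerivAt.comp x hφ.hasFDerivAt).differentiableAt

theorem contDiffOn_jac (hW : IsOpen W) (hφ : ContDiffOn ℝ ∞ φ W) (μ ν : Fin n) :
    ContDiffOn ℝ ∞ (fun y => (jac φ y ν μ : ℂ)) W :=
  (contDiffOn_pderiv hW (contDiffOn_ofReal (contDiffOn_coord hφ ν)) μ).congr fun y hy =>
    jac_ofReal ((hφ.contDiffAt (hW.mem_nhds hy)).differentiableAt (by simp)) μ ν

theorem pderiv_jac_comm (hW : IsOpen W) (hφ : ContDiffOn ℝ ∞ φ W) (hx : x ∈ W) (κ μ ν : Fin n) :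
    pderiv κ (fun y => (jac φ y ν μ : ℂ)) x = pderiv μ (fun y => (jac φ y ν κ : ℂ)) x := by
  have h : ∀ μ : Fin n, (fun y => (jac φ y ν μ : ℂ)) =ᶠ[nhds x]
      pderiv μ (fun y => ((φ y ν : ℝ) : ℂ)) := fun μ =>
    Filter.eventually_of_mem (hW.mem_nhds hx) fun y hy =>
      jac_ofReal ((hφ.contDiffAt (hW.mem_nhds hy)).differentiableAt (by simp)) μ ν
  rw [pderiv_congr (h μ), pderiv_congr (h κ),
    pderiv_pderiv_comm hW (contDiffOn_ofReal (contDiffOn_coord hφ ν)) hx]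

/-- The pullback of `1`-forms commutes with the exterior derivative. -/
theorem extD_pullback_oneForm (hU : IsOpen U) (hW : IsOpen W) (hφ : ContDiffOn ℝ ∞ φ W)
    (hWU : Set.MapsTo φ W U) {a : Coord n → Fin n → ℂ}
    (ha : ∀ ν, ContDiffOn ℝ ∞ (fun y => a y ν) U) (hx : x ∈ W) :
    extD (fun y => ∑ μ, (∑ ν, (jac φ y ν μ : ℂ) * a (φ y) ν) • dx μ) x =
      pullback (jac φ x) (extD (fun y => ∑ ν, a y ν • dx ν) (φ x)) := by
  have hφx : DifferentiableAt ℝ φ x := (hφ.contDiffAt (hW.mem_nhds hx)).differentiableAt (by simp)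
  have hax : ∀ ν, DifferentiableAt ℝ (fun y => a y ν) (φ x) := fun ν =>
    ((ha ν).contDiffAt (hU.mem_nhds (hWU hx))).differentiableAt (by simp)
  have hac : ∀ ν, DifferentiableAt ℝ (fun y => a (φ y) ν) x := fun ν =>
    (hax ν).fun_comp' x hφx
  have hJ : ∀ ν μ, DifferentiableAt ℝ (fun y => (jac φ y ν μ : ℂ)) x := fun ν μ =>
    ((contDiffOn_jac hW hφ μ ν).contDiffAt (hW.mem_nhds hx)).differentiableAt (by simp)
  have hd : ∀ μ κ, pderiv κ (fun y => ∑ ν, (jac φ y ν μ : ℂ) * a (φ y) ν) x =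
      (∑ ν, pderiv κ (fun y => (jac φ y ν μ : ℂ)) x * a (φ x) ν) +
        ∑ ν, ∑ ρ, (jac φ x ρ κ : ℂ) * jac φ x ν μ * pderiv ρ (fun y => a y ν) (φ x) := by
    intro μ κ
    rw [pderiv, fderiv_fun_sum fun ν _ => (hJ ν μ).fun_mul (hac ν), sum_apply,
      ← Finset.sum_add_distrib]
    refine Finset.sum_congr rfl fun ν _ => ?_
    rw [fderiv_fun_mul (hJ ν μ) (hac ν)]
    simp only [add_apply, smul_apply, smul_eq_mul]
    have h := pderiv_comp (hax ν) hφx κ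
    rw [pderiv] at h
    rw [h, add_comm, Finset.mul_sum, mul_comm (a (φ x) ν)]
    congr 1
    refine Finset.sum_congr rfl fun ρ _ => ?_
    rw [Complex.real_smul]
    ring
  rw [extD_sum_smul fun μ _ => DifferentiableAt.fun_sum fun ν _ => (hJ ν μ).fun_mul (hac ν),
    extD_sum_smul fun ν _ => hax ν]
  simp only [hd, add_smul, Finset.sum_add_distrib]
  -- The second derivatives of `φ` are symmetric and do not contribute.
  have h0 : ∑ μ, ∑ κ, (∑ ν, pderiv κ (fun y => (jac φ y ν μ : ℂ)) x * a (φ x) ν) •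
      (dx κ * dx μ) = 0 := by
    rw [Finset.sum_comm]
    refine sum_symm_smul_dx_mul_dx fun κ μ => Finset.sum_congr rfl fun ν _ => ?_
    rw [pderiv_jac_comm hW hφ hx]
  rw [h0, zero_add]
  simp only [map_sum, map_smul, map_mul, pullback_dx, Finset.sum_mul_sum, smul_mul_smul_comm,
    Finset.smul_sum, smul_smul, Finset.sum_smul]
  calc _ = ∑ μ, ∑ κ, ∑ ν, ∑ ρ, ((jac φ x ρ κ : ℂ) * jac φ x ν μ *
      pderiv ρ (fun y => a y ν) (φ x)) • (dx κ * dx μ) := rfl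
    _ = ∑ ν, ∑ ρ, ∑ κ, ∑ μ, ((jac φ x ρ κ : ℂ) * jac φ x ν μ *
      pderiv ρ (fun y => a y ν) (φ x)) • (dx κ * dx μ) := by
        rw [Finset.sum_comm]
        refine (Finset.sum_congr rfl fun κ _ => Finset.sum_comm).trans ?_
        rw [Finset.sum_comm]
        refine Finset.sum_congr rfl fun ν _ => ?_
        refine (Finset.sum_congr rfl fun κ _ => Finset.sum_comm).trans ?_
        exact Finset.sum_comm
    _ = _ := by
        refine Finset.sum_congr rfl fun ν _ => Finset.sum_congr rfl fun ρ _ =>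
          Finset.sum_congr rfl fun κ _ => Finset.sum_congr rfl fun μ _ => ?_
        congr 1
        ring

variable {s : Type*} [Fintype s] [DecidableEq s] {A A' : Coord n → Fin n → Matrix s s ℂ}
  {g g' : Coord n → Matrix s s ℂ}

omit [DecidableEq s] in
theorem scalarForm_mul_connForm (M : Matrix s s ℂ) (A : Coord n → Fin n → Matrix s s ℂ) :
    scalarForm n M * connForm A x = connForm (fun y ν => M * A y ν) x := by
  ext a b : 1
  simp only [scalarForm, connForm, Matrix.mul_apply, Matrix.map_apply, Matrix.of_apply,
    Finset.mul_sum, Algebra.algebraMap_eq_smul_one, smul_mul_smul_comm, one_mul, Finset.sum_smul]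
  exact Finset.sum_comm

omit [DecidableEq s] in
theorem connForm_mul_scalarForm (M : Matrix s s ℂ) (A : Coord n → Fin n → Matrix s s ℂ) :
    connForm A x * scalarForm n M = connForm (fun y ν => A y ν * M) x := by
  ext a b : 1
  simp only [scalarForm, connForm, Matrix.mul_apply, Matrix.map_apply, Matrix.of_apply,
    Finset.sum_mul, Algebra.algebraMap_eq_smul_one, smul_mul_smul_comm, mul_one, Finset.sum_smul]
  exact Finset.sum_comm

/-- Under a change of coordinates `φ` and a gauge transformation `g`, the curvature matrix is
conjugated by `g`. -/
theorem pullback_connCurvature (hU : IsOpen U) (hW : IsOpen W) (hφ : ContDiffOn ℝ ∞ φ W)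
    (hWU : Set.MapsTo φ W U) (hA' : ∀ ν a b, ContDiffOn ℝ ∞ (fun y => A' y ν a b) U)
    (hA : ∀ ν a b, ContDiffOn ℝ ∞ (fun y => A y ν a b) W)
    (hg : ∀ a b, ContDiffOn ℝ ∞ (fun y => g y a b) W)
    (hg' : ∀ a b, ContDiffOn ℝ ∞ (fun y => g' y a b) W) (hgg : ∀ y ∈ W, g' y * g y = 1)
    (hgauge : ∀ y ∈ W, ∀ μ, ∑ ν, (jac φ y ν μ : ℂ) • A' (φ y) ν =
      g' y * A y μ * g y + g' y * Matrix.of fun a b => pderiv μ (fun y => g y a b) y)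
    (hx : x ∈ W) :
    ((connCurvature A' (φ x)).map (evenVal n)).map (pullback (jac φ x)) =
      scalarForm n (g' x) * (connCurvature A x).map (evenVal n) * scalarForm n (g x) := by
  set B : Coord n → Fin n → Matrix s s ℂ := fun y μ => ∑ ν, (jac φ y ν μ : ℂ) • A' (φ y) ν with hB
  have hBentry : ∀ y μ a b, B y μ a b = ∑ ν, (jac φ y ν μ : ℂ) * A' (φ y) ν a b := by
    intro y μ a b
    simp only [hB, Matrix.sum_apply, Matrix.smul_apply, smul_eq_mul]
  have h1 : (connForm A' (φ x)).map (pullback (jac φ x)) = connForm B x := by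
    ext a b : 1
    simp only [Matrix.map_apply, connForm, Matrix.of_apply, map_sum, map_smul, pullback_dx, hBentry,
      Finset.smul_sum, Finset.sum_smul, smul_smul]
    rw [Finset.sum_comm]
    refine Finset.sum_congr rfl fun μ _ => Finset.sum_congr rfl fun ν _ => ?_
    rw [mul_comm]
  have h2 : (extDMatrix (connForm A') (φ x)).map (pullback (jac φ x)) =
      extDMatrix (connForm B) x := by
    ext a b : 1
    have h := extD_pullback_oneForm hU hW hφ hWU (a := fun y ν => A' y ν a b)
      (fun ν => hA' ν a b) hx
    simp only [← hBentry] at h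
    exact h.symm
  have hsG := smoothMatrixOn_scalarForm hg
  have hsG' := smoothMatrixOn_scalarForm hg'
  have hsA := smoothMatrixOn_connForm hA
  set G := fun y => scalarForm n (g y) with hG
  set G' := fun y => scalarForm n (g' y) with hG'
  set D := extDMatrix G with hD
  have hmul : ∀ M N : Matrix s s ℂ, scalarForm n (M * N) = scalarForm n M * scalarForm n N :=
    fun M N => Matrix.map_mul
  have hG'G : ∀ y ∈ W, G' y * G y = 1 := fun y hy => by
    rw [hG, hG', ← hmul, hgg y hy]
    exact Matrix.map_one _ (map_zero _) (map_one _)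
  have hGG' : G x * G' x = 1 := by
    rw [hG, hG', ← hmul, mul_eq_one_comm.mp (hgg x hx)]
    exact Matrix.map_one _ (map_zero _) (map_one _)
  have hconn : ∀ y ∈ W, connForm B y = G' y * (connForm A y * G y) + G' y * D y := by
    intro y hy
    rw [hD, hG, extDMatrix_scalarForm hW hg hy, hG', ← mul_assoc]
    ext a b : 1
    have e : ∀ μ, B y μ a b = (g' y * A y μ * g y) a b +
        (g' y * Matrix.of fun a b => pderiv μ (fun y => g y a b) y) a b := fun μ => by
      rw [← Matrix.add_apply, ← hgauge y hy μ]
    rw [scalarForm_mul_connForm, connForm_mul_scalarForm, scalarForm_mul_connForm]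
    simp only [Matrix.add_apply, connForm, Matrix.of_apply, e, add_smul, Finset.sum_add_distrib]
  -- The derivative of `G' G = 1`.
  have hH : extDMatrix G' x * G x = -(G' x * D x) := by
    have e : extDMatrix (fun y => G' y * G y) x = extDMatrix (fun _ => 1) x :=
      extDMatrix_congr (Filter.eventually_of_mem (hW.mem_nhds hx) hG'G)
    have e0 : extDMatrix (fun _ : Coord n => (1 : Matrix s s (Forms n))) x = 0 := by
      ext a b : 1
      exact extD_const ((1 : Matrix s s (Forms n)) a b)
    rw [e0, extDMatrix_mul_of_commute hW hsG' hsG hx fun a b μ => scalarForm_comm _ _ _ _] at e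
    exact eq_neg_of_add_eq_zero_left e
  have hdB : extDMatrix (connForm B) x = extDMatrix G' x * (connForm A x * G x) +
      G' x * (extDMatrix (connForm A) x * G x - connForm A x * D x) + extDMatrix G' x * D x := by
    have hsD := hsG.extDMatrix hW
    rw [extDMatrix_congr (Filter.eventually_of_mem (hW.mem_nhds hx) hconn),
      extDMatrix_add hW (hsG'.mul (hsA.mul hsG)) (hsG'.mul hsD) hx,
      extDMatrix_mul_of_commute hW hsG' (hsA.mul hsG) hx fun a b μ => scalarForm_comm _ _ _ _,
      extDMatrix_mul_of_commute hW hsG' hsD hx fun a b μ => scalarForm_comm _ _ _ _,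
      extDMatrix_mul_of_anticommute hW hsA hsG hx (connForm_anticomm A), hD,
      extDMatrix_extDMatrix hW hsG hx, mul_zero, add_zero]
  have hmapadd : ((connCurvature A' (φ x)).map (evenVal n)).map (pullback (jac φ x)) =
      extDMatrix (connForm B) x + connForm B x * connForm B x := by
    rw [connCurvature_map hU hA' (hWU hx), ← h1, ← h2, Matrix.map_add _ (map_add _), Matrix.map_mul]
  have hBB : connForm B x * connForm B x =
      (G' x * connForm A x - extDMatrix G' x) * (connForm A x * G x + D x) := by
    have e1 : connForm B x = (G' x * connForm A x - extDMatrix G' x) * G x := by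
      rw [hconn x hx, sub_mul, hH, sub_neg_eq_add, mul_assoc]
    calc connForm B x * connForm B x =
        (G' x * connForm A x - extDMatrix G' x) * G x * connForm B x := by rw [← e1]
      _ = _ := ?_
    rw [hconn x hx, mul_assoc, mul_add (G x), ← mul_assoc (G x) (G' x), hGG', one_mul,
      ← mul_assoc (G x) (G' x), hGG', one_mul]
  rw [hmapadd, hBB, hdB, connCurvature_map hW hA hx]
  noncomm_ring

end Gauge

/-! ### Closed forms on the manifold and Chern–Weil theory -/

section ChernWeil

variable {n : ℕ} {Z : Type*} [TopologicalSpace Z] [ChartedSpace (Coord n) Z] {ι : Type*}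
  {C : ChartCover n Z ι}

theorem ChartCover.isOpen_dom (C : ChartCover n Z ι) (i : ι) : IsOpen (C.dom i) :=
  (C.chart i).open_target

theorem ChartCover.overlap_eq (C : ChartCover n Z ι) (i j : ι) :
    C.overlap i j = ((C.chart i).symm ≫ₕ C.chart j).source := by
  rw [OpenPartialHomeomorph.trans_source, OpenPartialHomeomorph.symm_source]
  rfl

theorem ChartCover.isOpen_overlap (C : ChartCover n Z ι) (i j : ι) : IsOpen (C.overlap i j) := by
  rw [C.overlap_eq]
  exact OpenPartialHomeomorph.open_source _

theorem ChartCover.overlap_subset (C : ChartCover n Z ι) (i j : ι) : C.overlap i j ⊆ C.dom i :=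
  fun _ hx => hx.1

theorem ChartCover.pt_mem (C : ChartCover n Z ι) {i j : ι} {x : Coord n}
    (hx : x ∈ C.overlap i j) : C.pt i x ∈ (C.chart i).source ∩ (C.chart j).source :=
  ⟨(C.chart i).map_target hx.1, hx.2⟩

theorem ChartCover.mapsTo_trans (C : ChartCover n Z ι) (i j : ι) :
    Set.MapsTo (C.trans i j) (C.overlap i j) (C.dom j) := fun _ hx =>
  (C.chart j).map_source hx.2

theorem ChartCover.contDiffOn_trans (C : ChartCover n Z ι) (i j : ι) :
    ContDiffOn ℝ ∞ (C.trans i j) (C.overlap i j) := by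
  have h := StructureGroupoid.compatible_of_mem_maximalAtlas (C.chart_mem i) (C.chart_mem j)
  rw [contDiffGroupoid, mem_groupoid_of_pregroupoid] at h
  have h1 := h.1
  simp only [contDiffPregroupoid, modelWithCornersSelf_coe, modelWithCornersSelf_coe_symm,
    Set.range_id, Set.inter_univ, Set.preimage_id_eq, id_eq, Function.id_comp, Function.comp_id,
    ← C.overlap_eq] at h1
  exact h1

/-- The closed complex differential forms of mixed even degree on the manifold, given by their
expressions in the charts. -/
def closedForms (C : ChartCover n Z ι) : Subalgebra ℂ (ι → Coord n → EvenForms n) where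
  carrier := {α | (∀ i, SmoothFormOn (fun x => (α i x : Forms n)) (C.dom i)) ∧
    (∀ i, ∀ x ∈ C.dom i, extD (fun y => (α i y : Forms n)) x = 0) ∧
    ∀ i j, ∀ x ∈ C.overlap i j,
      (α i x : Forms n) = pullback (jac (C.trans i j) x) (α j (C.trans i j x))}
  mul_mem' := by
    rintro α β ⟨hα, hα', hα''⟩ ⟨hβ, hβ', hβ''⟩
    refine ⟨fun i => (hα i).mul (hβ i), fun i x hx => ?_, fun i j x hx => ?_⟩
    · have h := extD_mul_of_commute ((hα i).differentiableFormAt (C.isOpen_dom i) hx)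
        ((hβ i).differentiableFormAt (C.isOpen_dom i) hx)
        fun μ => (evenForms_commute (α i x) (dx μ)).symm
      rw [hα' i x hx, hβ' i x hx, zero_mul, mul_zero, add_zero] at h
      exact h
    · change (α i x : Forms n) * (β i x : Forms n) =
        pullback _ ((α j _ : Forms n) * (β j _ : Forms n))
      rw [hα'' i j x hx, hβ'' i j x hx, map_mul]
  add_mem' := by
    rintro α β ⟨hα, hα', hα''⟩ ⟨hβ, hβ', hβ''⟩
    refine ⟨fun i => (hα i).add (hβ i), fun i x hx => ?_, fun i j x hx => ?_⟩
    · have h := extD_add ((hα i).differentiableFormAt (C.isOpen_dom i) hx)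
        ((hβ i).differentiableFormAt (C.isOpen_dom i) hx)
      rw [hα' i x hx, hβ' i x hx, add_zero] at h
      exact h
    · change (α i x : Forms n) + (β i x : Forms n) =
        pullback _ ((α j _ : Forms n) + (β j _ : Forms n))
      rw [hα'' i j x hx, hβ'' i j x hx, map_add]
  algebraMap_mem' := by
    intro z
    refine ⟨fun i => smoothFormOn_const _ _, fun i x _ => extD_const _, fun i j x _ => ?_⟩
    change algebraMap ℂ (Forms n) z = pullback _ (algebraMap ℂ (Forms n) z)
    rw [AlgHom.commutes]

theorem closedForms_congr {α β : ι → Coord n → EvenForms n} (hα : α ∈ closedForms C)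
    (h : ∀ i, ∀ x ∈ C.dom i, β i x = α i x) : β ∈ closedForms C := by
  obtain ⟨h1, h2, h3⟩ := hα
  refine ⟨fun i S => (h1 i S).congr fun x hx => by simp only [h i x hx], fun i x hx => ?_,
    fun i j x hx => ?_⟩
  · rw [← h2 i x hx]
    exact extD_congr (Filter.eventually_of_mem ((C.isOpen_dom i).mem_nhds hx) fun y hy => by
      simp only [h i y hy])
  · rw [h i x (C.overlap_subset i j hx), h j _ (C.mapsTo_trans i j hx), h3 i j x hx]

variable {s : Type*} [Fintype s] [DecidableEq s]

/-- The matrices `A i` are the connection forms, in frames over the sets of the cover, of a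
connection on a complex vector bundle. The transition functions are not required to satisfy the
cocycle condition, which plays no role for the local invariance of characteristic forms. -/
def IsConnection (C : ChartCover n Z ι) (A : ι → Coord n → Fin n → Matrix s s ℂ) : Prop :=
  (∀ i ν a b, ContDiffOn ℝ ∞ (fun y => A i y ν a b) (C.dom i)) ∧
  ∀ i j, ∃ g g' : Coord n → Matrix s s ℂ,
    (∀ a b, ContDiffOn ℝ ∞ (fun y => g y a b) (C.overlap i j)) ∧
    (∀ a b, ContDiffOn ℝ ∞ (fun y => g' y a b) (C.overlap i j)) ∧
    (∀ y ∈ C.overlap i j, g' y * g y = 1) ∧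
    ∀ y ∈ C.overlap i j, ∀ μ, ∑ ν, (jac (C.trans i j) y ν μ : ℂ) • A j (C.trans i j y) ν =
      g' y * A i y μ * g y + g' y * Matrix.of fun a b => pderiv μ (fun y => g y a b) y

/-- Chern–Weil theory: the forms `tr Rᵐ` are closed, and agree on overlaps of charts. -/
theorem IsConnection.trace_pow_mem {A : ι → Coord n → Fin n → Matrix s s ℂ}
    (hA : IsConnection C A) (m : ℕ) :
    (fun i x => (connCurvature (A i) x ^ m).trace) ∈ closedForms C := by
  refine ⟨fun i => smoothFormOn_trace_pow (C.isOpen_dom i) (hA.1 i) m,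
    fun i x hx => extD_trace_pow (C.isOpen_dom i) (hA.1 i) hx m, fun i j x hx => ?_⟩
  obtain ⟨g, g', hg, hg', hgg, hgauge⟩ := hA.2 i j
  have h := pullback_connCurvature (C.isOpen_dom j) (C.isOpen_overlap i j) (C.contDiffOn_trans i j)
    (C.mapsTo_trans i j) (hA.1 j) (fun ν a b => (hA.1 i ν a b).mono (C.overlap_subset i j)) hg hg'
    hgg hgauge hx
  set R := connCurvature (A i) x
  set R' := connCurvature (A j) (C.trans i j x)
  set G : Matrix s s (EvenForms n) := (g x).map (algebraMap ℂ (EvenForms n))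
  set G' : Matrix s s (EvenForms n) := (g' x).map (algebraMap ℂ (EvenForms n))
  have hmap : ∀ M : Matrix s s ℂ,
      (M.map (algebraMap ℂ (EvenForms n))).map (evenVal n) = scalarForm n M := fun M => by
    ext a b : 1
    exact (evenVal n).commutes (M a b)
  have h2 : (((pullback (jac (C.trans i j) x)).comp (evenVal n)).mapMatrix R') =
      (evenVal n).mapMatrix (G' * R * G) := by
    rw [map_mul, map_mul]
    simp only [AlgHom.mapMatrix_apply]
    rw [hmap, hmap, ← h]
    rfl
  have htr : ∀ (ψ : EvenForms n →ₐ[ℂ] Forms n) (M : Matrix s s (EvenForms n)),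
      (ψ.mapMatrix M).trace = ψ M.trace := fun ψ M => by
    simp [Matrix.trace]
  have hG : G' * G = 1 := by
    rw [← Matrix.map_mul, hgg x hx]
    exact Matrix.map_one _ (map_zero _) (map_one _)
  have hG' : G * G' = 1 := mul_eq_one_comm.mp hG
  have hpow : (G' * R * G) ^ m = G' * R ^ m * G := by
    clear h2
    induction m with
    | zero => rw [pow_zero, pow_zero, mul_one, hG]
    | succ m ih =>
      rw [pow_succ, ih, pow_succ]
      calc G' * R ^ m * G * (G' * R * G) = G' * R ^ m * (G * G') * R * G := by noncomm_ring
        _ = _ := by rw [hG', mul_one, mul_assoc G']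
  have h3 : pullback (jac (C.trans i j) x) (evenVal n (R' ^ m).trace) =
      evenVal n (R ^ m).trace := by
    have h4 := htr ((pullback (jac (C.trans i j) x)).comp (evenVal n)) (R' ^ m)
    rw [map_pow, h2, ← map_pow, htr, hpow, Matrix.trace_mul_comm, ← mul_assoc, hG', one_mul] at h4
    exact h4.symm
  exact h3.symm

omit [DecidableEq s] in
theorem connCurvature_mem_degreeForms (A : Coord n → Fin n → Matrix s s ℂ) (x : Coord n)
    (a b : s) : (connCurvature A x a b : Forms n) ∈ degreeForms n 2 := by
  change evenVal n (connCurvature A x a b) ∈ _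
  rw [connCurvature, Matrix.of_apply, map_sum]
  refine Submodule.sum_mem _ fun μ _ => ?_
  rw [map_sum]
  refine Submodule.sum_mem _ fun ν _ => ?_
  rw [map_smul]
  exact Submodule.smul_mem _ _ (dxdx_mem_degreeForms μ ν)

theorem trace_pow_mem_degreeForms {R : Matrix s s (EvenForms n)}
    (hR : ∀ a b, (R a b : Forms n) ∈ degreeForms n 2) (m : ℕ) :
    ((R ^ m).trace : Forms n) ∈ degreeForms n (2 * m) := by
  have h : ∀ a b, ((R ^ m) a b : Forms n) ∈ degreeForms n (2 * m) := by
    induction m with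
    | zero =>
      intro a b
      rw [pow_zero, Matrix.one_apply]
      split_ifs
      · exact one_mem_degreeForms
      · exact Submodule.zero_mem _
    | succ m ih =>
      intro a b
      rw [pow_succ, Matrix.mul_apply]
      change evenVal n _ ∈ _
      rw [map_sum]
      refine Submodule.sum_mem _ fun c _ => ?_
      rw [map_mul]
      exact mul_mem_degreeForms (ih a c) (hR c b)
  change evenVal n (∑ a, (R ^ m) a a) ∈ _
  rw [map_sum]
  exact Submodule.sum_mem _ fun a _ => h a a

theorem differentiableAt_of_contDiffOn {F : Type*} [NormedAddCommGroup F] [NormedSpace ℝ F]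
    {U : Set (Coord n)} (hU : IsOpen U) {u : Coord n → F} (hu : ContDiffOn ℝ ∞ u U) {x : Coord n}
    (hx : x ∈ U) : DifferentiableAt ℝ u x :=
  (hu.contDiffAt (hU.mem_nhds hx)).differentiableAt (by simp)

theorem dxdx_comm (μ ν : Fin n) : dxdx ν μ = -dxdx μ ν :=
  Subtype.ext (dx_anticomm ν μ)

namespace EuclideanBundle

variable {r : ℕ} (V : EuclideanBundle C r)

/-- The connection forms of the complexification. -/
def complexA (i : ι) (x : Coord n) (μ : Fin n) : Matrix (Fin r) (Fin r) ℂ :=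
  (V.A i x μ).map Complex.ofRealHom

theorem contDiffOn_complexA (i : ι) (μ : Fin n) (a b : Fin r) :
    ContDiffOn ℝ ∞ (fun x => V.complexA i x μ a b) (C.dom i) :=
  contDiffOn_ofReal (V.A_smooth i μ a b)

theorem curvature_eq {i : ι} {x : Coord n} (hx : x ∈ C.dom i) :
    V.curvature i x = connCurvature (V.complexA i) x := by
  ext a b : 1
  simp only [curvature, connCurvature, Matrix.of_apply]
  refine Finset.sum_congr rfl fun μ _ => Finset.sum_congr rfl fun ν _ => ?_
  congr 1
  have h1 : pderiv μ (fun y => V.complexA i y ν a b) x =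
      ((pderiv μ (fun y => V.A i y ν a b) x : ℝ) : ℂ) :=
    pderiv_ofReal (differentiableAt_of_contDiffOn (C.isOpen_dom i) (V.A_smooth i ν a b) hx) μ
  rw [h1, complexA, complexA, ← Matrix.map_mul, Matrix.map_apply, Complex.ofReal_add]
  rfl

theorem isConnection_complexA : IsConnection C V.complexA := by
  refine ⟨V.contDiffOn_complexA, fun i j => ⟨fun y => (V.g i j (C.pt i y)).map Complex.ofRealHom,
    fun y => (V.g i j (C.pt i y)).transpose.map Complex.ofRealHom, ?_, ?_, ?_, ?_⟩⟩
  · exact fun a b => contDiffOn_ofReal (V.g_smooth i j a b)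
  · exact fun a b => contDiffOn_ofReal (V.g_smooth i j b a)
  · intro y hy
    rw [← Matrix.map_mul]
    have h := (Matrix.mem_orthogonalGroup_iff' (Fin r) ℝ).mp (V.g_mem i j _ (C.pt_mem hy))
    change (V.g i j (C.pt i y)).transpose * _ = 1 at h
    rw [h]
    exact Matrix.map_one _ (map_zero _) (map_one _)
  · intro y hy μ
    have h := congrArg (fun M => Complex.ofRealHom.mapMatrix M) (V.A_gauge i j μ y hy)
    simp only [map_sum, map_add, map_mul] at h
    have h1 : (Matrix.of fun a b => pderiv μ (fun y => (V.g i j (C.pt i y)).map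
        Complex.ofRealHom a b) y) = Complex.ofRealHom.mapMatrix
          (Matrix.of fun a b => pderiv μ (fun y => V.g i j (C.pt i y) a b) y) := by
      ext a b : 1
      exact pderiv_ofReal (differentiableAt_of_contDiffOn (C.isOpen_overlap i j)
        (V.g_smooth i j a b) hy) μ
    have h2 : ∀ ν, (jac (C.trans i j) y ν μ : ℂ) • V.complexA j (C.trans i j y) ν =
        Complex.ofRealHom.mapMatrix
          (jac (C.trans i j) y ν μ • V.A j (C.trans i j y) ν) := fun ν => by
      ext a b : 1
      exact (Complex.ofReal_mul _ _).symm
    simp only [h1, h2]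
    exact h

theorem curvature_mem (i : ι) (x : Coord n) (a b : Fin r) :
    V.curvature i x a b ∈ positiveForms n := by
  rw [curvature, Matrix.of_apply]
  exact Ideal.sum_mem _ fun _ _ => Ideal.sum_mem _ fun _ _ => smul_mem_ideal (dxdx_mem _ _) _

theorem curvature_transpose {i : ι} {x : Coord n} (hx : x ∈ C.dom i) :
    (V.curvature i x).transpose = -V.curvature i x := by
  ext a b : 1
  rw [Matrix.transpose_apply, Matrix.neg_apply]
  simp only [curvature, Matrix.of_apply, Complex.ofReal_add, add_smul, Finset.sum_add_distrib]
  rw [neg_add]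
  congr 1
  · simp only [← Finset.sum_neg_distrib]
    refine Finset.sum_congr rfl fun μ _ => Finset.sum_congr rfl fun ν _ => ?_
    have h : (fun y => V.A i y ν b a) =ᶠ[nhds x] fun y => -V.A i y ν a b :=
      Filter.eventually_of_mem ((C.isOpen_dom i).mem_nhds hx) fun y hy =>
        congrFun (congrFun (V.A_skew i ν y hy) a) b
    have h1 : pderiv μ (fun y => -V.A i y ν a b) x = -pderiv μ (fun y => V.A i y ν a b) x := by
      rw [pderiv, fderiv_fun_neg]
      rfl
    rw [pderiv_congr h, h1, Complex.ofReal_neg, neg_smul]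
  · rw [Finset.sum_comm]
    simp only [← Finset.sum_neg_distrib]
    refine Finset.sum_congr rfl fun μ _ => Finset.sum_congr rfl fun ν _ => ?_
    have h : (V.A i x ν * V.A i x μ) b a = (V.A i x μ * V.A i x ν) a b := by
      rw [← Matrix.transpose_apply (V.A i x ν * V.A i x μ), Matrix.transpose_mul,
        V.A_skew i ν x hx, V.A_skew i μ x hx, neg_mul_neg]
    rw [h, dxdx_comm, smul_neg]

theorem powerTrace_mem_closedForms (k : ℕ) :
    (fun i x => powerTrace k (V.curvature i x)) ∈ closedForms C := by
  have h := (closedForms C).smul_mem (V.isConnection_complexA.trace_pow_mem k)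
    ((Complex.I / (2 * Real.pi)) ^ k)
  refine closedForms_congr h fun i x hx => ?_
  rw [powerTrace, V.curvature_eq hx, smul_pow, Matrix.trace_smul]
  rfl

theorem powerTrace_mem_degreeForms {i : ι} {x : Coord n} (hx : x ∈ C.dom i) (k : ℕ) :
    (powerTrace k (V.curvature i x) : Forms n) ∈ degreeForms n (2 * k) := by
  rw [V.curvature_eq hx]
  exact trace_pow_mem_degreeForms (fun a b => Submodule.smul_mem _ (Complex.I / (2 * Real.pi))
    (connCurvature_mem_degreeForms _ x a b)) k

end EuclideanBundle

namespace HermitianLineBundle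

variable (ξ : HermitianLineBundle C)

/-- The connection forms `√-1 a` as `1 × 1`-matrices. -/
def complexA (i : ι) (x : Coord n) (μ : Fin n) : Matrix Unit Unit ℂ :=
  Matrix.of fun _ _ => Complex.I * (ξ.a i x μ : ℂ)

theorem contDiffOn_complexA (i : ι) (μ : Fin n) (a b : Unit) :
    ContDiffOn ℝ ∞ (fun x => ξ.complexA i x μ a b) (C.dom i) :=
  contDiffOn_const.mul (contDiffOn_ofReal (ξ.a_smooth i μ))

theorem isConnection_complexA : IsConnection C ξ.complexA := by
  have hne : ∀ i j, ∀ y ∈ C.overlap i j, ξ.h i j (C.pt i y) ≠ 0 := fun i j y hy h0 => by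
    have h := ξ.h_norm i j _ (C.pt_mem hy)
    rw [h0, norm_zero] at h
    exact zero_ne_one h
  refine ⟨ξ.contDiffOn_complexA, fun i j => ⟨fun y => Matrix.of fun _ _ => ξ.h i j (C.pt i y),
    fun y => Matrix.of fun _ _ => (ξ.h i j (C.pt i y))⁻¹, ?_, ?_, ?_, ?_⟩⟩
  · exact fun _ _ => ξ.h_smooth i j
  · exact fun _ _ => (ξ.h_smooth i j).inv (hne i j)
  · intro y hy
    ext a b : 1
    rw [Matrix.mul_apply, Fintype.sum_unique, Matrix.one_apply, if_pos (Subsingleton.elim a b)]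
    exact inv_mul_cancel₀ (hne i j y hy)
  · intro y hy μ
    ext a b : 1
    have h := ξ.a_gauge i j μ y hy
    simp only [complexA, Matrix.sum_apply, Matrix.add_apply, Matrix.mul_apply, Matrix.of_apply,
      Fintype.sum_unique, Matrix.smul_apply, smul_eq_mul]
    rw [mul_comm (ξ.h i j (C.pt i y))⁻¹ (Complex.I * _), mul_assoc,
      inv_mul_cancel₀ (hne i j y hy), mul_one, ← h, Complex.ofReal_sum, Finset.mul_sum]
    refine Finset.sum_congr rfl fun ν _ => ?_
    rw [Complex.ofReal_mul]
    ring

/-- For a line bundle the term `A ∧ A` vanishes. -/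
theorem trace_connCurvature {i : ι} {x : Coord n} (hx : x ∈ C.dom i) :
    (connCurvature (ξ.complexA i) x).trace = Complex.I • ξ.realCurvature i x := by
  have h0 : ∑ μ, ∑ ν, (ξ.complexA i x μ * ξ.complexA i x ν) () () • dxdx μ ν = 0 := by
    refine Subtype.ext ?_
    change evenVal n _ = 0
    simp only [map_sum, map_smul]
    refine sum_symm_smul_dx_mul_dx fun μ ν => ?_
    simp only [Matrix.mul_apply, Fintype.sum_unique, complexA, Matrix.of_apply]
    ring
  have h1 : (connCurvature (ξ.complexA i) x).trace = connCurvature (ξ.complexA i) x () () :=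
    Fintype.sum_unique _
  rw [h1, connCurvature, Matrix.of_apply]
  simp only [add_smul, Finset.sum_add_distrib]
  rw [h0, add_zero, realCurvature, Finset.smul_sum]
  refine Finset.sum_congr rfl fun μ _ => ?_
  rw [Finset.smul_sum]
  refine Finset.sum_congr rfl fun ν _ => ?_
  rw [smul_smul]
  congr 1
  have hd := differentiableAt_of_contDiffOn (C.isOpen_dom i) (ξ.a_smooth i ν) hx
  have hd' := differentiableAt_of_contDiffOn (C.isOpen_dom i)
    (contDiffOn_ofReal (ξ.a_smooth i ν)) hx
  rw [← pderiv_ofReal hd]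
  change pderiv μ (fun y => Complex.I * (ξ.a i y ν : ℂ)) x = _
  rw [pderiv, fderiv_const_mul hd']
  rfl

theorem realCurvature_mem (i : ι) (x : Coord n) : ξ.realCurvature i x ∈ positiveForms n :=
  Ideal.sum_mem _ fun _ _ => Ideal.sum_mem _ fun _ _ => smul_mem_ideal (dxdx_mem _ _) _

theorem c₁_mem_closedForms : (fun i x => ξ.c₁ i x) ∈ closedForms C := by
  have h := (closedForms C).smul_mem (ξ.isConnection_complexA.trace_pow_mem 1)
    (Complex.I / (2 * Real.pi))
  refine closedForms_congr h fun i x hx => ?_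
  rw [c₁, ← ξ.trace_connCurvature hx, Pi.smul_apply, Pi.smul_apply, pow_one]

theorem c₁_mem_degreeForms {i : ι} {x : Coord n} (hx : x ∈ C.dom i) :
    (ξ.c₁ i x : Forms n) ∈ degreeForms n 2 := by
  rw [c₁, ← ξ.trace_connCurvature hx]
  have h := trace_pow_mem_degreeForms (connCurvature_mem_degreeForms (ξ.complexA i) x) 1
  rw [pow_one] at h
  exact Submodule.smul_mem _ _ h

end HermitianLineBundle

end ChernWeil

/-! ### Homogeneous components -/

section Components

variable {n : ℕ}

theorem component_add (p : ℕ) (v w : Forms n) :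
    component p (v + w) = component p v + component p w :=
  map_add _ v w

theorem component_smul (p : ℕ) (z : ℂ) (w : Forms n) :
    component p (z • w) = z • component p w := by
  simp only [component, GradedRing.proj_apply, DirectSum.decompose_smul]
  rfl

theorem component_sum {κ : Type*} (p : ℕ) (s : Finset κ) (w : κ → Forms n) :
    component p (∑ k ∈ s, w k) = ∑ k ∈ s, component p (w k) :=
  map_sum (GradedRing.proj (fun i : ℕ => ⋀[ℂ]^i (Fin n → ℂ)) p) w s

theorem component_mem (p : ℕ) (w : Forms n) : component p w ∈ degreeForms n p := by
  rw [component, GradedRing.proj_apply]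
  exact SetLike.coe_mem _

theorem component_of_mem {p : ℕ} {w : Forms n} (hw : w ∈ degreeForms n p) : component p w = w := by
  rw [component, GradedRing.proj_apply]
  exact DirectSum.decompose_of_mem_same _ hw

theorem component_of_mem_ne {p q : ℕ} {w : Forms n} (hw : w ∈ degreeForms n q) (h : q ≠ p) :
    component p w = 0 := by
  rw [component, GradedRing.proj_apply]
  exact DirectSum.decompose_of_mem_ne _ hw h

theorem dxBasis_mem (S : Finset (Fin n)) : dxBasis n S ∈ degreeForms n S.card := by
  have h := ExteriorAlgebra.basis_eq_coe_basis (Pi.basisFun ℂ (Fin n))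
    (Set.powersetCard.ofCard (rfl : S.card = S.card))
  rw [dxBasis]
  change (Pi.basisFun ℂ (Fin n)).ExteriorAlgebra S = _ at h
  rw [h]
  exact SetLike.coe_mem _

theorem map_mem_degreeForms (f : (Fin n → ℂ) →ₗ[ℂ] (Fin n → ℂ)) {p : ℕ} {w : Forms n}
    (hw : w ∈ degreeForms n p) : ExteriorAlgebra.map f w ∈ degreeForms n p := by
  have h : Submodule.map (ExteriorAlgebra.map f).toLinearMap
      (LinearMap.range (ExteriorAlgebra.ι ℂ : (Fin n → ℂ) →ₗ[ℂ] Forms n)) ≤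
        LinearMap.range (ExteriorAlgebra.ι ℂ : (Fin n → ℂ) →ₗ[ℂ] Forms n) := by
    rintro _ ⟨_, ⟨v, rfl⟩, rfl⟩
    exact ⟨f v, (ExteriorAlgebra.map_apply_ι f v).symm⟩
  have h1 := Submodule.mem_map_of_mem (f := (ExteriorAlgebra.map f).toLinearMap) hw
  rw [degreeForms, Submodule.map_pow] at h1
  exact pow_le_pow_left' h p h1

theorem component_eq_sum (p : ℕ) (w : Forms n) :
    component p w = ∑ S, (dxBasis n).repr w S • component p (dxBasis n S) := by
  conv_lhs => rw [← (dxBasis n).sum_repr w]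
  rw [component_sum]
  simp only [component_smul]

/-- Linear substitutions preserve the degree. -/
theorem component_map (f : (Fin n → ℂ) →ₗ[ℂ] (Fin n → ℂ)) (p : ℕ) (w : Forms n) :
    component p (ExteriorAlgebra.map f w) = ExteriorAlgebra.map f (component p w) := by
  rw [component_eq_sum p w]
  conv_lhs => rw [← (dxBasis n).sum_repr w]
  rw [map_sum, map_sum, component_sum]
  refine Finset.sum_congr rfl fun S _ => ?_
  rw [map_smul, map_smul, component_smul]
  congr 1
  have h := dxBasis_mem S
  by_cases hS : S.card = p
  · rw [component_of_mem (hS ▸ map_mem_degreeForms f h), component_of_mem (hS ▸ h)]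
  · rw [component_of_mem_ne (map_mem_degreeForms f h) hS, component_of_mem_ne h hS, map_zero]

theorem component_pullback (J : Matrix (Fin n) (Fin n) ℝ) (p : ℕ) (w : Forms n) :
    component p (pullback J w) = pullback J (component p w) :=
  component_map _ p w

theorem SmoothFormOn.component {f : Coord n → Forms n} {U : Set (Coord n)}
    (hf : SmoothFormOn f U) (p : ℕ) : SmoothFormOn (fun y => component p (f y)) U := by
  simp only [component_eq_sum p (f _)]
  exact smoothFormOn_sum_smul fun S _ => hf S

/-- The exterior derivative raises the degree by one. -/
theorem extD_component {f : Coord n → Forms n} {x : Coord n} (hf : DifferentiableFormAt f x)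
    (p : ℕ) : extD (fun y => component p (f y)) x = component (p + 1) (extD f x) := by
  simp only [component_eq_sum p (f _)]
  rw [extD_sum_smul fun S _ => hf S, extD, component_sum]
  refine Finset.sum_congr rfl fun S _ => ?_
  rw [component_sum]
  refine Finset.sum_congr rfl fun μ _ => ?_
  rw [component_smul]
  congr 1
  have h := dxBasis_mem S
  have h1 := mul_mem_degreeForms (dx_mem_degreeForms μ) h
  by_cases hS : S.card = p
  · rw [component_of_mem (hS ▸ h), component_of_mem (by rwa [← hS, add_comm])]
  · rw [component_of_mem_ne h hS, component_of_mem_ne h1 (by omega), mul_zero]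

/-- The automorphism of the exterior algebra that acts on forms of degree `p` by `√-1ᵖ`. -/
def rotation (n : ℕ) : Forms n →ₐ[ℂ] Forms n :=
  ExteriorAlgebra.map (Complex.I • LinearMap.id)

theorem rotation_of_mem {p : ℕ} {w : Forms n} (hw : w ∈ degreeForms n p) :
    rotation n w = Complex.I ^ p • w := by
  induction p generalizing w with
  | zero =>
    change w ∈ LinearMap.range (ExteriorAlgebra.ι ℂ) ^ 0 at hw
    rw [pow_zero, Submodule.mem_one] at hw
    obtain ⟨z, rfl⟩ := hw
    rw [AlgHom.commutes, pow_zero, one_smul]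
  | succ p ih =>
    change w ∈ LinearMap.range (ExteriorAlgebra.ι ℂ) ^ (p + 1) at hw
    rw [pow_succ] at hw
    refine Submodule.mul_induction_on hw (fun a ha b hb => ?_) fun a b ha hb => ?_
    · obtain ⟨v, rfl⟩ := hb
      rw [map_mul, ih ha, rotation, ExteriorAlgebra.map_apply_ι, pow_succ, mul_smul,
        smul_mul_assoc]
      simp
    · rw [map_add, ha, hb, smul_add]

theorem component_rotation (p : ℕ) (w : Forms n) :
    component p (rotation n w) = Complex.I ^ p • component p w := by
  rw [rotation, component_map]
  exact rotation_of_mem (component_mem p w)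

/-- The even forms that are fixed by the rotation: those with components in degrees divisible
by `4` only. -/
def fixedForms (n : ℕ) : Subalgebra ℂ (EvenForms n) :=
  AlgHom.equalizer ((rotation n).comp (evenVal n)) (evenVal n)

theorem mem_fixedForms_of_mem {p : ℕ} {w : EvenForms n}
    (hw : (w : Forms n) ∈ degreeForms n (4 * p)) : w ∈ fixedForms n := by
  change rotation n (w : Forms n) = w
  rw [rotation_of_mem hw, pow_mul, Complex.I_pow_four, one_pow, one_smul]

theorem expForm_mem_subalgebra {A : Type*} [Ring A] [Algebra ℂ A] (S : Subalgebra ℂ A) {N : ℕ}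
    {y : A} (hy : y ∈ S) : expForm N y ∈ S :=
  Subalgebra.sum_mem _ fun _ _ => S.smul_mem (S.pow_mem hy _) _

/-- In degree `4k + 2`, only the odd part of the exponential of a `2`-form contributes to a product
with a form whose degrees are divisible by `4`: the rotation changes the sign of `y` and of the
component in degree `4k + 2`. -/
theorem component_expForm_mul {k : ℕ} (hn : n = 4 * k + 2) {y G : EvenForms n}
    (hy : (y : Forms n) ∈ degreeForms n 2) (hG : G ∈ fixedForms n) :
    component n ((expForm n y * G : EvenForms n) : Forms n) =
      component n (((1 / 2 : ℂ) • (expForm n y - expForm n (-y)) * G : EvenForms n) : Forms n) := by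
  have h1 : rotation n (evenVal n (expForm n y * G)) = evenVal n (expForm n (-y) * G) := by
    have hG' : rotation n (evenVal n G) = evenVal n G := hG
    have hy' : rotation n (evenVal n y) = evenVal n (-y) := by
      rw [map_neg]
      change rotation n (y : Forms n) = -(y : Forms n)
      rw [rotation_of_mem hy, Complex.I_sq, neg_one_smul]
    have he := map_nilEval (N := n) ((rotation n).comp (evenVal n)) (PowerSeries.exp ℂ) y
    rw [AlgHom.comp_apply, AlgHom.comp_apply, hy', ← map_nilEval] at he
    rw [map_mul, map_mul, hG', map_mul, expForm_eq_nilEval, he, expForm_eq_nilEval]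
  have h2 := component_rotation n (evenVal n (expForm n y * G))
  have hI : Complex.I ^ n = -1 := by
    rw [hn, pow_add, pow_mul, Complex.I_pow_four, one_pow, one_mul, Complex.I_sq]
  rw [h1, hI, neg_one_smul] at h2
  have hval : ∀ w : EvenForms n, (w : Forms n) = evenVal n w := fun _ => rfl
  rw [hval, hval, smul_mul_assoc, map_smul, component_smul, sub_mul, sub_eq_add_neg, map_add,
    component_add,
    map_neg, ← neg_one_smul ℂ (evenVal n (expForm n (-y) * G)), component_smul, h2, neg_one_smul,
    neg_neg, ← two_smul ℂ, smul_smul]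
  norm_num

end Components

section Exactness

variable {n : ℕ} {Z : Type*} [TopologicalSpace Z] [ChartedSpace (Coord n) Z] {ι : Type*}
  {C : ChartCover n Z ι}

theorem isForm_of_mem_closedForms {α : ι → Coord n → EvenForms n} (hα : α ∈ closedForms C) {p : ℕ}
    (hp : ∀ i, ∀ x ∈ C.dom i, (α i x : Forms n) ∈ degreeForms n p) :
    IsForm C p (fun i x => (α i x : Forms n)) :=
  ⟨hp, hα.1, hα.2.2⟩

/-- The product of a closed even form and an exact form is exact. -/
theorem isExact_component_mul {q p : ℕ} {P : ι → Coord n → Forms n} (hP : IsExact C q P)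
    {α : ι → Coord n → EvenForms n} (hα : α ∈ closedForms C) :
    IsExact C p (fun i x => component (p + 1) ((α i x : Forms n) * P i x)) := by
  obtain ⟨η, ⟨-, hη, hη'⟩, hd⟩ := hP
  refine ⟨fun i x => component p ((α i x : Forms n) * η i x),
    ⟨fun i x _ => component_mem _ _, fun i => ((hα.1 i).mul (hη i)).component p,
      fun i j x hx => ?_⟩, fun i x hx => ?_⟩
  · beta_reduce
    rw [hα.2.2 i j x hx, hη' i j x hx, ← map_mul, component_pullback]
  · have hα' := (hα.1 i).differentiableFormAt (C.isOpen_dom i) hx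
    have hηx : DifferentiableFormAt (η i) x :=
      SmoothFormOn.differentiableFormAt (hη i) (C.isOpen_dom i) hx
    rw [extD_component (hα'.mul hηx), extD_mul_of_commute hα' hηx fun μ =>
      (evenForms_commute (α i x) (dx μ)).symm, hα.2.1 i x hx, zero_mul, zero_add, ← hd i x hx]

end Exactness

/-! ### Modular families of closed forms -/

section ModularFamilies

variable {n : ℕ} {Z : Type*} [TopologicalSpace Z] [ChartedSpace (Coord n) Z] {ι : Type*}
  {C : ChartCover n Z ι}

/-- The products of a modular triple of weight `p` and a closed form of degree `2p`. The degree is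
imposed on the images of the charts only, since values elsewhere are meaningless. -/
def modularGenerators (C : ChartCover n Z ι) : Set (Fin 3 → ℍ → ι → Coord n → EvenForms n) :=
  {F | ∃ (p : ℕ) (g : Fin 3 → ℍ → ℂ) (β : ι → Coord n → EvenForms n),
    IsModularTriple p g ∧ β ∈ closedForms C ∧
    (∀ i, ∀ x ∈ C.dom i, (β i x : Forms n) ∈ degreeForms n (2 * p)) ∧
    F = fun s τ i x => g s τ • β i x}

/-- The sums of products of a modular triple and a closed form, with the weight equal to half the
degree. -/
def modularFamilies (C : ChartCover n Z ι) :
    Subalgebra ℂ (Fin 3 → ℍ → ι → Coord n → EvenForms n) :=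
  (Submodule.span ℂ (modularGenerators C)).toSubalgebra
    (Submodule.subset_span ⟨0, fun _ _ => 1, 1, IsModularTriple.one, (closedForms C).one_mem,
      fun _ _ _ => one_mem_degreeForms, by
        ext s τ i x : 4
        rw [one_smul]
        rfl⟩)
    (fun F G hF hG => by
      have h : F * G ∈ Submodule.span ℂ (modularGenerators C) *
        Submodule.span ℂ (modularGenerators C) := Submodule.mul_mem_mul hF hG
      rw [Submodule.span_mul_span] at h
      refine Submodule.span_mono ?_ h
      rintro _ ⟨_, ⟨p, g, β, hg, hβ, hβp, rfl⟩, _, ⟨q, g', β', hg', hβ', hβq, rfl⟩, rfl⟩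
      refine ⟨p + q, g * g', β * β', ?_, (closedForms C).mul_mem hβ hβ', fun i x hx => ?_, ?_⟩
      · rw [Nat.cast_add]
        exact hg.mul hg'
      · rw [mul_add]
        exact mul_mem_degreeForms (hβp i x hx) (hβq i x hx)
      · ext s τ i x : 4
        exact smul_mul_smul_comm _ _ _ _)

theorem mem_modularFamilies_of_generator {F : Fin 3 → ℍ → ι → Coord n → EvenForms n}
    (hF : F ∈ modularGenerators C) : F ∈ modularFamilies C :=
  Submodule.subset_span hF

variable {l : ℕ} {c : ι → Coord n → EvenForms n}

/-- The top degree component of `½ c ∑ₛ θₛˡ Fₛ`. -/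
def topComponent (l : ℕ) (c : ι → Coord n → EvenForms n)
    (F : Fin 3 → ℍ → ι → Coord n → EvenForms n) (τ : ℍ) (i : ι) (x : Coord n) : Forms n :=
  component n ((∑ s, thetaTriple s τ ^ l • ((1 / 2 : ℂ) • c i x * F s τ i x) : EvenForms n) :
    Forms n)

/-- The sum over the three indices of a product of modular triples is a modular form. -/
theorem topComponent_generator {k : ℕ} (hn : n = 4 * k + 2) (hc : c ∈ closedForms C)
    (hc2 : ∀ i, ∀ x ∈ C.dom i, (c i x : Forms n) ∈ degreeForms n 2)
    {F : Fin 3 → ℍ → ι → Coord n → EvenForms n} (hF : F ∈ modularGenerators C) :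
    ∃ (f : ModularForm 𝒮ℒ (4 * (l : ℤ) + 2 * (k : ℤ))) (α : ι → Coord n → Forms n),
      IsForm C n α ∧ ∀ τ i, ∀ x ∈ C.dom i, topComponent l c F τ i x = f τ • α i x := by
  obtain ⟨p, g, β, hg, hβ, hβp, rfl⟩ := hF
  set α : ι → Coord n → EvenForms n := (1 / 2 : ℂ) • c * β with hα
  have hαm : α ∈ closedForms C :=
    (closedForms C).mul_mem ((closedForms C).smul_mem hc _) hβ
  have hαp : ∀ i, ∀ x ∈ C.dom i, (α i x : Forms n) ∈ degreeForms n (2 + 2 * p) := fun i x hx =>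
    mul_mem_degreeForms (Submodule.smul_mem _ (1 / 2 : ℂ) (hc2 i x hx)) (hβp i x hx)
  have hsum : ∀ τ i x, (∑ s, thetaTriple s τ ^ l •
      ((1 / 2 : ℂ) • c i x * (g s τ • β i x)) : EvenForms n) =
        (∑ s, thetaTriple s τ ^ l * g s τ) • α i x := fun τ i x => by
    rw [Finset.sum_smul]
    refine Finset.sum_congr rfl fun s _ => ?_
    rw [mul_smul_comm, smul_smul]
    rfl
  -- The form has degree `2 + 2p`, and contributes to degree `4k + 2` only for `p = 2k`; the weight is
  -- then `4l + 2k`.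
  by_cases hp : p = 2 * k
  · have hw := (isModularTriple_theta.pow l).mul hg
    have hw' : (l : ℤ) * 4 + (p : ℤ) = 4 * (l : ℤ) + 2 * (k : ℤ) := by
      rw [hp]
      push_cast
      ring
    rw [hw'] at hw
    obtain ⟨f, hf⟩ := hw.exists_modularForm
    have hdeg : 2 + 2 * p = n := by omega
    rw [hdeg] at hαp
    refine ⟨f, _, isForm_of_mem_closedForms hαm hαp, fun τ i x hx => ?_⟩
    rw [topComponent, hsum, hf]
    exact (component_smul _ _ _).trans (congrArg _ (component_of_mem (hαp i x hx)))
  · refine ⟨0, fun _ _ => 0, ⟨fun _ _ _ => Submodule.zero_mem _,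
      fun i => smoothFormOn_const _ _, fun i j x _ => (map_zero _).symm⟩, fun τ i x hx => ?_⟩
    rw [topComponent, hsum, smul_zero]
    refine (component_smul _ _ _).trans ?_
    rw [component_of_mem_ne (hαp i x hx) (by omega), smul_zero]

theorem topComponent_of_mem {k : ℕ} (hn : n = 4 * k + 2) (hc : c ∈ closedForms C)
    (hc2 : ∀ i, ∀ x ∈ C.dom i, (c i x : Forms n) ∈ degreeForms n 2)
    {F : Fin 3 → ℍ → ι → Coord n → EvenForms n} (hF : F ∈ modularFamilies C) :
    ∃ (N : ℕ) (f : Fin N → ModularForm 𝒮ℒ (4 * (l : ℤ) + 2 * (k : ℤ)))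
      (α : Fin N → ι → Coord n → Forms n), (∀ j, IsForm C n (α j)) ∧
      ∀ τ i, ∀ x ∈ C.dom i, topComponent l c F τ i x = ∑ j, f j τ • α j i x := by
  obtain ⟨N, z, G, rfl⟩ := (Submodule.mem_span_set' (s := modularGenerators C)).mp hF
  choose f α hα hf using fun j => topComponent_generator (l := l) hn hc hc2 (G j).2
  refine ⟨N, fun j => z j • f j, α, hα, fun τ i x hx => ?_⟩
  have h : (∑ s, thetaTriple s τ ^ l • ((1 / 2 : ℂ) • c i x *
      (∑ j, z j • (G j : Fin 3 → ℍ → ι → Coord n → EvenForms n)) s τ i x) : EvenForms n) =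
      ∑ j, z j • ∑ s, thetaTriple s τ ^ l • ((1 / 2 : ℂ) • c i x *
        (G j : Fin 3 → ℍ → ι → Coord n → EvenForms n) s τ i x) := by
    simp only [Finset.sum_apply, Pi.smul_apply, Finset.mul_sum, Finset.smul_sum]
    rw [Finset.sum_comm]
    refine Finset.sum_congr rfl fun j _ => Finset.sum_congr rfl fun s _ => ?_
    rw [mul_smul_comm, smul_comm]
  rw [topComponent, h]
  change component n (evenVal n _) = _
  rw [map_sum, component_sum]
  refine Finset.sum_congr rfl fun j _ => ?_
  rw [map_smul, component_smul]
  change z j • topComponent l c (G j) τ i x = (z j • f j τ) • α j i x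
  rw [hf j τ i x hx, smul_assoc]

end ModularFamilies

/-! ### The anomaly and the modularity of the top degree component -/

section Anomaly

variable {n : ℕ} {Z : Type*} [TopologicalSpace Z] [ChartedSpace (Coord n) Z] {ι : Type*}
  {C : ChartCover n Z ι} {r : ℕ}

/-- The forms `tr (√-1 R/2π)ᵏ`, for even `k`, are closed of degree `2k`, as they are for the
curvature `R` of a connection. -/
def HasClosedTraces (C : ChartCover n Z ι)
    (R : ι → Coord n → Matrix (Fin r) (Fin r) (EvenForms n)) : Prop :=
  ∀ k, Even k → (fun i x => powerTrace k (R i x)) ∈ closedForms C ∧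
    ∀ i, ∀ x ∈ C.dom i, (powerTrace k (R i x) : Forms n) ∈ degreeForms n (2 * k)

theorem EuclideanBundle.hasClosedTraces (V : EuclideanBundle C r) :
    HasClosedTraces C V.curvature :=
  fun k _ => ⟨V.powerTrace_mem_closedForms k, fun _ _ hx => V.powerTrace_mem_degreeForms hx k⟩

theorem HermitianLineBundle.hasClosedTraces (ξ : HermitianLineBundle C) :
    HasClosedTraces C ξ.curvatureReal := by
  have h : ∀ k, Even k → ∀ i x, powerTrace k (ξ.curvatureReal i x) = (2 : ℂ) • ξ.c₁ i x ^ k :=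
    fun k hk i x => powerTrace_planeCurvature _ hk
  refine fun k hk => ⟨?_, fun i x hx => ?_⟩
  · simp only [h k hk]
    exact (closedForms C).smul_mem ((closedForms C).pow_mem ξ.c₁_mem_closedForms k) 2
  · have hpow : ((ξ.c₁ i x ^ k : EvenForms n) : Forms n) ∈ degreeForms n (2 * k) := by
      have := Submodule.pow_mem_pow _ (ξ.c₁_mem_degreeForms hx) k
      rw [degreeForms, ← pow_mul] at this
      exact this
    rw [h k hk]
    exact Submodule.smul_mem _ (2 : ℂ) hpow

section Traces

variable {R : ι → Coord n → Matrix (Fin r) (Fin r) (EvenForms n)}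

theorem HasClosedTraces.traceSum_mem_closedForms (hR : HasClosedTraces C R) (a : ℕ → ℂ) :
    (fun i x => traceSum a (R i x)) ∈ closedForms C := by
  have h : (fun i x => traceSum a (R i x)) =
      ∑ k ∈ evenDegrees n, (a k / k.factorial) • fun i x => powerTrace k (R i x) := by
    ext i x : 2
    simp only [traceSum, Finset.sum_apply, Pi.smul_apply]
  rw [h]
  exact Subalgebra.sum_mem _ fun k hk => (closedForms C).smul_mem
    (hR k (even_of_mem_evenDegrees hk).1).1 _

theorem HasClosedTraces.traceSum_mem_fixedForms (hR : HasClosedTraces C R) (a : ℕ → ℂ) {i : ι}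
    {x : Coord n} (hx : x ∈ C.dom i) : traceSum a (R i x) ∈ fixedForms n := by
  refine Subalgebra.sum_mem _ fun k hk => (fixedForms n).smul_mem ?_ _
  have hk' := (even_of_mem_evenDegrees hk).1
  have h := (hR k hk').2 i x hx
  obtain ⟨m, rfl⟩ := hk'
  exact mem_fixedForms_of_mem (p := m) (by rwa [show 2 * (m + m) = 4 * m by ring] at h)

theorem HasClosedTraces.traceSum_mem_modularFamilies (hR : HasClosedTraces C R)
    {a : ℕ → Fin 3 → ℍ → ℂ} (ha : ∀ k : ℕ, Even k → k ≠ 0 → IsModularTriple k (a k)) :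
    (fun s τ i x => traceSum (fun k => a k s τ) (R i x)) ∈ modularFamilies C := by
  have h : (fun s τ i x => traceSum (fun k => a k s τ) (R i x)) = ∑ k ∈ evenDegrees n,
      ((k.factorial : ℂ)⁻¹) • fun s τ i x => a k s τ • powerTrace k (R i x) := by
    ext s τ i x : 4
    simp only [traceSum, Finset.sum_apply, Pi.smul_apply, smul_smul, div_eq_inv_mul]
  rw [h]
  refine Subalgebra.sum_mem _ fun k hk => (modularFamilies C).smul_mem ?_ _
  obtain ⟨hk, hk0⟩ := even_of_mem_evenDegrees hk
  exact mem_modularFamilies_of_generator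
    ⟨k, a k, _, ha k hk hk0, (hR k hk).1, (hR k hk).2, rfl⟩

end Traces

/-- The quasimodular term `eis 2` in weight two, and zero in the other weights. -/
def eisAnomaly (τ : ℍ) (k : ℕ) : ℂ := if k = 2 then eis 2 τ else 0

theorem isModularTriple_eis_sub_eisAnomaly {k : ℕ} (hk : Even k) (hk0 : k ≠ 0) :
    IsModularTriple k (fun _ τ => eis k τ - eisAnomaly τ k) := by
  rcases eq_or_ne k 2 with rfl | h2
  · have h := (isModularTriple_eisTriple_two).const_smul 0
    rw [zero_smul] at h
    have h0 : (0 : Fin 3 → ℍ → ℂ) = fun _ τ => eis 2 τ - eisAnomaly τ 2 := by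
      ext s τ
      simp [eisAnomaly]
    rwa [h0] at h
  · have hk3 : 3 ≤ k := by
      obtain ⟨m, rfl⟩ := hk
      omega
    simpa only [eisAnomaly, if_neg h2, sub_zero] using isModularTriple_eis hk3 hk

theorem isModularTriple_eisTriple_add_eisAnomaly {k : ℕ} (hk : Even k) (hk0 : k ≠ 0) :
    IsModularTriple k (fun s τ => eisTriple k s τ + eisAnomaly τ k) := by
  rcases eq_or_ne k 2 with rfl | h2
  · exact isModularTriple_eisTriple_two
  · have hk3 : 3 ≤ k := by
      obtain ⟨m, rfl⟩ := hk
      omega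
    simpa only [eisAnomaly, if_neg h2, add_zero] using isModularTriple_eisTriple hk3 hk

theorem p₁_eq (R : Matrix (Fin r) (Fin r) (EvenForms n)) : p₁ R = (1 / 2 : ℂ) • powerTrace 2 R := by
  rw [p₁, powerTrace, smul_pow, Matrix.trace_smul, smul_smul, ← sq]
  congr 1
  rw [div_pow, Complex.I_sq, mul_pow]
  ring

theorem traceSum_eisAnomaly (hn : 2 ≤ n) (R : Matrix (Fin r) (Fin r) (EvenForms n)) (τ : ℍ) :
    traceSum (eisAnomaly τ) R = eis 2 τ • p₁ R := by
  rw [traceSum, Finset.sum_eq_single 2]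
  · rw [p₁_eq, smul_smul, eisAnomaly, if_pos rfl]
    norm_num
    ring_nf
  · intro k _ hk
    rw [eisAnomaly, if_neg hk, zero_div, zero_smul]
  · intro h
    exact absurd (Finset.mem_filter.mpr ⟨Finset.mem_range.mpr (by omega), even_two, two_ne_zero⟩) h

/-- The part of the exponential series after the constant term, divided by the variable. -/
def expTail (n : ℕ) {B : Type*} [Ring B] [Algebra ℂ B] (X : B) : B :=
  ∑ j ∈ Finset.range n, (((j + 1).factorial : ℂ)⁻¹) • X ^ j

theorem expForm_eq_one_add {B : Type*} [Ring B] [Algebra ℂ B] (X : B) :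
    expForm n X = 1 + expTail n X * X := by
  rw [expForm, Finset.sum_range_succ', expTail, Finset.sum_mul, add_comm]
  congr 1
  · simp
  · exact Finset.sum_congr rfl fun j _ => by rw [smul_mul_assoc, pow_succ]

theorem expTail_mem_subalgebra {A : Type*} [Ring A] [Algebra ℂ A] (S : Subalgebra ℂ A) {N : ℕ}
    {y : A} (hy : y ∈ S) : expTail N y ∈ S :=
  Subalgebra.sum_mem _ fun _ _ => S.smul_mem (S.pow_mem hy _) _

section Exponent

variable (T : TangentConnection C) (ξ : HermitianLineBundle C) {l : ℕ}
  (V : EuclideanBundle C (16 * l))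

/-- The exponent of the contribution of the `s`-th theta function, without the multiple of
`-p₁(Z) + p₁(ξ_ℝ) + p₁(V)` that obstructs its modularity. -/
def modularExponent (s : Fin 3) (τ : ℍ) (i : ι) (x : Coord n) : EvenForms n :=
  traceSum (fun k => eis k τ - eisAnomaly τ k) (T.curvature i x) -
    traceSum (fun k => eis k τ - eisAnomaly τ k) (ξ.curvatureReal i x) +
    traceSum (fun k => eisTriple k s τ + eisAnomaly τ k) (V.curvature i x)

theorem modularExponent_mem_modularFamilies : modularExponent T ξ V ∈ modularFamilies C :=
  (modularFamilies C).add_mem ((modularFamilies C).sub_mem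
    (T.hasClosedTraces.traceSum_mem_modularFamilies
      (a := fun k _ τ => eis k τ - eisAnomaly τ k)
      fun _k hk hk0 => isModularTriple_eis_sub_eisAnomaly hk hk0)
    (ξ.hasClosedTraces.traceSum_mem_modularFamilies
      (a := fun k _ τ => eis k τ - eisAnomaly τ k)
      fun _k hk hk0 => isModularTriple_eis_sub_eisAnomaly hk hk0))
    (V.hasClosedTraces.traceSum_mem_modularFamilies
      (a := fun k s τ => eisTriple k s τ + eisAnomaly τ k)
      fun _k hk hk0 => isModularTriple_eisTriple_add_eisAnomaly hk hk0)

theorem modularExponent_mem_closedForms (s : Fin 3) (τ : ℍ) :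
    modularExponent T ξ V s τ ∈ closedForms C :=
  (closedForms C).add_mem ((closedForms C).sub_mem
    (T.hasClosedTraces.traceSum_mem_closedForms _) (ξ.hasClosedTraces.traceSum_mem_closedForms _))
    (V.hasClosedTraces.traceSum_mem_closedForms _)

theorem modularExponent_mem_positiveForms (s : Fin 3) (τ : ℍ) (i : ι) (x : Coord n) :
    modularExponent T ξ V s τ i x ∈ positiveForms n :=
  Ideal.add_mem _ (Ideal.sub_mem _ (traceSum_mem (T.curvature_mem i x) _)
    (traceSum_mem (planeCurvature_mem (ξ.realCurvature_mem i x)) _))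
    (traceSum_mem (V.curvature_mem i x) _)

/-- The even form `-p₁(Z) + p₁(ξ_ℝ) + p₁(V)`. -/
def evenPontryaginSum (i : ι) (x : Coord n) : EvenForms n :=
  -p₁ (T.curvature i x) + p₁ (ξ.curvatureReal i x) + p₁ (V.curvature i x)

theorem p₁_mem {R : Matrix (Fin r) (Fin r) (EvenForms n)} (hR : ∀ a b, R a b ∈ positiveForms n) :
    p₁ R ∈ positiveForms n := by
  rw [p₁_eq]
  exact smul_mem_ideal (powerTrace_mem hR two_ne_zero) _

theorem evenPontryaginSum_mem_positiveForms (i : ι) (x : Coord n) :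
    evenPontryaginSum T ξ V i x ∈ positiveForms n :=
  Ideal.add_mem _ (Ideal.add_mem _ (neg_mem (p₁_mem (T.curvature_mem i x)))
    (p₁_mem (planeCurvature_mem (ξ.realCurvature_mem i x)))) (p₁_mem (V.curvature_mem i x))

theorem HasClosedTraces.p₁_mem_closedForms
    {R : ι → Coord n → Matrix (Fin r) (Fin r) (EvenForms n)} (hR : HasClosedTraces C R) :
    (fun i x => p₁ (R i x)) ∈ closedForms C := by
  simp only [p₁_eq]
  exact (closedForms C).smul_mem (hR 2 even_two).1 _

theorem evenPontryaginSum_mem_closedForms : evenPontryaginSum T ξ V ∈ closedForms C :=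
  (closedForms C).add_mem ((closedForms C).add_mem
    ((closedForms C).neg_mem T.hasClosedTraces.p₁_mem_closedForms)
    ξ.hasClosedTraces.p₁_mem_closedForms) V.hasClosedTraces.p₁_mem_closedForms

/-- Only the quasimodular Eisenstein series in weight two separates the exponent from a modular one,
and its coefficients combine to the form `-p₁(Z) + p₁(ξ_ℝ) + p₁(V)`. -/
theorem exponent_eq (hn : 2 ≤ n) (s : Fin 3) (τ : ℍ) (i : ι) (x : Coord n) :
    traceSum (fun k => eis k τ) (T.curvature i x) -
      traceSum (fun k => eis k τ) (ξ.curvatureReal i x) +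
      traceSum (fun k => eisTriple k s τ) (V.curvature i x) =
    modularExponent T ξ V s τ i x + -(eis 2 τ • evenPontryaginSum T ξ V i x) := by
  have h1 : ∀ {r : ℕ} (R : Matrix (Fin r) (Fin r) (EvenForms n)) (a : ℕ → ℂ),
      traceSum (fun k => a k - eisAnomaly τ k) R = traceSum a R - eis 2 τ • p₁ R := fun R a => by
    simp only [sub_eq_add_neg]
    rw [traceSum_add, traceSum_neg, traceSum_eisAnomaly hn]
  have h2 : ∀ {r : ℕ} (R : Matrix (Fin r) (Fin r) (EvenForms n)) (a : ℕ → ℂ),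
      traceSum (fun k => a k + eisAnomaly τ k) R = traceSum a R + eis 2 τ • p₁ R := fun R a => by
    rw [traceSum_add, traceSum_eisAnomaly hn]
  rw [modularExponent, evenPontryaginSum, h1, h1, h2, smul_add, smul_add, smul_neg]
  abel

/-- The degrees of `e^{c/2}` that contribute are odd multiples of two, and `sinh (c/2)` supplies the
Bernoulli numbers missing from the Eisenstein series of `ξ_ℝ`. -/
theorem Q₁_eq {k : ℕ} (hn : n = 4 * k + 2) (τ : ℍ) {i : ι} {x : Coord n} (hx : x ∈ C.dom i) :
    Q₁ T ξ V τ i x = component n ((∑ s, thetaTriple s τ ^ l • ((1 / 2 : ℂ) • ξ.c₁ i x *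
      expForm n (modularExponent T ξ V s τ i x + -(eis 2 τ • evenPontryaginSum T ξ V i x))) :
        EvenForms n) : Forms n) := by
  have hF := ξ.realCurvature_mem i x
  have hT := T.curvature_mem i x
  have hV := V.curvature_mem i x
  have hξ : ∀ a b, ξ.curvatureReal i x a b ∈ positiveForms n := planeCurvature_mem hF
  have hfix : ∀ {r : ℕ} {R : ι → Coord n → Matrix (Fin r) (Fin r) (EvenForms n)},
      HasClosedTraces C R → ∀ a, expForm n (traceSum a (R i x)) ∈ fixedForms n :=
    fun hR a => expForm_mem_subalgebra _ (hR.traceSum_mem_fixedForms a hx)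
  have hc2 : (((1 / 2 : ℂ) • ξ.c₁ i x : EvenForms n) : Forms n) ∈ degreeForms n 2 :=
    Submodule.smul_mem _ (1 / 2 : ℂ) (ξ.c₁_mem_degreeForms hx)
  change component n ((Q₁Integrand l (T.curvature i x) (ξ.c₁ i x)
    (planeCurvature (ξ.realCurvature i x)) (V.curvature i x) τ : EvenForms n) : Forms n) = _
  rw [Q₁Integrand_eq (T.curvature_transpose hx) hT (V.curvature_transpose hx) hV hF,
    component_expForm_mul hn hc2, sinh_eq_expForm hF (c := ξ.c₁ i x) rfl]
  · rw [show planeCurvature (ξ.realCurvature i x) = ξ.curvatureReal i x from rfl]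
    congr 2
    rw [Finset.mul_sum, Finset.mul_sum]
    refine Finset.sum_congr rfl fun s _ => ?_
    rw [mul_smul_comm, mul_smul_comm, ← exponent_eq T ξ V (by omega),
      expForm_add_of_mem (Ideal.sub_mem _ (traceSum_mem hT _) (traceSum_mem hξ _))
        (traceSum_mem hV _), sub_eq_add_neg,
      expForm_add_of_mem (traceSum_mem hT _) (neg_mem (traceSum_mem hξ _))]
    have h : expForm n (-traceSum (fun k => eis k τ) (ξ.curvatureReal i x)) =
        expForm n (traceSum (fun k => (bernoulli k : ℂ) / (2 * k))
          (ξ.curvatureReal i x)) *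
        expForm n (traceSum (fun k => -lambert (k - 1) (Function.Periodic.qParam 1 (τ : ℂ)))
          (ξ.curvatureReal i x)) := by
      rw [← expForm_add_of_mem (traceSum_mem hξ _) (traceSum_mem hξ _), ← traceSum_add,
        ← traceSum_neg]
      congr 2
      ext k
      rw [eis]
      ring
    rw [h]
    congr 1
    ring
  · exact (fixedForms n).mul_mem ((fixedForms n).mul_mem (hfix T.hasClosedTraces _)
      (hfix ξ.hasClosedTraces _)) (Subalgebra.sum_mem _ fun s _ =>
        (fixedForms n).smul_mem (hfix V.hasClosedTraces _) _)

/-- The closed form whose product with `-p₁(Z) + p₁(ξ_ℝ) + p₁(V)` is the part of `Q₁` that is not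
modular. -/
def anomalyForm (τ : ℍ) (i : ι) (x : Coord n) : EvenForms n :=
  ∑ s, thetaTriple s τ ^ l • ((1 / 2 : ℂ) • ξ.c₁ i x * expForm n (modularExponent T ξ V s τ i x) *
    (-eis 2 τ) • expTail n ((-eis 2 τ) • evenPontryaginSum T ξ V i x))

theorem expForm_apply (α : ι → Coord n → EvenForms n) (i : ι) (x : Coord n) :
    expForm n α i x = expForm n (α i x) := by
  simp only [expForm, Finset.sum_apply, Pi.smul_apply, Pi.pow_apply]

theorem expTail_apply (α : ι → Coord n → EvenForms n) (i : ι) (x : Coord n) :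
    expTail n α i x = expTail n (α i x) := by
  simp only [expTail, Finset.sum_apply, Pi.smul_apply, Pi.pow_apply]

theorem anomalyForm_mem_closedForms (τ : ℍ) : anomalyForm T ξ V τ ∈ closedForms C := by
  have h : anomalyForm T ξ V τ = ∑ s, thetaTriple s τ ^ l • ((1 / 2 : ℂ) • (fun i x => ξ.c₁ i x) *
      expForm n (modularExponent T ξ V s τ) *
      (-eis 2 τ) • expTail n ((-eis 2 τ) • evenPontryaginSum T ξ V)) := by
    ext i x : 2
    simp only [anomalyForm, Finset.sum_apply, Pi.smul_apply, Pi.mul_apply, expForm_apply,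
      expTail_apply]
  rw [h]
  refine Subalgebra.sum_mem _ fun s _ => (closedForms C).smul_mem ((closedForms C).mul_mem
    ((closedForms C).mul_mem ((closedForms C).smul_mem ξ.c₁_mem_closedForms _) ?_)
    ((closedForms C).smul_mem ?_ _)) _
  · exact expForm_mem_subalgebra _ (modularExponent_mem_closedForms T ξ V s τ)
  · exact expTail_mem_subalgebra _
      ((closedForms C).smul_mem (evenPontryaginSum_mem_closedForms T ξ V) _)

/-- `Q₁` differs from its modular part by a closed multiple of `-p₁(Z) + p₁(ξ_ℝ) + p₁(V)`, because
`eˣ - 1` is divisible by `x`. -/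
theorem Q₁_sub_topComponent {k : ℕ} (hn : n = 4 * k + 2) (τ : ℍ) {i : ι} {x : Coord n}
    (hx : x ∈ C.dom i) :
    Q₁ T ξ V τ i x -
        topComponent l (fun i x => ξ.c₁ i x) (expForm n (modularExponent T ξ V)) τ i x =
      component n ((anomalyForm T ξ V τ i x : Forms n) * pontryaginSum T ξ V i x) := by
  have hexp : ∀ s, expForm n (modularExponent T ξ V) s τ i x =
      expForm n (modularExponent T ξ V s τ i x) := fun s => by
    simp only [expForm, Finset.sum_apply, Pi.smul_apply, Pi.pow_apply]
  have h : (∑ s, thetaTriple s τ ^ l • ((1 / 2 : ℂ) • ξ.c₁ i x * expForm n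
      (modularExponent T ξ V s τ i x + -(eis 2 τ • evenPontryaginSum T ξ V i x))) : EvenForms n) =
      anomalyForm T ξ V τ i x * evenPontryaginSum T ξ V i x +
        ∑ s, thetaTriple s τ ^ l • ((1 / 2 : ℂ) • ξ.c₁ i x *
          expForm n (modularExponent T ξ V) s τ i x) := by
    rw [anomalyForm, Finset.sum_mul, ← Finset.sum_add_distrib]
    refine Finset.sum_congr rfl fun s _ => ?_
    rw [hexp, expForm_add_of_mem (modularExponent_mem_positiveForms T ξ V s τ i x)
      (neg_mem (smul_mem_ideal (evenPontryaginSum_mem_positiveForms T ξ V i x) _)),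
      expForm_eq_one_add (-(_ : EvenForms n)), ← neg_smul,
      smul_mul_assoc (thetaTriple s τ ^ l), ← smul_add]
    congr 1
    simp only [mul_smul_comm, smul_mul_assoc, mul_add, mul_one, mul_assoc]
    exact add_comm _ _
  rw [Q₁_eq T ξ V hn τ hx, h, topComponent, sub_eq_iff_eq_add, ← component_add]
  rfl

end Exponent

/-- The values outside the images of the charts are irrelevant. -/
theorem IsExact.congr {p : ℕ} {α β : ι → Coord n → Forms n} (hα : IsExact C p α)
    (h : ∀ i, ∀ x ∈ C.dom i, β i x = α i x) : IsExact C p β := by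
  obtain ⟨η, hη, hd⟩ := hα
  exact ⟨η, hη, fun i x hx => (h i x hx).trans (hd i x hx)⟩

end Anomaly

end SpincModular
end

theorem lemma2p6 {k l : ℕ} {Z : Type*} [TopologicalSpace Z]
    [ChartedSpace (EuclideanSpace ℝ (Fin (4 * k + 2))) Z]
    [IsManifold (𝓡 (4 * k + 2)) ∞ Z] {ι : Type*}
    (C : SpincModular.ChartCover (4 * k + 2) Z ι)
    (T : SpincModular.TangentConnection C)
    (ξ : SpincModular.HermitianLineBundle C)
    (_spinc : SpincModular.SpincStructure T.toEuclideanBundle ξ)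
    (V : SpincModular.EuclideanBundle C (16 * l))
    (_spin : SpincModular.SpinStructure V)
    (hp : SpincModular.IsExact C 3 (SpincModular.pontryaginSum T ξ V)) :
    SpincModular.IsModularInCohomology C (4 * k + 1) (4 * (l : ℤ) + 2 * (k : ℤ))
      (SpincModular.Q₁ T ξ V) := by
  have hcT := SpincModular.expForm_mem_subalgebra _ (N := 4 * k + 2)
    (SpincModular.modularExponent_mem_modularFamilies T ξ V)
  obtain ⟨N, f, α, hα, h⟩ := SpincModular.topComponent_of_mem (l := l) (k := k) rfl
    ξ.c₁_mem_closedForms (fun _ _ hx => ξ.c₁_mem_degreeForms hx) hcT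
  refine ⟨N, f, α, hα, fun τ => ?_⟩
  refine (SpincModular.isExact_component_mul hp
    (SpincModular.anomalyForm_mem_closedForms T ξ V τ)).congr fun i x hx => ?_
  rw [← h τ i x hx]
  exact SpincModular.Q₁_sub_topComponent T ξ V rfl τ hx
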